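/- **Setting.** Let $\Omega\subset\mathbb R^2$ be a bounded Lipschitz open set and let $\mathcal M$ be a finite rectangular mesh of $\Omega$: a finite set of pairwise disjoint open axis-parallel rectangles $K\subset\Omega$ with $\bigcup_{K\in\mathcal M}\bar K=\bar\Omega$. Let $h_K=\operatorname{diam}K$ and let $\mathcal E^{\rm side}$ be the set of all $e=\partial K\cap\partial K'$ with $K\ne K'$ in $\mathcal M$ that contain more than one point. Hanging nodes are allowed in the usual sense: each $e=\partial K\cap\partial K'\in\mathcal E^{\rm side}$ is a whole side of $K$ or of $K'$ (and possibly only a part of a side of the other element). On such an $e$ put $h|_e=(h_K+h_{K'})/2$, and for $v\in\mathbb V_p(\mathcal M)=\prod_{K\in\mathcal M}Q_p(K)$ (polynomials of degree at most $p$ in each variable on each element) let $[\![v]\!]_e=\pm(v|_K-v|_{K'})$ be the jump of the traces. A vertex of an element is a *conforming node* if it lies on $\partial\Omega$ or is a vertex of four elements; let $\mathcal N^0$ be the set of conforming nodes. Assume that for constants $\kappa,C_0$: * (shape regularity) the ratio of the side lengths of each $K\in\mathcal M$ is at most $\kappa$; * ($K$-mesh) for each $P\in\mathcal N^0$ there is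 a nodal basis function $\psi_P\in C(\bar\Omega)$, bilinear on each element, with $\psi_P(Q)=\delta_{PQ}$ for all $Q\in\mathcal N^0$, and $\operatorname{diam}(\operatorname{supp}\psi_P)\le C_0\,h_K$ for every $K\in\mathcal M$ with $K\subset\operatorname{supp}\psi_P$. **Lemma.** There is a constant $C>0$ depending only on $\kappa$ and $C_0$ (in particular not on $h_K$ and $p$) such that for every such $\Omega$ and $\mathcal M$ one can choose, for each $K\in\mathcal M$, a set of elements $\widetilde\omega(K)\subset\mathcal M$ including $K$, whose union has diameter at most $Ch_K$, with the following property. Let $\sigma(K)$ be the set of all $e\in\mathcal E^{\rm side}$ contained in $\bigcup_{K'\in\widetilde\omega(K)}\overline{K'}$. For every integer $p\ge1$ there is a linear operator $\pi_h:\mathbb V_p(\mathcal M)\to\mathbb V_p(\mathcal M)\cap H^1(\Omega)$ such that for all $v\in\mathbb V_p(\mathcal M)$ and $K\in\mathcal M$ $$\|v-\pi_hv\|_{L^2(K)}\le C\,\|p^{-1}h^{1/2}[\![v]\!]\|_{L^2(\sigma(K))},\qquad \|\nabla(v-\pi_hv)\|_{L^2(K)}\le C\,\|p\,h^{-1/2}[\![v]\!]\|_{L^2(\sigma(K))},$$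 where $\|w\|_{L^2(\sigma(K))}^2=\sum_{e\in\sigma(K)}\int_e|w|^2\,ds$. Moreover, $\pi_hv\in H^1_0(\Omega)$ whenever $v=0$ on $\partial\Omega$, that is, whenever for each $K$ the trace of $v|_K$ vanishes a.e. on $\partial K\cap\partial\Omega$. -/

import Mathlib

open MeasureTheory Set Filter Topology
open scoped ContDiff NNReal ENNReal

noncomputable section

/-- The Euclidean plane. -/
abbrev Plane : Type := EuclideanSpace ℝ (Fin 2)

/-! ### Lipschitz domains and Sobolev spaces -/

/-- Bounded open sets whose boundary is, near each of its points and after a rotation or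
reflection of the plane, the graph of a Lipschitz function with the set on one side of it.
(Connectedness is not required.) -/
def IsBoundedLipschitz (Ω : Set Plane) : Prop :=
  IsOpen Ω ∧ Bornology.IsBounded Ω ∧
    ∀ x ∈ frontier Ω, ∃ r : ℝ, 0 < r ∧ ∃ (R : Plane ≃ₗᵢ[ℝ] Plane) (L : ℝ≥0) (φ : ℝ → ℝ),
      LipschitzWith L φ ∧ ∀ y ∈ Metric.ball x r, (y ∈ Ω ↔ φ (R y 0) < R y 1)

/-- `C_c^∞(Ω)`. -/
def IsTestFunction (Ω : Set Plane) (φ : Plane → ℝ) : Prop :=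
  ContDiff ℝ ∞ φ ∧ HasCompactSupport φ ∧ tsupport φ ⊆ Ω

/-- The classical partial derivative `∂φ/∂x_i`. -/
def partialDeriv (i : Fin 2) (φ : Plane → ℝ) (x : Plane) : ℝ :=
  fderiv ℝ φ x (EuclideanSpace.single i 1)

/-- `f ∈ L²(Ω)` has the weak gradient `g ∈ L²(Ω)²`. -/
def IsL2WeakGradient (Ω : Set Plane) (f : Plane → ℝ) (g : Fin 2 → Plane → ℝ) : Prop :=
  MemLp f 2 (volume.restrict Ω) ∧
    ∀ i, MemLp (g i) 2 (volume.restrict Ω) ∧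
      ∀ φ, IsTestFunction Ω φ →
        ∫ x in Ω, f x * partialDeriv i φ x = - ∫ x in Ω, g i x * φ x

/-- `f ∈ H¹(Ω)`. -/
def MemH1 (Ω : Set Plane) (f : Plane → ℝ) : Prop :=
  ∃ g, IsL2WeakGradient Ω f g

/-- `f ∈ H¹₀(Ω)`, the closure of `C_c^∞(Ω)` in `H¹(Ω)`. -/
def MemH10 (Ω : Set Plane) (f : Plane → ℝ) : Prop :=
  ∃ g, IsL2WeakGradient Ω f g ∧ ∃ φ : ℕ → Plane → ℝ, (∀ n, IsTestFunction Ω (φ n)) ∧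
    Tendsto (fun n => eLpNorm (fun x => φ n x - f x) 2 (volume.restrict Ω)) atTop (𝓝 0) ∧
    ∀ i, Tendsto (fun n => eLpNorm (fun x => partialDeriv i (φ n) x - g i x) 2
      (volume.restrict Ω)) atTop (𝓝 0)

/-! ### Rectangles and meshes -/

/-- A nondegenerate rectangle with sides parallel to the coordinate axes. -/
@[ext]
structure Rect where
  lo : Fin 2 → ℝ
  hi : Fin 2 → ℝ
  lo_lt_hi : ∀ i, lo i < hi i

namespace Rect

/-- The open rectangle. -/
def carrier (K : Rect) : Set Plane := {x | ∀ i, K.lo i < x i ∧ x i < K.hi i}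

/-- The diameter `h_K`. -/
def h (K : Rect) : ℝ := Metric.diam K.carrier

/-- The four vertices. -/
def vertices (K : Rect) : Set Plane := {x | ∀ i, x i = K.lo i ∨ x i = K.hi i}

/-- The four closed sides. -/
def sides (K : Rect) : Set (Set Plane) :=
  {s | ∃ i, s = {x ∈ closure K.carrier | x i = K.lo i} ∨
    s = {x ∈ closure K.carrier | x i = K.hi i}}

/-- `∂K ∩ ∂K'`. -/
def interface (K K' : Rect) : Set Plane := frontier K.carrier ∩ frontier K'.carrier

end Rect

/-- `∂K ∩ ∂K'` is an interior side of the mesh: the elements differ, and their common boundary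
is not merely empty or a point. -/
def IsInteriorSide (K K' : Rect) : Prop := K ≠ K' ∧ (K.interface K').Nontrivial

/-- The closed region covered by a set of elements. -/
def region (S : Finset Rect) : Set Plane := ⋃ K ∈ S, closure K.carrier

/-- A mesh of `Ω` by axis-parallel rectangles, possibly with hanging nodes: the elements are
pairwise disjoint open rectangles in `Ω` whose closures cover the closure of `Ω`, and the common
side `∂K ∩ ∂K'` of two elements is a whole side of at least one of them (it may be only a part
of the side of the other). -/
structure IsMesh (Ω : Set Plane) (M : Finset Rect) : Prop where
  subset : ∀ K ∈ M, K.carrier ⊆ Ω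
  disjoint : ∀ K ∈ M, ∀ K' ∈ M, K ≠ K' → Disjoint K.carrier K'.carrier
  cover : region M = closure Ω
  whole_side : ∀ K ∈ M, ∀ K' ∈ M, IsInteriorSide K K' →
    K.interface K' ∈ K.sides ∨ K.interface K' ∈ K'.sides

/-- The side lengths of each element have ratio at most `κ`. -/
def IsShapeRegular (κ : ℝ) (M : Finset Rect) : Prop :=
  ∀ K ∈ M, ∀ i j, K.hi i - K.lo i ≤ κ * (K.hi j - K.lo j)

/-- A conforming node: a vertex of some element which lies on the boundary of `Ω` or is a vertex
of four elements. -/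
def IsConformingNode (Ω : Set Plane) (M : Finset Rect) (P : Plane) : Prop :=
  (∃ K ∈ M, P ∈ K.vertices) ∧ (P ∈ frontier Ω ∨ {K | K ∈ M ∧ P ∈ K.vertices}.ncard = 4)

/-- `Q_p`: the polynomials in two variables of degree at most `p` in each of them. -/
abbrev Qp (p : ℕ) : Submodule ℝ (MvPolynomial (Fin 2) ℝ) :=
  MvPolynomial.restrictDegree (Fin 2) ℝ p

/-- The value of a polynomial at a point of the plane. -/
def polyEval (q : MvPolynomial (Fin 2) ℝ) (x : Plane) : ℝ :=
  MvPolynomial.eval (fun i => x i) q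

/-- The nodal function `ψ_P`: continuous on the closure of `Ω`, bilinear on each element, equal
to one at `P` and to zero at the other conforming nodes. -/
structure IsNodalFunction (Ω : Set Plane) (M : Finset Rect) (P : Plane) (ψ : Plane → ℝ) :
    Prop where
  continuousOn : ContinuousOn ψ (closure Ω)
  bilinear : ∀ K ∈ M, ∃ q ∈ Qp 1, ∀ x ∈ K.carrier, ψ x = polyEval q x
  eq_one : ψ P = 1
  eq_zero : ∀ Q, IsConformingNode Ω M Q → Q ≠ P → ψ Q = 0

/-- The support in the closure of `Ω`. -/
def nodalSupport (Ω : Set Plane) (ψ : Plane → ℝ) : Set Plane := closure {x ∈ Ω | ψ x ≠ 0}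

/-- The `K`-mesh condition with constant `C₀`: for each conforming node `P`,
`diam (supp ψ_P) ≤ C₀ h_K` for all elements `K ⊆ supp ψ_P`. -/
def IsKMesh (C₀ : ℝ) (Ω : Set Plane) (M : Finset Rect) : Prop :=
  ∀ P, IsConformingNode Ω M P → ∃ ψ, IsNodalFunction Ω M P ψ ∧
    ∀ K ∈ M, K.carrier ⊆ nodalSupport Ω ψ → Metric.diam (nodalSupport Ω ψ) ≤ C₀ * K.h

/-! ### Broken polynomial spaces and norms -/

/-- `V_p(M) = ∏_{K ∈ M} Q_p(K)`: one polynomial for each element. -/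
abbrev BrokenPoly (M : Finset Rect) (p : ℕ) : Type := (K : {K : Rect // K ∈ M}) → Qp p

/-- The piecewise polynomial function given by an element of `V_p(M)` (with value zero on the
null set formed by the sides). -/
def BrokenPoly.toFunction {M : Finset Rect} {p : ℕ} (v : BrokenPoly M p) (x : Plane) : ℝ :=
  ∑ K : {K : Rect // K ∈ M}, K.1.carrier.indicator (polyEval (v K : MvPolynomial (Fin 2) ℝ)) x

/-- `v = 0` on `∂Ω`: for each element `K`, the trace of `v|_K` vanishes almost everywhere, with
respect to length, on `∂K ∩ ∂Ω`. -/
def BrokenPoly.VanishesOnBoundary {M : Finset Rect} {p : ℕ} (v : BrokenPoly M p)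
    (Ω : Set Plane) : Prop :=
  ∀ K : {K : Rect // K ∈ M},
    ∀ᵐ x ∂((μH[1] : Measure Plane).restrict (frontier K.1.carrier ∩ frontier Ω)),
      polyEval (v K : MvPolynomial (Fin 2) ℝ) x = 0

/-- `‖q‖_{L²(K)}`. -/
def l2Norm (K : Rect) (q : MvPolynomial (Fin 2) ℝ) : ℝ :=
  Real.sqrt (∫ x in K.carrier, polyEval q x ^ 2)

/-- `‖∇q‖_{L²(K)}`. -/
def gradL2Norm (K : Rect) (q : MvPolynomial (Fin 2) ℝ) : ℝ :=
  Real.sqrt (∫ x in K.carrier, ∑ i, polyEval (MvPolynomial.pderiv i q) x ^ 2)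

open Classical in
/-- `‖ρ(h) [[v]]‖_{L²(σ)}`, where `σ` is the set of the interior sides `e = ∂K ∩ ∂K'` of the mesh
that are contained in the region covered by `S`, the mesh function is `h|_e = (h_K + h_K') / 2`,
and the jump is the difference of the traces from the two elements. The factor `1/2` accounts for
each side occurring twice, for `(K, K')` and for `(K', K)`. -/
def jumpNorm {M : Finset Rect} {p : ℕ} (ρ : ℝ → ℝ) (v : BrokenPoly M p) (S : Finset Rect) : ℝ :=
  Real.sqrt ((1 / 2) * ∑ K : {K : Rect // K ∈ M}, ∑ K' : {K : Rect // K ∈ M},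
    if IsInteriorSide K.1 K'.1 ∧ K.1.interface K'.1 ⊆ region S then
      ∫ x in K.1.interface K'.1, (ρ ((K.1.h + K'.1.h) / 2) *
        (polyEval (v K : MvPolynomial (Fin 2) ℝ) x -
          polyEval (v K' : MvPolynomial (Fin 2) ℝ) x)) ^ 2 ∂(μH[1] : Measure Plane)
    else 0)

end

noncomputable section

/-! The jumps are repaired on traces, by corrections no larger than the jumps. Every node `z` (a
vertex of some element) receives a value `N z`. Of two adjacent elements, the one whose side
contains the other's determines the trace on the common side: the trace of its own polynomial, with
both end values corrected to `N` by multiples of a cutoff polynomial `β` of degree at most `p` with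
`β(0) = 1`, `β(1) = 0`. Transfinite (Coons) interpolation, with `β` in place of the linear blending
function, lifts the corrections of the traces into the elements. On the sides it reproduces them, so
the corrected polynomials agree on common points of closed elements and define a continuous function
(`polyEval_add_blending_agree`).

At a node that is not interior to a side, `N` is the value of one element touching the node. At a
hanging node it has to be the value of the corrected trace of the long side; the ends of that side
may be hanging as well, so this is a linear system. Since `0 ≤ β(x) ≤ 1 - x`, a homogeneous solution
is bounded at a hanging node by a convex combination of its absolute values at the two ends, and the
discrete maximum principle `exists_max_not_isMidSide` yields unique solvability. The same principle
with a quadratic barrier bounds `N - V K` at the vertices by the pointwise jumps, uniformly in `p`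
and without counting generations of hanging nodes (`abs_nodal_sub_le`). The nodal function of a
conforming node is positive at every node whose value depends on it, so the `K`-mesh condition makes
all elements involved comparable in size and close to each other (`IsKMesh.comparable`).

The powers of `p` come from the Legendre operator, whose norm on polynomials of degree at most `p`
is `p (p + 1)` in `L²`. It gives `q(0)² ≲ p² ‖q‖²` and `‖q'‖² ≲ p⁴ ‖q‖²`; the cutoff, built from a
Fejér kernel, has `‖β‖² ≤ 2 / p²`. If `B` bounds the `L²` norms of the jumps on the sides, the
squared pointwise jumps are `≲ p² B² / h`. Multiplication by a scaled cutoff, of squared norm `≲ h /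
p²`, gives trace corrections of squared norm `≲ B²`, and lifting with another cutoff gives `‖v -
πv‖² ≲ h p⁻² B²`. The inverse inequality, with factor `p⁴ / h²`, then gives the gradient estimate.

At a boundary node the element defining `N` is chosen with a boundary segment that starts at or near
the node on a coordinate line through it, so its trace on that line, and with it `N`, vanishes if
`v` does. The Lipschitz condition enters by excluding checkerboard configurations at the boundary.
Membership in `H¹₀` follows by truncating the continuous result near zero and mollifying. -/

open Polynomial in
theorem Polynomial.integral_derivative_eval (q : ℝ[X]) (a b : ℝ) :
    ∫ x in a..b, (derivative q).eval x = q.eval b - q.eval a :=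
  intervalIntegral.integral_eq_sub_of_hasDerivAt (fun x _ => q.hasDerivAt x)
    ((derivative q).continuous.intervalIntegrable _ _)

/-! ### The Legendre operator and the endpoint inequality on the unit interval -/

namespace UnitIntervalPoly

open Polynomial

/-- The Legendre operator `q ↦ -((x - x²) q')'` on the unit interval. -/
def legendreOp (q : ℝ[X]) : ℝ[X] := -derivative ((X - X ^ 2) * derivative q)

theorem coeff_legendreOp (q : ℝ[X]) (n : ℕ) :
    (legendreOp q).coeff n =
      n * (n + 1) * q.coeff n - (n + 1) ^ 2 * q.coeff (n + 1) := by
  have e : (X - X ^ 2) * derivative q = X * derivative q - X * (X * derivative q) := by ring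
  rw [legendreOp, e, coeff_neg, coeff_derivative, coeff_sub, coeff_X_mul, coeff_X_mul,
    coeff_derivative]
  rcases n with _ | n
  · simp
  · rw [coeff_X_mul, coeff_derivative]; push_cast; ring

theorem degree_legendreOp_lt {q : ℝ[X]} {n : ℕ} (h : q.degree < n) :
    (legendreOp q).degree < n := by
  rw [degree_lt_iff_coeff_zero] at h ⊢
  intro m hm
  rw [coeff_legendreOp, h m hm, h (m + 1) (by omega)]; simp

theorem intervalIntegrable_eval (q : ℝ[X]) (a b : ℝ) :
    IntervalIntegrable (fun x => q.eval x) volume a b :=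
  q.continuous.intervalIntegrable _ _

/-- Integration by parts; the boundary terms vanish because `x - x²` does at both ends. -/
theorem integral_legendreOp_mul (q r : ℝ[X]) :
    ∫ x in (0 : ℝ)..1, (legendreOp q * r).eval x =
      ∫ x in (0 : ℝ)..1, ((X - X ^ 2) * derivative q * derivative r).eval x := by
  have h := integral_derivative_eval ((X - X ^ 2) * derivative q * r) 0 1
  have e : derivative ((X - X ^ 2) * derivative q * r) =
      (X - X ^ 2) * derivative q * derivative r - legendreOp q * r := by
    rw [derivative_mul, legendreOp]; ring
  rw [e] at h
  simp only [eval_sub] at h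
  rw [intervalIntegral.integral_sub (intervalIntegrable_eval _ _ _)
    (intervalIntegrable_eval _ _ _)] at h
  simp only [eval_mul, eval_sub, eval_X, eval_pow] at h ⊢
  norm_num at h
  linarith

theorem integral_legendreOp_symm (q r : ℝ[X]) :
    ∫ x in (0 : ℝ)..1, (legendreOp q * r).eval x =
      ∫ x in (0 : ℝ)..1, (q * legendreOp r).eval x := by
  rw [mul_comm q, integral_legendreOp_mul, integral_legendreOp_mul]
  congr 1; ext x; simp only [eval_mul]; ring

theorem eq_zero_of_integral_sq_eq_zero {s : ℝ[X]}
    (h : ∫ x in (0 : ℝ)..1, (s * s).eval x = 0) : s = 0 := by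
  by_contra hs
  have : ∃ c ∈ Icc (0 : ℝ) 1, s.eval c ≠ 0 := by
    by_contra hc
    push Not at hc
    exact hs (eq_zero_of_infinite_isRoot s ((Icc_infinite one_pos).mono fun x hx => hc x hx))
  obtain ⟨c, hc, hc'⟩ := this
  have := intervalIntegral.integral_pos (f := fun x => (s * s).eval x) one_pos
    (s * s).continuous.continuousOn (fun x _ => by rw [eval_mul]; exact mul_self_nonneg _)
    ⟨c, hc, by rw [eval_mul]; exact mul_self_pos.2 hc'⟩
  linarith

/-- A multiple of the Legendre polynomial of degree `n` of the unit interval. -/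
def rodrigues (n : ℕ) : ℝ[X] := derivative^[n] ((X - X ^ 2) ^ n)

theorem rodrigues_eq (n : ℕ) : rodrigues n =
    (n.factorial : ℝ[X]) * (shiftedLegendre n).map (Int.castRingHom ℝ) := by
  have := congrArg (Polynomial.map (Int.castRingHom ℝ)) (factorial_mul_shiftedLegendre_eq n)
  rw [← iterate_derivative_map] at this
  simp only [Polynomial.map_mul, Polynomial.map_natCast, Polynomial.map_pow, Polynomial.map_sub,
    map_X, Polynomial.map_one] at this
  rw [this, rodrigues, ← mul_pow]
  congr 2; ring

theorem degree_rodrigues (n : ℕ) : (rodrigues n).degree = n := by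
  rw [rodrigues_eq, degree_mul, degree_map_eq_of_injective (Int.castRingHom ℝ).injective_int,
    degree_shiftedLegendre]
  have : ((n.factorial : ℕ) : ℝ[X]) = C (n.factorial : ℝ) := by simp
  rw [this, degree_C (by positivity)]; simp

theorem eval_iterate_derivative_eq_zero {n k : ℕ} (hk : k < n) {t : ℝ} (ht : t = 0 ∨ t = 1) :
    (derivative^[k] ((X - X ^ 2 : ℝ[X]) ^ n)).eval t = 0 := by
  have hd : (X - C t) ∣ (X - X ^ 2 : ℝ[X]) := by
    rw [dvd_iff_isRoot, IsRoot]
    rcases ht with rfl | rfl <;> simp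
  have h1 := pow_sub_dvd_iterate_derivative_of_pow_dvd k (pow_dvd_pow_of_dvd hd n)
  have h2 := (dvd_pow_self (X - C t) (by omega : n - k ≠ 0)).trans h1
  exact dvd_iff_isRoot.1 h2

theorem integral_iterate_derivative_mul (n : ℕ) (r : ℝ[X]) (k : ℕ) (hk : k ≤ n) :
    ∫ x in (0 : ℝ)..1, (derivative^[k] ((X - X ^ 2) ^ n) * r).eval x =
      (-1) ^ k * ∫ x in (0 : ℝ)..1, ((X - X ^ 2) ^ n * derivative^[k] r).eval x := by
  induction k generalizing r with
  | zero => simp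
  | succ k ih =>
    have h := integral_derivative_eval (derivative^[k] ((X - X ^ 2) ^ n) * r) 0 1
    rw [derivative_mul] at h
    simp only [eval_add] at h
    rw [intervalIntegral.integral_add (intervalIntegrable_eval _ _ _)
      (intervalIntegrable_eval _ _ _), ih (derivative r) (by omega)] at h
    rw [eval_mul, eval_mul, eval_iterate_derivative_eq_zero (by omega) (Or.inl rfl),
      eval_iterate_derivative_eq_zero (by omega) (Or.inr rfl)] at h
    rw [Function.iterate_succ_apply', Function.iterate_succ_apply, pow_succ (-1 : ℝ)]
    linarith

/-- Integrating by parts `n` times puts `n` derivatives on `r` and kills it. -/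
theorem integral_rodrigues_mul {n : ℕ} {r : ℝ[X]} (hr : r.degree < n) :
    ∫ x in (0 : ℝ)..1, (rodrigues n * r).eval x = 0 := by
  rw [rodrigues, integral_iterate_derivative_mul n r n le_rfl]
  have : derivative^[n] r = 0 := by
    rcases eq_or_ne r 0 with rfl | h0
    · simp
    · exact iterate_derivative_eq_zero ((natDegree_lt_iff_degree_lt h0).2 hr)
  simp [this]

/-- The leading coefficients match, so the difference `s` of the two sides has degree less than `n`.
By symmetry of the operator both terms of `s` are orthogonal to polynomials of lower degree, in
particular to `s` itself. -/
theorem legendreOp_rodrigues (n : ℕ) :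
    legendreOp (rodrigues n) = C ((n : ℝ) * (n + 1)) * rodrigues n := by
  set P := rodrigues n
  set s := legendreOp P - C ((n : ℝ) * (n + 1)) * P with hs
  have hdeg : s.degree < n := by
    rw [degree_lt_iff_coeff_zero]
    intro m hm
    have hP : ∀ k, n < k → P.coeff k = 0 := fun k hk =>
      coeff_eq_zero_of_degree_lt (by rw [degree_rodrigues]; exact_mod_cast hk)
    rw [hs, coeff_sub, coeff_C_mul, coeff_legendreOp, hP (m + 1) (by omega)]
    rcases hm.eq_or_lt with rfl | h
    · ring
    · rw [hP m h]; ring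
  have h0 : s = 0 := by
    apply eq_zero_of_integral_sq_eq_zero
    have e : ∀ x, (s * s).eval x =
        (legendreOp P * s).eval x - (n : ℝ) * (n + 1) * (P * s).eval x := by
      intro x
      conv_lhs => rw [eval_mul]
      nth_rw 1 [hs]
      simp only [eval_mul, eval_sub, eval_C]; ring
    simp only [e]
    rw [intervalIntegral.integral_sub (intervalIntegrable_eval _ _ _)
      ((intervalIntegrable_eval _ _ _).const_mul _), intervalIntegral.integral_const_mul,
      integral_rodrigues_mul hdeg, integral_legendreOp_symm,
      integral_rodrigues_mul (degree_legendreOp_lt hdeg)]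
    simp
  exact sub_eq_zero.1 h0

theorem legendreOp_add (q r : ℝ[X]) : legendreOp (q + r) = legendreOp q + legendreOp r := by
  simp only [legendreOp, derivative_add, mul_add]; ring

theorem legendreOp_C_mul (c : ℝ) (q : ℝ[X]) : legendreOp (C c * q) = C c * legendreOp q := by
  simp only [legendreOp, derivative_C_mul]
  rw [show (X - X ^ 2) * (C c * derivative q) = C c * ((X - X ^ 2) * derivative q) by ring,
    derivative_C_mul]; ring

theorem integral_sq_add {P r : ℝ[X]} (c : ℝ)
    (h : ∫ x in (0 : ℝ)..1, (P * r).eval x = 0) :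
    ∫ x in (0 : ℝ)..1, ((C c * P + r) ^ 2).eval x =
      c ^ 2 * (∫ x in (0 : ℝ)..1, (P ^ 2).eval x) + ∫ x in (0 : ℝ)..1, (r ^ 2).eval x := by
  have e : ∀ x, ((C c * P + r) ^ 2).eval x =
      c ^ 2 * (P ^ 2).eval x + (2 * c * (P * r).eval x + (r ^ 2).eval x) := by
    intro x; simp only [eval_pow, eval_add, eval_mul, eval_C]; ring
  simp only [e]
  rw [intervalIntegral.integral_add ((intervalIntegrable_eval _ _ _).const_mul _)
    (((intervalIntegrable_eval _ _ _).const_mul _).add (intervalIntegrable_eval _ _ _)),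
    intervalIntegral.integral_add ((intervalIntegrable_eval _ _ _).const_mul _)
    (intervalIntegrable_eval _ _ _), intervalIntegral.integral_const_mul,
    intervalIntegral.integral_const_mul, h]
  ring

theorem integral_sq_nonneg (q : ℝ[X]) {a b : ℝ} (hab : a ≤ b) :
    0 ≤ ∫ x in a..b, (q ^ 2).eval x :=
  intervalIntegral.integral_nonneg hab fun x _ => by rw [eval_pow]; positivity

/-- Spectral bound: the operator is diagonal in the orthogonal Legendre basis, with largest
eigenvalue `p (p + 1)`. The induction splits off the top Legendre component. -/
theorem integral_legendreOp_sq_le (p : ℕ) (q : ℝ[X]) (hq : q.degree < (p + 1 : ℕ)) :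
    ∫ x in (0 : ℝ)..1, ((legendreOp q) ^ 2).eval x ≤
      ((p : ℝ) * (p + 1)) ^ 2 * ∫ x in (0 : ℝ)..1, (q ^ 2).eval x := by
  induction p generalizing q with
  | zero =>
    have : q = C (q.coeff 0) := eq_C_of_natDegree_le_zero (by
      rw [zero_add, Nat.cast_one] at hq
      exact natDegree_le_of_degree_le (Order.le_of_lt_succ hq))
    rw [this]; simp [legendreOp]
  | succ n ih =>
    set m := n + 1
    set P := rodrigues m
    set c := q.coeff m / P.coeff m with hc
    have hPm : P.coeff m ≠ 0 := by
      have := degree_rodrigues m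
      exact coeff_ne_zero_of_eq_degree this
    set r := q - C c * P with hr
    have hrd : r.degree < m := by
      rw [degree_lt_iff_coeff_zero] at hq ⊢
      intro k hk
      rw [hr, coeff_sub, coeff_C_mul]
      rcases hk.eq_or_lt with rfl | h
      · rw [hc]; field_simp; ring
      · rw [hq k h, coeff_eq_zero_of_degree_lt (p := P)
          (by rw [degree_rodrigues]; exact_mod_cast h)]; ring
    have hqr : q = C c * P + r := by rw [hr]; ring
    have hL : legendreOp q = C (c * ((m : ℝ) * (m + 1))) * P + legendreOp r := by
      rw [hqr, legendreOp_add, legendreOp_C_mul, legendreOp_rodrigues, ← mul_assoc, ← C_mul]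
    rw [hL, integral_sq_add _ (integral_rodrigues_mul (degree_legendreOp_lt hrd)), hqr,
      integral_sq_add _ (integral_rodrigues_mul hrd)]
    have h1 := ih r hrd
    have h2 : ((n : ℝ) * (n + 1)) ^ 2 ≤ ((m : ℝ) * (m + 1)) ^ 2 := by
      have : (m : ℝ) = n + 1 := by simp [m]
      rw [this]; gcongr <;> linarith
    have h3 := mul_le_mul_of_nonneg_right h2 (integral_sq_nonneg r zero_le_one)
    rw [mul_add, mul_pow]
    linarith

/-- Cauchy–Schwarz, from the nonnegative variance of `f` about its mean on `[0, x]`. -/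
theorem sq_integral_le (f : ℝ[X]) {x : ℝ} (hx : 0 < x) (hx1 : x ≤ 1) :
    (∫ t in (0 : ℝ)..x, f.eval t) ^ 2 ≤ x * ∫ t in (0 : ℝ)..1, (f ^ 2).eval t := by
  set m := (∫ t in (0 : ℝ)..x, f.eval t) / x with hm
  have h := intervalIntegral.integral_nonneg (μ := volume) hx.le
    (fun t _ => sq_nonneg (f.eval t - m))
  have e : ∀ t, (f.eval t - m) ^ 2 = (f ^ 2).eval t - 2 * m * f.eval t + m ^ 2 := by
    intro t; rw [eval_pow]; ring
  simp only [e] at h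
  rw [intervalIntegral.integral_add (((intervalIntegrable_eval _ _ _).sub
    ((intervalIntegrable_eval _ _ _).const_mul _))) intervalIntegrable_const,
    intervalIntegral.integral_sub (intervalIntegrable_eval _ _ _)
    ((intervalIntegrable_eval _ _ _).const_mul _), intervalIntegral.integral_const_mul,
    intervalIntegral.integral_const] at h
  have h2 : ∫ t in (0 : ℝ)..x, (f ^ 2).eval t ≤ ∫ t in (0 : ℝ)..1, (f ^ 2).eval t := by
    rw [← intervalIntegral.integral_add_adjacent_intervals
      (intervalIntegrable_eval (f ^ 2) 0 x) (intervalIntegrable_eval (f ^ 2) x 1)]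
    linarith [integral_sq_nonneg f hx1]
  have h3 : (∫ t in (0 : ℝ)..x, f.eval t) = m * x := by rw [hm]; field_simp
  rw [h3] at h ⊢
  simp only [smul_eq_mul, sub_zero] at h
  nlinarith

/-- Integrating the Legendre operator from `0` recovers `-(x - x²) q'`, so its `L²` bound controls
`√x |q'|` near `0`. In the variable `y = √x` this is a Lipschitz bound of order `p² ‖q‖`, and `q(0)`
is compared with the values of `q` on an interval of length of order `p⁻²`. -/
theorem eval_zero_sq_le {p : ℕ} (hp : 1 ≤ p) {q : ℝ[X]} (hq : q.degree < (p + 1 : ℕ)) :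
    q.eval 0 ^ 2 ≤ 132 * (p : ℝ) ^ 2 * ∫ x in (0 : ℝ)..1, (q ^ 2).eval x := by
  set S := ∫ x in (0 : ℝ)..1, (q ^ 2).eval x with hS
  have hS0 : 0 ≤ S := integral_sq_nonneg q zero_le_one
  have hp1 : (1 : ℝ) ≤ p := by exact_mod_cast hp
  have hL : ∫ x in (0 : ℝ)..1, ((legendreOp q) ^ 2).eval x ≤ (2 * (p : ℝ) ^ 2) ^ 2 * S := by
    refine (integral_legendreOp_sq_le p q hq).trans (mul_le_mul_of_nonneg_right ?_ hS0)
    refine pow_le_pow_left₀ (by positivity) ?_ 2; nlinarith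
  have hder : ∀ y ∈ Icc (0 : ℝ) 1, y ^ 2 ≤ 1 / 2 →
      |2 * y * (derivative q).eval (y ^ 2)| ≤ 8 * (p : ℝ) ^ 2 * √S := by
    intro y hy hy2
    rcases hy.1.eq_or_lt with h0 | h0
    · rw [← h0]; simp; positivity
    have h1 := sq_integral_le (legendreOp q) (x := y ^ 2) (by positivity) (by linarith)
    have h2 : ∫ t in (0 : ℝ)..y ^ 2, (legendreOp q).eval t =
        - ((y ^ 2 - (y ^ 2) ^ 2) * (derivative q).eval (y ^ 2)) := by
      simp only [legendreOp, eval_neg, intervalIntegral.integral_neg, integral_derivative_eval]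
      simp
    rw [h2] at h1
    apply abs_le_of_sq_le_sq _ (by positivity)
    rw [mul_pow (8 * (p : ℝ) ^ 2), Real.sq_sqrt hS0]
    set D := (derivative q).eval (y ^ 2)
    have h3 : y ^ 2 * (y * D / 2) ^ 2 ≤ y ^ 2 * ((2 * (p : ℝ) ^ 2) ^ 2 * S) := by
      have h4 : y ^ 2 * (y * D / 2) ^ 2 ≤ (-((y ^ 2 - (y ^ 2) ^ 2) * D)) ^ 2 := by
        have : (y ^ 2 * D) ^ 2 * (1 / 2) ^ 2 ≤ (y ^ 2 * D) ^ 2 * (1 - y ^ 2) ^ 2 := by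
          gcongr; linarith
        nlinarith
      exact (h4.trans h1).trans (mul_le_mul_of_nonneg_left hL (by positivity))
    have h5 := le_of_mul_le_mul_left h3 (by positivity)
    nlinarith
  have hmv : ∀ x ∈ Icc (0 : ℝ) (1 / 2), |q.eval 0| ≤ |q.eval x| + 8 * (p : ℝ) ^ 2 * √S * √x := by
    intro x hx
    have h := (convex_Icc (0 : ℝ) √x).norm_image_sub_le_of_norm_hasDerivWithin_le
      (f := fun y => q.eval (y ^ 2)) (f' := fun y => 2 * y * (derivative q).eval (y ^ 2))
      (C := 8 * (p : ℝ) ^ 2 * √S) (x := √x) (y := 0) ?_ ?_ ⟨Real.sqrt_nonneg _, le_rfl⟩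
      ⟨le_rfl, Real.sqrt_nonneg _⟩
    · simp only [Real.norm_eq_abs, Real.sq_sqrt hx.1, zero_sub, abs_neg,
        abs_of_nonneg (Real.sqrt_nonneg x)] at h
      have := abs_sub_abs_le_abs_sub (q.eval 0) (q.eval x)
      norm_num at h this
      linarith
    · intro y hy
      have h2 := (q.hasDerivAt (y ^ 2)).comp y (hasDerivAt_pow 2 y)
      have e : 2 * y * (derivative q).eval (y ^ 2) =
          (derivative q).eval (y ^ 2) * ((2 : ℕ) * y ^ (2 - 1)) := by push_cast; ring
      rw [e]
      exact h2.hasDerivWithinAt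
    · intro y hy
      have : y ^ 2 ≤ x := by
        have := pow_le_pow_left₀ hy.1 hy.2 2
        rwa [Real.sq_sqrt hx.1] at this
      exact hder y ⟨hy.1, by nlinarith [hx.2]⟩ (this.trans hx.2)
  -- Averaging over `[0, δ]` costs `2 S / δ = 4 p² S` for the values of `q`, while the Lipschitz
  -- term is at most `128 p⁴ S δ`, again of order `p² S`.
  set δ : ℝ := 1 / (2 * (p : ℝ) ^ 2) with hδ
  have hδ0 : 0 < δ := by positivity
  have hδ1 : δ ≤ 1 / 2 := by
    rw [hδ, div_le_div_iff₀ (by positivity) (by norm_num)]; nlinarith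
  have hpt : ∀ x ∈ Icc (0 : ℝ) δ,
      q.eval 0 ^ 2 ≤ 2 * (q ^ 2).eval x + 2 * (8 * (p : ℝ) ^ 2) ^ 2 * S * δ := by
    intro x hx
    have h1 := hmv x ⟨hx.1, hx.2.trans hδ1⟩
    have h2 : √x ^ 2 ≤ δ := by rw [Real.sq_sqrt hx.1]; exact hx.2
    have h3 := Real.sq_sqrt hS0
    rw [eval_pow, ← sq_abs, ← sq_abs (q.eval x)]
    calc |q.eval 0| ^ 2 ≤ (|q.eval x| + 8 * (p : ℝ) ^ 2 * √S * √x) ^ 2 := by gcongr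
      _ ≤ 2 * |q.eval x| ^ 2 + 2 * (8 * (p : ℝ) ^ 2 * √S * √x) ^ 2 := add_sq_le.trans (by linarith)
      _ = 2 * |q.eval x| ^ 2 + 2 * (8 * (p : ℝ) ^ 2) ^ 2 * (√S ^ 2) * √x ^ 2 := by ring
      _ ≤ _ := by rw [h3]; gcongr
  have hint := intervalIntegral.integral_mono_on hδ0.le
    (intervalIntegrable_const (μ := volume) (c := q.eval 0 ^ 2))
    (((intervalIntegrable_eval (q ^ 2) 0 δ).const_mul 2).add
      (intervalIntegrable_const (c := 2 * (8 * (p : ℝ) ^ 2) ^ 2 * S * δ))) hpt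
  rw [intervalIntegral.integral_add ((intervalIntegrable_eval _ _ _).const_mul _)
    intervalIntegrable_const, intervalIntegral.integral_const_mul,
    intervalIntegral.integral_const, intervalIntegral.integral_const] at hint
  have h2 : ∫ t in (0 : ℝ)..δ, (q ^ 2).eval t ≤ S := by
    rw [hS, ← intervalIntegral.integral_add_adjacent_intervals
      (intervalIntegrable_eval (q ^ 2) 0 δ) (intervalIntegrable_eval (q ^ 2) δ 1)]
    linarith [integral_sq_nonneg q (show δ ≤ 1 by linarith)]
  simp only [smul_eq_mul, sub_zero] at hint
  have h4 : δ * q.eval 0 ^ 2 ≤ δ * (132 * (p : ℝ) ^ 2 * S) := by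
    have e1 : δ * (2 * (8 * (p : ℝ) ^ 2) ^ 2 * S * δ) = δ * (128 * p ^ 2 * S) * (2 * p ^ 2 * δ) / 2 := by
      ring
    have e2 : 2 * (p : ℝ) ^ 2 * δ = 1 := by rw [hδ]; field_simp
    have e3 : δ * (132 * (p : ℝ) ^ 2 * S) = δ * (128 * p ^ 2 * S) + 2 * (2 * p ^ 2 * δ) * S := by ring
    rw [e3, e2]
    rw [e1, e2] at hint
    have : 0 ≤ δ * (128 * (p : ℝ) ^ 2 * S) := by positivity
    linarith
  exact le_of_mul_le_mul_left h4 hδ0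

end UnitIntervalPoly

/-! ### Inverse inequalities on intervals and the cutoff polynomial -/

namespace UnitIntervalPoly

open Polynomial

theorem integral_comp_affine (q : ℝ[X]) {a b : ℝ} (hab : a ≠ b) :
    ∫ x in (0 : ℝ)..1, (q.comp (C (b - a) * X + C a)).eval x =
      (b - a)⁻¹ * ∫ x in a..b, q.eval x := by
  have h := intervalIntegral.integral_comp_mul_add (a := 0) (b := 1) (fun x => q.eval x)
    (sub_ne_zero.2 hab.symm) a
  simp only [mul_zero, zero_add, mul_one, sub_add_cancel, smul_eq_mul] at h
  rw [← h]
  congr 1; ext x; simp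

theorem natDegree_comp_affine_le {q : ℝ[X]} {p : ℕ} (hq : q.natDegree ≤ p) (c d : ℝ) :
    (q.comp (C c * X + C d)).natDegree ≤ p := by
  refine natDegree_comp_le.trans ?_
  calc q.natDegree * (C c * X + C d).natDegree ≤ p * 1 :=
        Nat.mul_le_mul hq (natDegree_linear_le)
    _ = p := mul_one p

theorem degree_lt_succ {q : ℝ[X]} {p : ℕ} (hq : q.natDegree ≤ p) : q.degree < (p + 1 : ℕ) :=
  lt_of_le_of_lt (degree_le_of_natDegree_le hq) (by exact_mod_cast Nat.lt_succ_self p)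

theorem eval_endpoint_sq_le {p : ℕ} (hp : 1 ≤ p) {q : ℝ[X]} (hq : q.natDegree ≤ p) {a b : ℝ}
    (hab : a ≠ b) :
    q.eval a ^ 2 ≤ 132 * (p : ℝ) ^ 2 * ((b - a)⁻¹ * ∫ x in a..b, (q ^ 2).eval x) := by
  have h := eval_zero_sq_le hp (degree_lt_succ (natDegree_comp_affine_le hq (b - a) a))
  rw [← pow_comp, integral_comp_affine _ hab] at h
  simpa using h

/-- The point `x` is an end of a subinterval of at least half the length, to which the endpoint
inequality applies. -/
theorem eval_sq_le {p : ℕ} (hp : 1 ≤ p) {q : ℝ[X]} (hq : q.natDegree ≤ p) {a b x : ℝ}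
    (hab : a < b) (hx : x ∈ Icc a b) :
    q.eval x ^ 2 ≤ 264 * (p : ℝ) ^ 2 / (b - a) * ∫ x in a..b, (q ^ 2).eval x := by
  have hsplit := intervalIntegral.integral_add_adjacent_intervals
    (intervalIntegrable_eval (q ^ 2) a x) (intervalIntegrable_eval (q ^ 2) x b)
  have h1 := integral_sq_nonneg q hx.1
  have h2 := integral_sq_nonneg q hx.2
  set S := ∫ x in a..b, (q ^ 2).eval x
  have hba : 0 < b - a := sub_pos.2 hab
  have key : ∀ w I : ℝ, (b - a) / 2 ≤ w → 0 ≤ I → I ≤ S →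
      132 * (p : ℝ) ^ 2 * (w⁻¹ * I) ≤ 264 * (p : ℝ) ^ 2 / (b - a) * S := by
    intro w I hw hI hIS
    have : w⁻¹ ≤ ((b - a) / 2)⁻¹ := inv_anti₀ (by linarith) hw
    calc 132 * (p : ℝ) ^ 2 * (w⁻¹ * I) ≤ 132 * (p : ℝ) ^ 2 * (((b - a) / 2)⁻¹ * S) := by
          gcongr
      _ = _ := by field_simp; ring
  rcases le_total x ((a + b) / 2) with hm | hm
  · refine (eval_endpoint_sq_le hp hq (by linarith : x < b).ne).trans ?_
    exact key _ _ (by linarith) h2 (by linarith)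
  · refine (eval_endpoint_sq_le hp hq (by linarith : a < x).ne').trans ?_
    rw [intervalIntegral.integral_symm a x, mul_neg, ← neg_mul, ← inv_neg, neg_sub]
    exact key _ _ (by linarith) h1 (by linarith)

/-- The left side is the quadratic form of the Legendre operator. Young's inequality with weight `p
(p + 1)` reduces it to the operator norm bound. -/
theorem integral_weighted_derivative_sq_le {p : ℕ} (hp : 1 ≤ p) {q : ℝ[X]}
    (hq : q.natDegree ≤ p) :
    ∫ x in (0 : ℝ)..1, ((X - X ^ 2) * derivative q * derivative q).eval x ≤
      2 * (p : ℝ) ^ 2 * ∫ x in (0 : ℝ)..1, (q ^ 2).eval x := by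
  have hp1 : (1 : ℝ) ≤ p := by exact_mod_cast hp
  have hL := integral_legendreOp_sq_le p q (degree_lt_succ hq)
  rw [← integral_legendreOp_mul]
  set m : ℝ := (p : ℝ) * (p + 1) with hm
  have hm0 : 0 < m := by positivity
  have hpt : ∀ x ∈ Icc (0 : ℝ) 1, (legendreOp q * q).eval x ≤
      (2 * m)⁻¹ * (legendreOp q ^ 2).eval x + m / 2 * (q ^ 2).eval x := by
    intro x _
    simp only [eval_mul, eval_pow]
    have h := sq_nonneg ((legendreOp q).eval x - m * q.eval x)
    rw [← sub_nonneg]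
    have : (2 * m)⁻¹ * eval x (legendreOp q) ^ 2 + m / 2 * eval x q ^ 2 -
      eval x (legendreOp q) * eval x q =
        (2 * m)⁻¹ * ((legendreOp q).eval x - m * q.eval x) ^ 2 := by field_simp; ring
    rw [this]; positivity
  have hint := intervalIntegral.integral_mono_on zero_le_one
    (intervalIntegrable_eval (legendreOp q * q) 0 1)
    (((intervalIntegrable_eval (legendreOp q ^ 2) 0 1).const_mul (2 * m)⁻¹).add
      ((intervalIntegrable_eval (q ^ 2) 0 1).const_mul (m / 2))) hpt
  rw [intervalIntegral.integral_add ((intervalIntegrable_eval _ _ _).const_mul _)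
    ((intervalIntegrable_eval _ _ _).const_mul _), intervalIntegral.integral_const_mul,
    intervalIntegral.integral_const_mul] at hint
  set S := ∫ x in (0 : ℝ)..1, (q ^ 2).eval x with hS
  have hS0 : 0 ≤ S := integral_sq_nonneg q zero_le_one
  have h3 : (2 * m)⁻¹ * ∫ x in (0 : ℝ)..1, (legendreOp q ^ 2).eval x ≤ (2 * m)⁻¹ * (m ^ 2 * S) :=
    mul_le_mul_of_nonneg_left hL (by positivity)
  have h4 : (2 * m)⁻¹ * (m ^ 2 * S) = m / 2 * S := by field_simp
  have h5 : m ≤ 2 * (p : ℝ) ^ 2 := by nlinarith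
  have := mul_le_mul_of_nonneg_right h5 hS0
  linarith

/-- Markov's inequality in `L²`. The weighted estimate suffices away from the ends; in thin end
layers the pointwise bound for `q'` shows that they carry at most half of `‖q'‖²`, which is
absorbed. -/
theorem integral_derivative_sq_le_unit {p : ℕ} (hp : 1 ≤ p) {q : ℝ[X]} (hq : q.natDegree ≤ p) :
    ∫ x in (0 : ℝ)..1, (derivative q ^ 2).eval x ≤
      8448 * (p : ℝ) ^ 4 * ∫ x in (0 : ℝ)..1, (q ^ 2).eval x := by
  have hp1 : (1 : ℝ) ≤ p := by exact_mod_cast hp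
  set r := derivative q with hr
  have hrd : r.natDegree ≤ p := (natDegree_derivative_le q).trans (by omega)
  set S := ∫ x in (0 : ℝ)..1, (r ^ 2).eval x with hS
  have hS0 : 0 ≤ S := integral_sq_nonneg r zero_le_one
  have hsup : ∀ x ∈ Icc (0 : ℝ) 1, (r ^ 2).eval x ≤ 264 * (p : ℝ) ^ 2 * S := by
    intro x hx
    have := eval_sq_le hp hrd one_pos hx
    rw [sub_zero, div_one] at this
    rwa [eval_pow]
  -- Since `264 p² S · δ = S / 4`, each end layer of width `δ` carries at most a quarter of `S`.
  set δ : ℝ := 1 / (1056 * (p : ℝ) ^ 2) with hδ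
  have hδ0 : 0 < δ := by positivity
  have hδ1 : δ ≤ 1 / 2 := by
    rw [hδ, div_le_div_iff₀ (by positivity) (by norm_num)]; nlinarith
  have hend : ∀ a b : ℝ, 0 ≤ a → b ≤ 1 → b - a = δ →
      ∫ x in a..b, (r ^ 2).eval x ≤ S / 4 := by
    intro a b ha hb hba
    have h := intervalIntegral.integral_mono_on (by linarith : a ≤ b)
      (intervalIntegrable_eval (r ^ 2) a b)
      (intervalIntegrable_const (c := 264 * (p : ℝ) ^ 2 * S))
      (fun x hx => hsup x ⟨ha.trans hx.1, hx.2.trans hb⟩)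
    rw [intervalIntegral.integral_const, hba, smul_eq_mul] at h
    refine h.trans (le_of_eq ?_)
    rw [hδ]; field_simp; ring
  have h1 := hend 0 δ le_rfl (by linarith) (by ring)
  have h2 := hend (1 - δ) 1 (by linarith) le_rfl (by ring)
  have hw := integral_weighted_derivative_sq_le hp hq
  set w : ℝ[X] := (X - X ^ 2) * r * r with hwdef
  have hw0 : ∀ x ∈ Icc (0 : ℝ) 1, 0 ≤ w.eval x := by
    intro x hx
    simp only [hwdef, eval_mul, eval_sub, eval_X, eval_pow]
    rw [mul_assoc]
    exact mul_nonneg (by nlinarith [hx.1, hx.2]) (mul_self_nonneg _)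
  have hmid : ∫ x in δ..(1 - δ), (r ^ 2).eval x ≤ 2 / δ * ∫ x in δ..(1 - δ), w.eval x := by
    rw [← intervalIntegral.integral_const_mul]
    refine intervalIntegral.integral_mono_on (by linarith) (intervalIntegrable_eval _ _ _)
      ((intervalIntegrable_eval _ _ _).const_mul _) fun x hx => ?_
    simp only [hwdef, eval_mul, eval_sub, eval_X, eval_pow]
    have : 1 ≤ 2 / δ * (x - x ^ 2) := by
      rw [div_mul_eq_mul_div, one_le_div hδ0]; nlinarith [hx.1, hx.2]
    nlinarith [sq_nonneg (r.eval x)]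
  have hmid2 : ∫ x in δ..(1 - δ), w.eval x ≤ ∫ x in (0 : ℝ)..1, w.eval x := by
    rw [← intervalIntegral.integral_add_adjacent_intervals
      (intervalIntegrable_eval w 0 δ) (intervalIntegrable_eval w δ 1),
      ← intervalIntegral.integral_add_adjacent_intervals
      (intervalIntegrable_eval w δ (1 - δ)) (intervalIntegrable_eval w (1 - δ) 1)]
    have a1 := intervalIntegral.integral_nonneg (μ := volume) hδ0.le
      (fun x hx => hw0 x ⟨hx.1, by linarith [hx.2]⟩)
    have a2 := intervalIntegral.integral_nonneg (μ := volume) (by linarith : 1 - δ ≤ 1)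
      (fun x hx => hw0 x ⟨by linarith [hx.1], hx.2⟩)
    linarith
  have hsplit : S = (∫ x in (0 : ℝ)..δ, (r ^ 2).eval x) +
      ((∫ x in δ..(1 - δ), (r ^ 2).eval x) + ∫ x in (1 - δ)..1, (r ^ 2).eval x) := by
    rw [intervalIntegral.integral_add_adjacent_intervals
      (intervalIntegrable_eval _ _ _) (intervalIntegrable_eval _ _ _),
      intervalIntegral.integral_add_adjacent_intervals
      (intervalIntegrable_eval _ _ _) (intervalIntegrable_eval _ _ _)]
  have h3 : 2 / δ * ∫ x in δ..(1 - δ), w.eval x ≤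
      2 / δ * (2 * (p : ℝ) ^ 2 * ∫ x in (0 : ℝ)..1, (q ^ 2).eval x) :=
    mul_le_mul_of_nonneg_left (hmid2.trans hw) (by positivity)
  have h4 : 2 / δ = 2112 * (p : ℝ) ^ 2 := by rw [hδ]; field_simp; norm_num
  rw [h4] at h3 hmid
  nlinarith

theorem integral_derivative_sq_le {p : ℕ} (hp : 1 ≤ p) {q : ℝ[X]} (hq : q.natDegree ≤ p)
    {a b : ℝ} (hab : a < b) :
    ∫ x in a..b, (derivative q ^ 2).eval x ≤
      8448 * (p : ℝ) ^ 4 / (b - a) ^ 2 * ∫ x in a..b, (q ^ 2).eval x := by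
  have h := integral_derivative_sq_le_unit hp (natDegree_comp_affine_le hq (b - a) a)
  have hba : 0 < b - a := sub_pos.2 hab
  have e : derivative (q.comp (C (b - a) * X + C a)) ^ 2 =
      C ((b - a) ^ 2) * (derivative q ^ 2).comp (C (b - a) * X + C a) := by
    rw [derivative_comp, pow_comp]; simp; ring
  rw [← pow_comp, integral_comp_affine _ hab.ne, e] at h
  simp only [eval_mul, eval_C, intervalIntegral.integral_const_mul] at h
  rw [integral_comp_affine _ hab.ne] at h
  set I := ∫ x in a..b, (derivative q ^ 2).eval x
  set J := ∫ x in a..b, (q ^ 2).eval x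
  have e2 : I = (b - a)⁻¹ * ((b - a) ^ 2 * ((b - a)⁻¹ * I)) := by field_simp
  rw [e2]
  calc _ ≤ (b - a)⁻¹ * (8448 * (p : ℝ) ^ 4 * ((b - a)⁻¹ * J)) := by gcongr
    _ = _ := by field_simp

/-- `(1 - T_p(y)) / (p² (1 - y))` at `y = 1 - 2x`, a Fejér kernel. -/
theorem exists_fejer {p : ℕ} (hp : 1 ≤ p) : ∃ r : ℝ[X], r.natDegree ≤ p - 1 ∧ r.eval 0 = 1 ∧
    (∀ x ∈ Icc (0 : ℝ) 1, 0 ≤ r.eval x ∧ r.eval x ≤ 1) ∧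
    ∀ x ∈ Ioc (0 : ℝ) 1, r.eval x ≤ 1 / ((p : ℝ) ^ 2 * x) := by
  have hp0 : (0 : ℝ) < p := by exact_mod_cast hp
  -- `T_p(1) = 1`, so the constant coefficient vanishes.
  have hdvd : (X : ℝ[X]) ∣ (1 - Chebyshev.T ℝ p).comp (1 - C 2 * X) := by
    rw [X_dvd_iff, coeff_zero_eq_eval_zero, eval_comp]; simp
  obtain ⟨s, hs⟩ := hdvd
  have hs' : ∀ x, 1 - (Chebyshev.T ℝ p).eval (1 - 2 * x) = x * s.eval x := by
    intro x
    have := congrArg (eval x) hs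
    simpa [eval_comp] using this
  -- the values at `x = (1 - cos θ) / 2`
  have hcos : ∀ θ : ℝ, 1 - Real.cos (p * θ) = (1 - Real.cos θ) / 2 * s.eval ((1 - Real.cos θ) / 2) := by
    intro θ
    rw [← hs', show 1 - 2 * ((1 - Real.cos θ) / 2) = Real.cos θ by ring]
    have := Chebyshev.T_real_cos θ p
    rw [this]; simp
  have hsin : ∀ (n : ℕ) (θ : ℝ), |Real.sin (n * θ)| ≤ n * |Real.sin θ| := by
    intro n θ
    induction n with
    | zero => simp
    | succ n ih =>
      push_cast
      rw [add_mul, one_mul, Real.sin_add]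
      have h1 := Real.abs_cos_le_one θ
      have h2 := Real.abs_cos_le_one (n * θ)
      calc _ ≤ |Real.sin (n * θ) * Real.cos θ| + |Real.cos (n * θ) * Real.sin θ| := abs_add_le _ _
        _ = |Real.sin (n * θ)| * |Real.cos θ| + |Real.cos (n * θ)| * |Real.sin θ| := by
          rw [abs_mul, abs_mul]
        _ ≤ |Real.sin (n * θ)| * 1 + 1 * |Real.sin θ| := by gcongr
        _ ≤ _ := by linarith
  have hval : ∀ x ∈ Ioc (0 : ℝ) 1, 0 ≤ x * s.eval x ∧ x * s.eval x ≤ 2 ∧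
      x * s.eval x ≤ 2 * p ^ 2 * x := by
    intro x hx
    obtain ⟨θ, hθ⟩ : ∃ θ, Real.cos θ = 1 - 2 * x :=
      ⟨Real.arccos (1 - 2 * x), Real.cos_arccos (by linarith [hx.2]) (by linarith [hx.1])⟩
    have h := hcos θ
    rw [hθ, show (1 - (1 - 2 * x)) / 2 = x by ring] at h
    have e1 : 1 - Real.cos (p * θ) = 2 * Real.sin (p * (θ / 2)) ^ 2 := by
      have := Real.cos_two_mul' (p * (θ / 2))
      have h2 := Real.sin_sq_add_cos_sq (p * (θ / 2))
      rw [show 2 * (p * (θ / 2)) = p * θ by ring] at this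
      linarith
    have e2 : 2 * x = 2 * Real.sin (θ / 2) ^ 2 := by
      have := Real.cos_two_mul' (θ / 2)
      have h2 := Real.sin_sq_add_cos_sq (θ / 2)
      rw [show 2 * (θ / 2) = θ by ring] at this
      linarith
    refine ⟨?_, ?_, ?_⟩
    · rw [← h]; linarith [Real.cos_le_one (p * θ)]
    · rw [← h]; linarith [Real.neg_one_le_cos (p * θ)]
    · rw [← h, e1, mul_right_comm, e2, ← sq_abs, ← sq_abs (Real.sin (θ / 2))]
      have := pow_le_pow_left₀ (abs_nonneg _) (hsin p (θ / 2)) 2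
      nlinarith
  -- Differentiating `1 - T_p(1 - 2x) = x s(x)` at `0` gives `s(0) = 2 T_p'(1) = 2 p²`.
  have hs0 : s.eval 0 = 2 * (p : ℝ) ^ 2 := by
    have hd := congrArg (fun q => (derivative q).eval 0) hs
    simp only [derivative_comp, derivative_mul, derivative_X, eval_add, eval_mul, eval_comp] at hd
    simp only [derivative_sub, derivative_one, Chebyshev.T_derivative_eq_U, derivative_mul,
      derivative_C, derivative_X] at hd
    simp [eval_sub] at hd
    rw [← hd]; ring
  refine ⟨C (2 * (p : ℝ) ^ 2)⁻¹ * s, ?_, ?_, ?_, ?_⟩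
  · refine (natDegree_C_mul_le _ _).trans ?_
    rcases eq_or_ne s 0 with rfl | h0
    · simp
    have h1 : (X * s).natDegree = s.natDegree + 1 := natDegree_X_mul h0
    have h2 : ((1 - Chebyshev.T ℝ p).comp (1 - C 2 * X)).natDegree ≤ p := by
      rw [show (1 - C 2 * X : ℝ[X]) = C (-2) * X + C 1 by simp; ring]
      apply natDegree_comp_affine_le
      refine (natDegree_sub_le _ _).trans ?_
      simp [Chebyshev.natDegree_T]
    rw [hs, h1] at h2
    omega
  · rw [eval_mul, eval_C, hs0]; field_simp
  · intro x hx
    rw [eval_mul, eval_C]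
    rcases hx.1.eq_or_lt with h | h
    · rw [← h, hs0]; constructor
      · positivity
      · apply le_of_eq; field_simp
    · obtain ⟨a, -, b⟩ := hval x ⟨h, hx.2⟩
      rw [mul_comm x] at b
      have a' := nonneg_of_mul_nonneg_right a h
      have b' := le_of_mul_le_mul_right b h
      refine ⟨by positivity, ?_⟩
      rw [inv_mul_le_iff₀ (by positivity)]; linarith
  · intro x hx
    obtain ⟨-, b, -⟩ := hval x hx
    have hx0 := hx.1
    rw [eval_mul, eval_C, le_div_iff₀ (by positivity)]
    calc _ = (x * s.eval x) / 2 := by field_simp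
      _ ≤ 1 := by linarith

/-- The Fejér kernel times `1 - x`: the factor makes it vanish at `1` and lie below the linear
cutoff. Its square integrates to at most `p⁻²` on `[0, p⁻²]`, and to at most `p⁻²` on the rest by
the decay `1 / (p² x)`. -/
theorem exists_cutoff {p : ℕ} (hp : 1 ≤ p) : ∃ r : ℝ[X], r.natDegree ≤ p ∧ r.eval 0 = 1 ∧
    r.eval 1 = 0 ∧ (∀ x ∈ Icc (0 : ℝ) 1, 0 ≤ r.eval x ∧ r.eval x ≤ 1 - x) ∧
    ∫ x in (0 : ℝ)..1, (r ^ 2).eval x ≤ 2 / (p : ℝ) ^ 2 := by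
  obtain ⟨s, hsd, hs0, hs1, hs2⟩ := exists_fejer hp
  have hp0 : (1 : ℝ) ≤ p := by exact_mod_cast hp
  have hle : ∀ x ∈ Icc (0 : ℝ) 1, 0 ≤ ((1 - X) * s).eval x ∧ ((1 - X) * s).eval x ≤ 1 - x ∧
      ((1 - X) * s).eval x ≤ s.eval x := by
    intro x hx
    have h := hs1 x hx
    simp only [eval_mul, eval_sub, eval_one, eval_X]
    have hx2 : 0 ≤ 1 - x := by linarith [hx.2]
    exact ⟨mul_nonneg hx2 h.1, by nlinarith, by nlinarith [hx.1]⟩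
  refine ⟨(1 - X) * s, ?_, by simp [hs0], by simp, fun x hx => ⟨(hle x hx).1, (hle x hx).2.1⟩, ?_⟩
  · refine natDegree_mul_le.trans ?_
    have : (1 - X : ℝ[X]).natDegree ≤ 1 := by
      refine (natDegree_sub_le _ _).trans (by simp)
    omega
  set r := (1 - X) * s
  set δ : ℝ := 1 / (p : ℝ) ^ 2 with hδ
  have hδ0 : 0 < δ := by positivity
  have hδ1 : δ ≤ 1 := by rw [hδ, div_le_one (by positivity)]; nlinarith
  rw [← intervalIntegral.integral_add_adjacent_intervals
    (intervalIntegrable_eval (r ^ 2) 0 δ) (intervalIntegrable_eval (r ^ 2) δ 1)]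
  have h1 : ∫ x in (0 : ℝ)..δ, (r ^ 2).eval x ≤ δ := by
    have h := intervalIntegral.integral_mono_on hδ0.le
      (intervalIntegrable_eval (r ^ 2) 0 δ)
      (intervalIntegrable_const (c := (1 : ℝ))) (fun x hx => by
        have hx' : x ∈ Icc (0 : ℝ) 1 := ⟨hx.1, hx.2.trans hδ1⟩
        rw [eval_pow]
        exact pow_le_one₀ (hle x hx').1 (by linarith [(hle x hx').2.1, hx.1]))
    simpa using h
  have h2 : ∫ x in δ..1, (r ^ 2).eval x ≤ δ := by
    have hF : ∀ x ∈ Icc δ 1, HasDerivAt (fun x : ℝ => - (δ ^ 2 * x⁻¹)) (δ ^ 2 * (x ^ 2)⁻¹) x := by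
      intro x hx
      have hx0 : x ≠ 0 := (hδ0.trans_le hx.1).ne'
      have := ((hasDerivAt_inv hx0).const_mul (δ ^ 2)).neg
      rwa [mul_neg, neg_neg] at this
    have hcont : ContinuousOn (fun x : ℝ => δ ^ 2 * (x ^ 2)⁻¹) (uIcc δ 1) := by
      rw [uIcc_of_le hδ1]
      intro x hx
      have hx0 : x ≠ 0 := (hδ0.trans_le hx.1).ne'
      exact (continuousAt_const.mul ((continuousAt_id.pow 2).inv₀ (by simpa using hx0))).continuousWithinAt
    have h := intervalIntegral.integral_mono_on hδ1
      (intervalIntegrable_eval (r ^ 2) δ 1) (hcont.intervalIntegrable) (fun x hx => by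
        have hx0 : 0 < x := hδ0.trans_le hx.1
        have hx' : x ∈ Icc (0 : ℝ) 1 := ⟨hx0.le, hx.2⟩
        rw [eval_pow, ← inv_pow, ← mul_pow]
        refine pow_le_pow_left₀ (hle x hx').1 ((hle x hx').2.2.trans ((hs2 x ⟨hx0, hx.2⟩).trans ?_)) 2
        rw [hδ]; apply le_of_eq; field_simp)
    refine h.trans ?_
    rw [intervalIntegral.integral_eq_sub_of_hasDerivAt (fun x hx => hF x (by rwa [uIcc_of_le hδ1] at hx))
      hcont.intervalIntegrable]
    have : δ ^ 2 * δ⁻¹ = δ := by field_simp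
    rw [this]; simp; positivity
  have : 2 / (p : ℝ) ^ 2 = δ + δ := by rw [hδ]; ring
  linarith

end UnitIntervalPoly

/-! ### Coordinates in the plane -/

/-- The other coordinate. -/
def oth (i : Fin 2) : Fin 2 := i + 1

@[simp] theorem oth_oth (i : Fin 2) : oth (oth i) = i := by fin_cases i <;> rfl

@[simp] theorem oth_ne (i : Fin 2) : oth i ≠ i := by fin_cases i <;> decide

@[simp] theorem ne_oth (i : Fin 2) : i ≠ oth i := by fin_cases i <;> decide

theorem eq_or_eq_oth (i k : Fin 2) : k = i ∨ k = oth i := by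
  fin_cases i <;> fin_cases k <;> decide

theorem forall_coord (i : Fin 2) {P : Fin 2 → Prop} : (∀ k, P k) ↔ P i ∧ P (oth i) :=
  ⟨fun h => ⟨h _, h _⟩, fun h k => by rcases eq_or_eq_oth i k with rfl | rfl; exacts [h.1, h.2]⟩

/-- The point with coordinate `i` equal to `a` and the other coordinate equal to `c`. -/
def pt (i : Fin 2) (a c : ℝ) : Plane := WithLp.toLp 2 fun k => if k = i then a else c

@[simp] theorem pt_self (i : Fin 2) (a c : ℝ) : pt i a c i = a := by simp [pt]

@[simp] theorem pt_oth (i : Fin 2) (a c : ℝ) : pt i a c (oth i) = c := by simp [pt]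

theorem plane_ext (i : Fin 2) {x y : Plane} (h1 : x i = y i) (h2 : x (oth i) = y (oth i)) :
    x = y := by
  ext k; rcases eq_or_eq_oth i k with rfl | rfl <;> assumption

theorem pt_eta (i : Fin 2) (x : Plane) : pt i (x i) (x (oth i)) = x :=
  plane_ext i (by simp) (by simp)

theorem pt_oth_comm (i : Fin 2) (a c : ℝ) : pt (oth i) c a = pt i a c :=
  plane_ext i (by have := pt_oth (oth i) c a; rw [oth_oth] at this; simp [this]) (by simp)

theorem exists_coord_nhds {U : Set Plane} (hU : IsOpen U) {z : Plane} (hz : z ∈ U) :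
    ∃ r > 0, ∀ y : Plane, (∀ i, |y i - z i| < r) → y ∈ U := by
  have hc : Continuous (fun f : Fin 2 → ℝ => (WithLp.toLp 2 f : Plane)) :=
    PiLp.continuous_toLp 2 _
  have ho := hU.preimage hc
  obtain ⟨r, hr, h⟩ := Metric.isOpen_iff.1 ho (WithLp.ofLp z) hz
  refine ⟨r, hr, fun y hy => ?_⟩
  have : WithLp.ofLp y ∈ Metric.ball (WithLp.ofLp z) r := by
    rw [Metric.mem_ball, dist_pi_lt_iff hr]
    intro i; rw [Real.dist_eq]; exact hy i
  exact h this

theorem continuous_coord (i : Fin 2) : Continuous (fun x : Plane => x i) :=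
  PiLp.continuous_apply 2 _ i

theorem abs_coord_sub_le_dist (x y : Plane) (i : Fin 2) : |x i - y i| ≤ dist x y := by
  have := PiLp.norm_apply_le (p := 2) (x - y) i
  rwa [← dist_eq_norm] at this

theorem dist_le_coord (x y : Plane) (i : Fin 2) :
    dist x y ≤ |x i - y i| + |x (oth i) - y (oth i)| := by
  have h0 : dist x y = √(∑ k, dist (x k) (y k) ^ 2) := EuclideanSpace.dist_eq x y
  have h : ∑ k, dist (x k) (y k) ^ 2 = |x i - y i| ^ 2 + |x (oth i) - y (oth i)| ^ 2 := by
    rw [Fin.sum_univ_two]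
    fin_cases i <;> simp [oth, Real.dist_eq]; ring
  rw [h0, h]
  apply Real.sqrt_le_iff.2
  constructor
  · positivity
  · nlinarith [abs_nonneg (x i - y i), abs_nonneg (x (oth i) - y (oth i))]

/-! ### Closed rectangles, their sides and vertices, and the quadrants at a point -/

namespace Rect

theorem isOpen_carrier (K : Rect) : IsOpen K.carrier := by
  have : K.carrier = ⋂ i, {x : Plane | K.lo i < x i} ∩ {x | x i < K.hi i} := by
    ext x; simp [carrier]
  rw [this]
  exact isOpen_iInter_of_finite fun i =>
    (isOpen_lt continuous_const (continuous_coord i)).inter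
      (isOpen_lt (continuous_coord i) continuous_const)

theorem mem_closure {K : Rect} {x : Plane} :
    x ∈ closure K.carrier ↔ ∀ i, K.lo i ≤ x i ∧ x i ≤ K.hi i := by
  constructor
  · intro h
    have hc : IsClosed (⋂ i, {x : Plane | K.lo i ≤ x i} ∩ {x | x i ≤ K.hi i}) :=
      isClosed_iInter fun i => (isClosed_le continuous_const (continuous_coord i)).inter
        (isClosed_le (continuous_coord i) continuous_const)
    have := closure_minimal (fun y hy => mem_iInter.2 fun i =>
      (⟨(hy i).1.le, (hy i).2.le⟩ : K.lo i ≤ y i ∧ y i ≤ K.hi i)) hc h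
    exact fun i => mem_iInter.1 this i
  · intro h
    rw [mem_closure_iff]
    intro U hU hx
    obtain ⟨r, hr, hrU⟩ := exists_coord_nhds hU hx
    -- move towards the midpoint
    have key : ∀ i, ∃ t, |t - x i| < r ∧ K.lo i < t ∧ t < K.hi i := by
      intro i
      have hlt := K.lo_lt_hi i
      obtain ⟨h1, h2⟩ := h i
      rcases h1.eq_or_lt with h1 | h1
      · refine ⟨x i + min (r / 2) ((K.hi i - K.lo i) / 2), ?_, ?_, ?_⟩
        · have : 0 < min (r / 2) ((K.hi i - K.lo i) / 2) := lt_min (by linarith) (by linarith)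
          rw [add_sub_cancel_left, abs_of_pos this]
          linarith [min_le_left (r / 2) ((K.hi i - K.lo i) / 2)]
        · have : 0 < min (r / 2) ((K.hi i - K.lo i) / 2) := lt_min (by linarith) (by linarith)
          linarith
        · linarith [min_le_right (r / 2) ((K.hi i - K.lo i) / 2)]
      · refine ⟨x i - min (r / 2) ((x i - K.lo i) / 2), ?_, ?_, ?_⟩
        · have : 0 < min (r / 2) ((x i - K.lo i) / 2) := lt_min (by linarith) (by linarith)
          rw [sub_sub_cancel_left, abs_neg, abs_of_pos this]
          linarith [min_le_left (r / 2) ((x i - K.lo i) / 2)]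
        · linarith [min_le_right (r / 2) ((x i - K.lo i) / 2)]
        · have : 0 < min (r / 2) ((x i - K.lo i) / 2) := lt_min (by linarith) (by linarith)
          linarith
    choose t ht using key
    exact ⟨WithLp.toLp 2 t, hrU _ fun i => (ht i).1, fun i => (ht i).2⟩

theorem mem_frontier {K : Rect} {x : Plane} :
    x ∈ frontier K.carrier ↔ x ∈ closure K.carrier ∧ x ∉ K.carrier := by
  rw [K.isOpen_carrier.frontier_eq]; rfl

/-- The side coordinate: `hi` for `true` and `lo` for `false`. -/
def bd (K : Rect) (i : Fin 2) (b : Bool) : ℝ := if b then K.hi i else K.lo i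

@[simp] theorem bd_true (K : Rect) (i : Fin 2) : K.bd i true = K.hi i := rfl
@[simp] theorem bd_false (K : Rect) (i : Fin 2) : K.bd i false = K.lo i := rfl

theorem lo_le_bd (K : Rect) (i : Fin 2) (b : Bool) : K.lo i ≤ K.bd i b := by
  cases b <;> simp [(K.lo_lt_hi i).le]

theorem bd_le_hi (K : Rect) (i : Fin 2) (b : Bool) : K.bd i b ≤ K.hi i := by
  cases b <;> simp [(K.lo_lt_hi i).le]

theorem mem_vertices {K : Rect} {x : Plane} : x ∈ K.vertices ↔ ∀ i, ∃ b, x i = K.bd i b := by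
  simp [vertices]

theorem vertices_subset_closure (K : Rect) : K.vertices ⊆ closure K.carrier := by
  intro x hx
  rw [mem_closure]
  intro i
  have := K.lo_lt_hi i
  rcases hx i with h | h <;> rw [h] <;> constructor <;> linarith

theorem vertices_disjoint_carrier (K : Rect) {x : Plane} (hx : x ∈ K.vertices) :
    x ∉ K.carrier := fun h => by
  have := h 0
  rcases hx 0 with h | h <;> rw [h] at this <;> linarith [this.1, this.2]

theorem pt_mem_vertices (K : Rect) (i : Fin 2) (b b' : Bool) :
    pt i (K.bd i b) (K.bd (oth i) b') ∈ K.vertices := by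
  rw [mem_vertices, forall_coord i]
  exact ⟨⟨b, by simp⟩, ⟨b', by simp⟩⟩

/-- `z` lies in the interior of the side `(i, b)` of `K`. -/
structure MidSide (K : Rect) (z : Plane) (i : Fin 2) (b : Bool) : Prop where
  eq : z i = K.bd i b
  lo_lt : K.lo (oth i) < z (oth i)
  lt_hi : z (oth i) < K.hi (oth i)

theorem MidSide.mem_closure {K : Rect} {z : Plane} {i : Fin 2} {b : Bool} (h : K.MidSide z i b) :
    z ∈ closure K.carrier := by
  rw [Rect.mem_closure, forall_coord i, h.eq]
  exact ⟨⟨K.lo_le_bd i b, K.bd_le_hi i b⟩, h.lo_lt.le, h.lt_hi.le⟩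

/-- A point of the closed rectangle is interior, interior to a side, or a vertex. -/
theorem trichotomy {K : Rect} {x : Plane} (hx : x ∈ closure K.carrier) :
    x ∈ K.carrier ∨ (∃ i b, K.MidSide x i b) ∨ x ∈ K.vertices := by
  rw [mem_closure] at hx
  have key : ∀ i, (K.lo i < x i ∧ x i < K.hi i) ∨ ∃ b, x i = K.bd i b := by
    intro i
    rcases (hx i).1.eq_or_lt with h | h
    · exact Or.inr ⟨false, h.symm⟩
    rcases (hx i).2.eq_or_lt with h' | h'
    · exact Or.inr ⟨true, h'⟩
    · exact Or.inl ⟨h, h'⟩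
  rcases key 0 with h0 | ⟨b0, h0⟩ <;> rcases key 1 with h1 | ⟨b1, h1⟩
  · exact Or.inl (Fin.forall_fin_two.2 ⟨h0, h1⟩)
  · exact Or.inr (Or.inl ⟨1, b1, h1, h0.1, h0.2⟩)
  · exact Or.inr (Or.inl ⟨0, b0, h0, h1.1, h1.2⟩)
  · exact Or.inr (Or.inr (mem_vertices.2 (Fin.forall_fin_two.2 ⟨⟨b0, h0⟩, ⟨b1, h1⟩⟩)))

/-- `K` fills the quadrant `e` at `z`. -/
def Covers (K : Rect) (z : Plane) (e : Fin 2 → Bool) : Prop :=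
  ∀ i, (e i = true → K.lo i ≤ z i ∧ z i < K.hi i) ∧ (e i = false → K.lo i < z i ∧ z i ≤ K.hi i)

theorem Covers.mem_closure {K : Rect} {z : Plane} {e : Fin 2 → Bool} (h : K.Covers z e) :
    z ∈ closure K.carrier := by
  rw [Rect.mem_closure]
  intro i
  obtain ⟨h1, h2⟩ := h i
  cases he : e i
  · exact ⟨(h2 he).1.le, (h2 he).2⟩
  · exact ⟨(h1 he).1, (h1 he).2.le⟩

theorem exists_covers {K : Rect} {z : Plane} (h : z ∈ closure K.carrier) :
    ∃ e, K.Covers z e := by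
  rw [Rect.mem_closure] at h
  refine ⟨fun i => decide (z i < K.hi i), fun i => ⟨fun hi => ?_, fun hi => ?_⟩⟩
  · exact ⟨(h i).1, by simpa using hi⟩
  · have h1 := K.lo_lt_hi i
    have h2 : K.hi i ≤ z i := by simpa using hi
    exact ⟨h1.trans_le h2, (h i).2⟩

/-- The points of the quadrant `e` at `z` at coordinate distance less than `r`. -/
def _root_.quadrant (z : Plane) (e : Fin 2 → Bool) (r : ℝ) : Set Plane :=
  {y | ∀ i, (e i = true → z i < y i ∧ y i < z i + r) ∧ (e i = false → z i - r < y i ∧ y i < z i)}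

theorem _root_.quadrant_nonempty (z : Plane) (e : Fin 2 → Bool) {r : ℝ} (hr : 0 < r) :
    (quadrant z e r).Nonempty := by
  refine ⟨WithLp.toLp 2 fun i => if e i then z i + r / 2 else z i - r / 2, fun i => ?_⟩
  constructor <;> intro h <;> simp [h] <;> linarith

theorem _root_.quadrant_mono (z : Plane) (e : Fin 2 → Bool) {r s : ℝ} (h : r ≤ s) :
    quadrant z e r ⊆ quadrant z e s := fun _ hy i =>
  ⟨fun hi => ⟨((hy i).1 hi).1, by linarith [((hy i).1 hi).2]⟩,
    fun hi => ⟨by linarith [((hy i).2 hi).1], ((hy i).2 hi).2⟩⟩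

theorem _root_.abs_sub_lt_of_mem_quadrant {z y : Plane} {e : Fin 2 → Bool} {r : ℝ}
    (h : y ∈ quadrant z e r) (i : Fin 2) : |y i - z i| < r := by
  rw [abs_lt]
  cases he : e i
  · have := (h i).2 he; constructor <;> linarith [this.1, this.2]
  · have := (h i).1 he; constructor <;> linarith [this.1, this.2]

theorem Covers.exists_quadrant_subset {K : Rect} {z : Plane} {e : Fin 2 → Bool}
    (h : K.Covers z e) : ∃ r > 0, quadrant z e r ⊆ K.carrier := by
  have key : ∀ i, ∃ r > 0, ∀ t, ((e i = true → z i < t ∧ t < z i + r) ∧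
      (e i = false → z i - r < t ∧ t < z i)) → K.lo i < t ∧ t < K.hi i := by
    intro i
    cases he : e i
    · obtain ⟨h1, h2⟩ := (h i).2 he
      refine ⟨z i - K.lo i, by linarith, fun t ht => ?_⟩
      have := ht.2 rfl
      constructor <;> linarith [this.1, this.2]
    · obtain ⟨h1, h2⟩ := (h i).1 he
      refine ⟨K.hi i - z i, by linarith, fun t ht => ?_⟩
      have := ht.1 rfl
      constructor <;> linarith [this.1, this.2]
  choose r hr hr' using key
  refine ⟨min (r 0) (r 1), lt_min (hr 0) (hr 1), fun y hy i => hr' i (y i) ?_⟩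
  have : min (r 0) (r 1) ≤ r i := by fin_cases i; exacts [min_le_left _ _, min_le_right _ _]
  exact quadrant_mono z e this hy i

theorem exists_quadrant_disjoint {K : Rect} {z : Plane} {e : Fin 2 → Bool}
    (h : ¬ K.Covers z e) : ∃ r > 0, ∀ y ∈ quadrant z e r, y ∉ closure K.carrier := by
  simp only [Covers, not_forall] at h
  obtain ⟨i, hi⟩ := h
  simp only [Rect.mem_closure, not_forall]
  cases he : e i
  · simp only [he, Bool.false_eq_true, false_imp_iff, true_and, forall_const, not_and_or,
      not_lt, not_le] at hi
    rcases hi with h | h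
    · exact ⟨1, one_pos, fun y hy => ⟨i, fun hc => by linarith [((hy i).2 he).2]⟩⟩
    · exact ⟨z i - K.hi i, by linarith, fun y hy => ⟨i, fun hc => by linarith [((hy i).2 he).1]⟩⟩
  · simp only [he, Bool.true_eq_false, false_imp_iff, and_true, forall_const, not_and_or,
      not_lt, not_le] at hi
    rcases hi with h | h
    · exact ⟨K.lo i - z i, by linarith, fun y hy => ⟨i, fun hc => by linarith [((hy i).1 he).2]⟩⟩
    · exact ⟨1, one_pos, fun y hy => ⟨i, fun hc => by linarith [((hy i).1 he).1]⟩⟩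

end Rect

/-! ### Quadrants filled by mesh elements, in the interior and at the Lipschitz boundary -/

theorem mem_region {M : Finset Rect} {x : Plane} :
    x ∈ region M ↔ ∃ K ∈ M, x ∈ closure K.carrier := by
  simp [region]

theorem isClosed_region (M : Finset Rect) : IsClosed (region M) :=
  M.finite_toSet.isClosed_biUnion fun _ _ => isClosed_closure

/-- Some element of the mesh fills the quadrant `e` at `z`. -/
def Filled (M : Finset Rect) (z : Plane) (e : Fin 2 → Bool) : Prop := ∃ K ∈ M, K.Covers z e

theorem exists_quadrant_disjoint_region {M : Finset Rect} {z : Plane} {e : Fin 2 → Bool}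
    (h : ¬ Filled M z e) : ∃ r > 0, ∀ y ∈ quadrant z e r, y ∉ region M := by
  classical
  induction M using Finset.induction_on with
  | empty => exact ⟨1, one_pos, fun y _ => by simp [region]⟩
  | insert K M hK ih =>
    have h1 : ¬ K.Covers z e := fun hc => h ⟨K, by simp, hc⟩
    have h2 : ¬ Filled M z e := fun ⟨K', hK', hc⟩ => h ⟨K', by simp [hK'], hc⟩
    obtain ⟨r, hr, hr'⟩ := ih h2
    obtain ⟨s, hs, hs'⟩ := Rect.exists_quadrant_disjoint h1
    refine ⟨min r s, lt_min hr hs, fun y hy => ?_⟩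
    rw [mem_region]
    rintro ⟨K', hK', hc⟩
    rcases Finset.mem_insert.1 hK' with rfl | hm
    · exact hs' y (quadrant_mono z e (min_le_right _ _) hy) hc
    · exact hr' y (quadrant_mono z e (min_le_left _ _) hy) (mem_region.2 ⟨K', hm, hc⟩)

namespace IsMesh

variable {Ω : Set Plane} {M : Finset Rect}

theorem eq_of_mem_carrier_of_mem_closure (hM : IsMesh Ω M) {K K' : Rect} (hK : K ∈ M)
    (hK' : K' ∈ M) {x : Plane} (h : x ∈ K.carrier) (h' : x ∈ closure K'.carrier) : K = K' := by
  by_contra hne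
  obtain ⟨y, hy, hy'⟩ := mem_closure_iff.1 h' _ K.isOpen_carrier h
  exact disjoint_left.1 (hM.disjoint K hK K' hK' hne) hy hy'

theorem covers_unique (hM : IsMesh Ω M) {K K' : Rect} (hK : K ∈ M) (hK' : K' ∈ M) {z : Plane}
    {e : Fin 2 → Bool} (h : K.Covers z e) (h' : K'.Covers z e) : K = K' := by
  by_contra hne
  obtain ⟨r, hr, hs⟩ := h.exists_quadrant_subset
  obtain ⟨r', hr', hs'⟩ := h'.exists_quadrant_subset
  obtain ⟨y, hy⟩ := quadrant_nonempty z e (lt_min hr hr')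
  exact disjoint_left.1 (hM.disjoint K hK K' hK' hne)
    (hs (quadrant_mono z e (min_le_left _ _) hy)) (hs' (quadrant_mono z e (min_le_right _ _) hy))

theorem closure_subset (hM : IsMesh Ω M) {K : Rect} (hK : K ∈ M) :
    closure K.carrier ⊆ closure Ω := closure_mono (hM.subset K hK)

theorem filled_of_mem (hM : IsMesh Ω M) (hΩ : IsOpen Ω) {z : Plane} (hz : z ∈ Ω)
    (e : Fin 2 → Bool) : Filled M z e := by
  by_contra h
  obtain ⟨r, hr, h1⟩ := exists_quadrant_disjoint_region h
  obtain ⟨s, hs, h2⟩ := exists_coord_nhds hΩ hz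
  obtain ⟨y, hy⟩ := quadrant_nonempty z e (lt_min hr hs)
  refine h1 y (quadrant_mono z e (min_le_left _ _) hy) ?_
  rw [hM.cover]
  exact subset_closure (h2 y fun i =>
    abs_sub_lt_of_mem_quadrant (quadrant_mono z e (min_le_right _ _) hy) i)

end IsMesh

/-- In the local coordinates `z` lies on the graph. A short step in the graph direction enters `Ω`,
and the opposite step ends strictly on the other side, hence outside the closure. This is the form
in which the Lipschitz condition is used. -/
theorem IsBoundedLipschitz.exists_antipodal {Ω : Set Plane} (hΩ : IsBoundedLipschitz Ω)
    {z : Plane} (hz : z ∈ frontier Ω) {ε : ℝ} (hε : 0 < ε) :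
    ∃ u : Plane, ‖u‖ < ε ∧ z + u ∈ Ω ∧ z - u ∉ closure Ω := by
  obtain ⟨hO, -, hL⟩ := hΩ
  obtain ⟨r, hr, R, L, φ, hφ, hball⟩ := hL z hz
  have hφc := hφ.continuous
  have hR : ∀ i, Continuous fun y : Plane => R y i := fun i => (continuous_coord i).comp R.continuous
  have hzball : z ∈ Metric.ball z r := Metric.mem_ball_self hr
  have hzΩ : z ∉ Ω := by
    rw [hO.frontier_eq] at hz; exact hz.2
  have h1 : R z 1 ≤ φ (R z 0) := not_lt.1 fun h => hzΩ ((hball z hzball).2 h)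
  have h2 : φ (R z 0) ≤ R z 1 := by
    by_contra hlt
    push Not at hlt
    have hU : IsOpen (Metric.ball z r ∩ {y : Plane | R y 1 < φ (R y 0)}) :=
      Metric.isOpen_ball.inter (isOpen_lt (hR 1) (hφc.comp (hR 0)))
    obtain ⟨y, hy, hyΩ⟩ := mem_closure_iff.1 (frontier_subset_closure hz) _ hU ⟨hzball, hlt⟩
    have := (hball y hy.1).1 hyΩ
    have h3 : R y 1 < φ (R y 0) := hy.2
    linarith
  have heq : φ (R z 0) = R z 1 := le_antisymm h2 h1
  set t : ℝ := min (ε / 2) (r / 2) with ht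
  have ht0 : 0 < t := lt_min (by linarith) (by linarith)
  set u : Plane := R.symm (pt 1 t 0) with hu
  have hRu : R u = pt 1 t 0 := by simp [hu]
  have hnu : ‖u‖ = t := by
    rw [hu, LinearIsometryEquiv.norm_map, EuclideanSpace.norm_eq, Fin.sum_univ_two]
    have : (0 : Fin 2) = oth 1 := by decide
    rw [pt_self, this, pt_oth]
    simp [Real.sqrt_sq ht0.le]
  have hu0 : R u 0 = 0 := by
    have : (0 : Fin 2) = oth 1 := by decide
    rw [hRu, this, pt_oth]
  have hu1 : R u 1 = t := by rw [hRu, pt_self]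
  have htr : t < r := lt_of_le_of_lt (min_le_right _ _) (by linarith)
  refine ⟨u, by rw [hnu]; exact lt_of_le_of_lt (min_le_left _ _) (by linarith), ?_, ?_⟩
  · rw [hball _ (by simp [hnu, htr]), map_add, PiLp.add_apply, PiLp.add_apply, hu0, hu1, add_zero,
      heq]
    linarith
  · intro hcl
    have hU : IsOpen (Metric.ball z r ∩ {y : Plane | R y 1 < φ (R y 0)}) :=
      Metric.isOpen_ball.inter (isOpen_lt (hR 1) (hφc.comp (hR 0)))
    have hmem : z - u ∈ Metric.ball z r ∩ {y : Plane | R y 1 < φ (R y 0)} := by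
      refine ⟨by simp [hnu, htr], ?_⟩
      simp only [mem_ofPred_eq]
      rw [map_sub, PiLp.sub_apply, PiLp.sub_apply, hu0, hu1, sub_zero, heq]
      linarith
    obtain ⟨y, hy, hyΩ⟩ := mem_closure_iff.1 hcl _ hU hmem
    have := (hball y hy.1).1 hyΩ
    have h3 : R y 1 < φ (R y 0) := hy.2
    linarith

namespace IsMesh

variable {Ω : Set Plane} {M : Finset Rect}

/-- At a boundary point some quadrant is filled while the opposite one is not. -/
theorem exists_filled_not_filled (hM : IsMesh Ω M) (hΩ : IsBoundedLipschitz Ω) {z : Plane}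
    (hz : z ∈ frontier Ω) : ∃ e, Filled M z e ∧ ¬ Filled M z (fun i => !e i) := by
  by_contra hcon
  push Not at hcon
  -- a radius which works for all quadrants
  have key : ∀ e, ∃ r > 0, (Filled M z e → quadrant z e r ⊆ region M) ∧
      (¬ Filled M z e → ∀ y ∈ quadrant z e r, y ∉ region M) := by
    intro e
    by_cases h : Filled M z e
    · obtain ⟨K, hK, hc⟩ := h
      obtain ⟨r, hr, hs⟩ := hc.exists_quadrant_subset
      exact ⟨r, hr, fun _ y hy => mem_region.2 ⟨K, hK, subset_closure (hs hy)⟩,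
        fun h => (h ⟨K, hK, hc⟩).elim⟩
    · obtain ⟨r, hr, hs⟩ := exists_quadrant_disjoint_region h
      exact ⟨r, hr, fun h' => (h h').elim, fun _ => hs⟩
  choose r hr h1 h2 using key
  obtain ⟨ρ, hρ, hρr⟩ : ∃ ρ > 0, ∀ e, ρ ≤ r e := by
    obtain ⟨e0, -, he0⟩ := Finset.exists_min_image Finset.univ r ⟨fun _ => true, Finset.mem_univ _⟩
    exact ⟨r e0, hr e0, fun e => he0 e (Finset.mem_univ _)⟩
  obtain ⟨u, hu, huΩ, huc⟩ := hΩ.exists_antipodal hz (half_pos hρ)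
  obtain ⟨s, hs, hs'⟩ := exists_coord_nhds hΩ.1 huΩ
  obtain ⟨s', hs0, hs''⟩ := exists_coord_nhds (isClosed_closure (s := Ω)).isOpen_compl huc
  -- perturb `u` so that no coordinate vanishes
  have hw : ∀ i, ∃ w : ℝ, w ≠ 0 ∧ |w - u i| < min (min s s') (ρ / 2) := by
    intro i
    have hm : 0 < min (min s s') (ρ / 2) := lt_min (lt_min hs hs0) (half_pos hρ)
    by_cases h : u i = 0
    · refine ⟨min (min s s') (ρ / 2) / 2, by positivity, ?_⟩
      rw [h, sub_zero, abs_of_pos (by positivity)]; linarith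
    · exact ⟨u i, h, by simpa using hm⟩
  choose w hw0 hw1 using hw
  have hwρ : ∀ i, |w i| < ρ := by
    intro i
    have h3 : |u i| ≤ ‖u‖ := PiLp.norm_apply_le u i
    have h4 := (hw1 i).trans_le (min_le_right _ _)
    have := abs_sub_abs_le_abs_sub (w i) (u i)
    linarith
  set e : Fin 2 → Bool := fun i => decide (0 < w i) with he
  have hq1 : z + WithLp.toLp 2 w ∈ quadrant z e ρ := by
    intro i
    have := abs_lt.1 (hwρ i)
    simp only [he, decide_eq_true_eq, decide_eq_false_iff_not, PiLp.add_apply, not_lt]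
    constructor <;> intro h
    · constructor <;> linarith
    · have := lt_of_le_of_ne h (hw0 i)
      constructor <;> linarith
  have hq2 : z - WithLp.toLp 2 w ∈ quadrant z (fun i => !e i) ρ := by
    intro i
    have := abs_lt.1 (hwρ i)
    simp only [he, Bool.not_eq_true', Bool.not_eq_false', decide_eq_true_eq,
      decide_eq_false_iff_not, PiLp.sub_apply, not_lt]
    constructor <;> intro h
    · have := lt_of_le_of_ne h (hw0 i)
      constructor <;> linarith
    · constructor <;> linarith
  have hin : z + WithLp.toLp 2 w ∈ region M := by
    rw [hM.cover]
    refine subset_closure (hs' _ fun i => ?_)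
    have := (hw1 i).trans_le ((min_le_left _ _).trans (min_le_left _ _))
    simpa using this
  have hout : z - WithLp.toLp 2 w ∉ region M := by
    rw [hM.cover]
    refine hs'' _ fun i => ?_
    have := (hw1 i).trans_le ((min_le_left _ _).trans (min_le_right _ _))
    rw [abs_sub_comm] at this
    simpa using this
  have hf : Filled M z e := by
    by_contra h
    exact h2 e h _ (quadrant_mono z e (hρr e) hq1) hin
  exact hout (h1 _ (hcon e hf) (quadrant_mono z _ (hρr _) hq2))

end IsMesh

/-! ### Traces of polynomials on axis-parallel lines -/

/-- The restriction of a polynomial to the line `x_i = c`. -/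
def lineTrace (i : Fin 2) (c : ℝ) : MvPolynomial (Fin 2) ℝ →ₐ[ℝ] Polynomial ℝ :=
  MvPolynomial.aeval fun k => if k = i then Polynomial.C c else Polynomial.X

theorem eval_lineTrace (i : Fin 2) (c t : ℝ) (q : MvPolynomial (Fin 2) ℝ) :
    (lineTrace i c q).eval t = polyEval q (pt i c t) := by
  induction q using MvPolynomial.induction_on with
  | C a => simp [lineTrace, polyEval]
  | add q r hq hr => simp only [polyEval, map_add, Polynomial.eval_add] at *; rw [hq, hr]
  | mul_X q k hq =>
    simp only [polyEval, map_mul, Polynomial.eval_mul] at *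
    rw [hq]
    by_cases h : k = i <;> simp [lineTrace, pt, h]

theorem natDegree_lineTrace_le {p : ℕ} {q : MvPolynomial (Fin 2) ℝ} (hq : q ∈ Qp p) (i : Fin 2)
    (c : ℝ) : (lineTrace i c q).natDegree ≤ p := by
  rw [lineTrace, MvPolynomial.aeval_def, MvPolynomial.eval₂_eq']
  refine Polynomial.natDegree_sum_le_of_forall_le _ _ fun d hd => ?_
  have hd' := (MvPolynomial.mem_restrictDegree _ _ _).1 hq d hd
  refine (Polynomial.natDegree_C_mul_le _ _).trans ?_
  have : ∏ k, (if k = i then Polynomial.C c else Polynomial.X : Polynomial ℝ) ^ d k =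
      Polynomial.C (c ^ d i) * Polynomial.X ^ d (oth i) := by
    rw [Fin.prod_univ_two]
    fin_cases i
    · simp [oth]
    · have : (1 : Fin 2) + 1 = 0 := rfl
      simp [oth, mul_comm, this]
  rw [this]
  exact (Polynomial.natDegree_C_mul_le _ _).trans (by simpa using hd' (oth i))

@[simp] theorem polyEval_add (q r : MvPolynomial (Fin 2) ℝ) (x : Plane) :
    polyEval (q + r) x = polyEval q x + polyEval r x := by simp [polyEval]

@[simp] theorem polyEval_sub (q r : MvPolynomial (Fin 2) ℝ) (x : Plane) :
    polyEval (q - r) x = polyEval q x - polyEval r x := by simp [polyEval]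

@[simp] theorem polyEval_mul (q r : MvPolynomial (Fin 2) ℝ) (x : Plane) :
    polyEval (q * r) x = polyEval q x * polyEval r x := by simp [polyEval]

@[simp] theorem polyEval_neg (q : MvPolynomial (Fin 2) ℝ) (x : Plane) :
    polyEval (-q) x = - polyEval q x := by simp [polyEval]

@[simp] theorem polyEval_smul (c : ℝ) (q : MvPolynomial (Fin 2) ℝ) (x : Plane) :
    polyEval (c • q) x = c * polyEval q x := by simp [polyEval]

theorem continuous_polyEval (q : MvPolynomial (Fin 2) ℝ) : Continuous (polyEval q) := by
  have h := q.continuous_eval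
  exact h.comp (continuous_pi fun i => continuous_coord i)

/-- A univariate polynomial in the coordinate `j`. -/
def inCoord (j : Fin 2) : Polynomial ℝ →ₐ[ℝ] MvPolynomial (Fin 2) ℝ :=
  Polynomial.aeval (MvPolynomial.X j)

theorem polyEval_inCoord (j : Fin 2) (f : Polynomial ℝ) (x : Plane) :
    polyEval (inCoord j f) x = f.eval (x j) := by
  induction f using Polynomial.induction_on' with
  | add f g hf hg => simp only [polyEval, map_add, Polynomial.eval_add] at *; rw [hf, hg]
  | monomial n a => simp [inCoord, polyEval, Polynomial.aeval_monomial, MvPolynomial.algebraMap_eq]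

theorem degreeOf_inCoord_le (j k : Fin 2) (f : Polynomial ℝ) :
    (inCoord j f).degreeOf k ≤ if k = j then f.natDegree else 0 := by
  rw [inCoord, Polynomial.aeval_eq_sum_range]
  refine (MvPolynomial.degreeOf_sum_le _ _ _).trans (Finset.sup_le fun n hn => ?_)
  rw [MvPolynomial.smul_eq_C_mul]
  refine (MvPolynomial.degreeOf_C_mul_le _ _ _).trans ?_
  split_ifs with h
  · subst h
    rw [MvPolynomial.degreeOf_X_self_pow]
    exact Nat.lt_succ_iff.1 (Finset.mem_range.1 hn)
  · rw [MvPolynomial.degreeOf_X_pow_of_ne _ h]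

theorem mem_Qp_iff {p : ℕ} {q : MvPolynomial (Fin 2) ℝ} :
    q ∈ Qp p ↔ ∀ k, q.degreeOf k ≤ p := by
  classical
  rw [MvPolynomial.mem_restrictDegree_iff_sup]
  simp only [MvPolynomial.degreeOf_def]

theorem inCoord_mul_inCoord_mem {p : ℕ} {f g : Polynomial ℝ} (hf : f.natDegree ≤ p)
    (hg : g.natDegree ≤ p) (i : Fin 2) : inCoord i f * inCoord (oth i) g ∈ Qp p := by
  rw [mem_Qp_iff, forall_coord i]
  constructor
  · refine (MvPolynomial.degreeOf_mul_le _ _ _).trans ?_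
    have h1 := degreeOf_inCoord_le i i f
    have h2 := degreeOf_inCoord_le (oth i) i g
    simp only [if_true, ne_oth, if_false] at h1 h2
    omega
  · refine (MvPolynomial.degreeOf_mul_le _ _ _).trans ?_
    have h1 := degreeOf_inCoord_le i (oth i) f
    have h2 := degreeOf_inCoord_le (oth i) (oth i) g
    simp only [if_true, oth_ne, if_false] at h1 h2
    omega

/-! ### The combinatorics of a mesh -/

namespace Rect

theorem MidSide.covers {K : Rect} {z : Plane} {i : Fin 2} {b : Bool} (h : K.MidSide z i b)
    {e : Fin 2 → Bool} (he : e i = !b) : K.Covers z e := by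
  have hlt := K.lo_lt_hi i
  rw [Covers, forall_coord i]
  refine ⟨?_, fun _ => ⟨h.lo_lt.le, h.lt_hi⟩, fun _ => ⟨h.lo_lt, h.lt_hi.le⟩⟩
  rw [he, h.eq]
  cases b <;> simp [hlt]

theorem MidSide.not_vertex {K : Rect} {z : Plane} {i : Fin 2} {b : Bool} (h : K.MidSide z i b) :
    z ∉ K.vertices := by
  intro hv
  rcases hv (oth i) with hz | hz
  · exact h.lo_lt.ne hz.symm
  · exact h.lt_hi.ne hz

theorem MidSide.unique {K : Rect} {z : Plane} {i i' : Fin 2} {b b' : Bool} (h : K.MidSide z i b)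
    (h' : K.MidSide z i' b') : i = i' ∧ b = b' := by
  have hlt := K.lo_lt_hi i
  rcases eq_or_eq_oth i i' with rfl | rfl
  · refine ⟨rfl, ?_⟩
    have := h.eq.symm.trans h'.eq
    cases b <;> cases b' <;> simp at this ⊢ <;> linarith
  · exfalso
    have h1 := h.eq
    have h2 := h'.lo_lt
    have h3 := h'.lt_hi
    rw [oth_oth] at h2 h3
    cases b <;> simp at h1 <;> linarith

theorem Covers.eq_of_vertex {K : Rect} {z : Plane} (hz : z ∈ K.vertices) {e e' : Fin 2 → Bool}
    (h : K.Covers z e) (h' : K.Covers z e') : e = e' := by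
  ext i
  have h1 := h i
  have h2 := h' i
  rcases hz i with hi | hi <;> rw [hi] at h1 h2 <;>
    cases he : e i <;> cases he' : e' i <;> simp [he, he'] at h1 h2 ⊢

/-- `K` and `K'` lie on different sides of the line through the side `(i, b)` of `K`, and
their sides on this line overlap. -/
structure Adj (K K' : Rect) (i : Fin 2) (b : Bool) : Prop where
  eq : K.bd i b = K'.bd i (!b)
  lt₁ : K.lo (oth i) < K'.hi (oth i)
  lt₂ : K'.lo (oth i) < K.hi (oth i)

theorem Adj.symm {K K' : Rect} {i : Fin 2} {b : Bool} (h : K.Adj K' i b) : K'.Adj K i (!b) :=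
  ⟨by rw [Bool.not_not]; exact h.eq.symm, h.lt₂, h.lt₁⟩

theorem Adj.ne {K K' : Rect} {i : Fin 2} {b : Bool} (h : K.Adj K' i b) : K ≠ K' := by
  rintro rfl
  have := h.eq
  have := K.lo_lt_hi i
  cases b <;> simp at * <;> linarith

end Rect

namespace IsMesh

variable {Ω : Set Plane} {M : Finset Rect}

/-- Otherwise the centre of the intersection rectangle would lie in both open elements. -/
theorem exists_separated (hM : IsMesh Ω M) {K K' : Rect} (hK : K ∈ M) (hK' : K' ∈ M)
    (hne : K ≠ K') : ∃ i, K.hi i ≤ K'.lo i ∨ K'.hi i ≤ K.lo i := by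
  by_contra hcon
  push Not at hcon
  have hd := hM.disjoint K hK K' hK' hne
  set y : Plane := WithLp.toLp 2 fun i => (max (K.lo i) (K'.lo i) + min (K.hi i) (K'.hi i)) / 2
  have hy : ∀ i, max (K.lo i) (K'.lo i) < y i ∧ y i < min (K.hi i) (K'.hi i) := by
    intro i
    have h1 := K.lo_lt_hi i
    have h2 := K'.lo_lt_hi i
    have h3 : max (K.lo i) (K'.lo i) < min (K.hi i) (K'.hi i) :=
      max_lt (lt_min h1 (hcon i).2) (lt_min (hcon i).1 h2)
    have : y i = (max (K.lo i) (K'.lo i) + min (K.hi i) (K'.hi i)) / 2 := rfl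
    constructor <;> linarith
  exact disjoint_left.1 hd (show y ∈ K.carrier from
    fun i => ⟨(le_max_left _ _).trans_lt (hy i).1, (hy i).2.trans_le (min_le_left _ _)⟩)
    (show y ∈ K'.carrier from fun i => ⟨(le_max_right _ _).trans_lt (hy i).1, (hy i).2.trans_le (min_le_right _ _)⟩)

theorem interface_eq (hM : IsMesh Ω M) {K K' : Rect} (hK : K ∈ M) (hK' : K' ∈ M)
    (hne : K ≠ K') : K.interface K' = closure K.carrier ∩ closure K'.carrier := by
  ext x
  simp only [Rect.interface, mem_inter_iff, Rect.mem_frontier]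
  constructor
  · rintro ⟨⟨h1, -⟩, h2, -⟩; exact ⟨h1, h2⟩
  · rintro ⟨h1, h2⟩
    exact ⟨⟨h1, fun h => hne (hM.eq_of_mem_carrier_of_mem_closure hK hK' h h2)⟩, h2,
      fun h => hne (hM.eq_of_mem_carrier_of_mem_closure hK' hK h h1).symm⟩

theorem interface_eq_of_adj (hM : IsMesh Ω M) {K K' : Rect} (hK : K ∈ M) (hK' : K' ∈ M)
    {i : Fin 2} {b : Bool} (h : K.Adj K' i b) :
    K.interface K' = {x | x i = K.bd i b ∧ max (K.lo (oth i)) (K'.lo (oth i)) ≤ x (oth i) ∧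
      x (oth i) ≤ min (K.hi (oth i)) (K'.hi (oth i))} := by
  rw [hM.interface_eq hK hK' h.ne]
  ext x
  have h1 := h.eq
  have h2 := K.lo_lt_hi i
  have h3 := K'.lo_lt_hi i
  simp only [mem_inter_iff, Rect.mem_closure, forall_coord i, mem_ofPred_eq, max_le_iff,
    le_min_iff]
  constructor
  · rintro ⟨⟨⟨a1, a2⟩, a3, a4⟩, ⟨a5, a6⟩, a7, a8⟩
    refine ⟨?_, ⟨a3, a7⟩, a4, a8⟩
    cases b <;> simp at h1 ⊢ <;> linarith
  · rintro ⟨a1, ⟨a3, a7⟩, a4, a8⟩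
    refine ⟨⟨?_, a3, a4⟩, ?_, a7, a8⟩
    · rw [a1]; exact ⟨K.lo_le_bd i b, K.bd_le_hi i b⟩
    · rw [a1, h1]; exact ⟨K'.lo_le_bd i _, K'.bd_le_hi i _⟩

theorem isInteriorSide_of_adj (hM : IsMesh Ω M) {K K' : Rect} (hK : K ∈ M) (hK' : K' ∈ M)
    {i : Fin 2} {b : Bool} (h : K.Adj K' i b) : IsInteriorSide K K' := by
  have h2 := K.lo_lt_hi (oth i)
  have h3 := K'.lo_lt_hi (oth i)
  have hlt : max (K.lo (oth i)) (K'.lo (oth i)) < min (K.hi (oth i)) (K'.hi (oth i)) :=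
    max_lt (lt_min h2 h.lt₁) (lt_min h.lt₂ h3)
  refine ⟨h.ne, pt i (K.bd i b) (max (K.lo (oth i)) (K'.lo (oth i))), ?_,
    pt i (K.bd i b) (min (K.hi (oth i)) (K'.hi (oth i))), ?_, ?_⟩
  · rw [hM.interface_eq_of_adj hK hK' h]
    exact ⟨by simp, by rw [pt_oth], by rw [pt_oth]; exact hlt.le⟩
  · rw [hM.interface_eq_of_adj hK hK' h]
    exact ⟨by simp, by rw [pt_oth]; exact hlt.le, by rw [pt_oth]⟩
  · intro heq
    have := congrArg (fun x : Plane => x (oth i)) heq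
    simp only [pt_oth] at this
    exact hlt.ne this

/-- A whole side on which coordinate `i` is constant cannot be one with normal direction `oth i`.
This turns the set equality in the mesh condition into inequalities between end coordinates. -/
theorem _root_.Rect.exists_ends_of_mem_sides {K : Rect} {s : Set Plane} (hs : s ∈ K.sides)
    {i : Fin 2} {c : ℝ} (hc : ∀ x ∈ s, x i = c) :
    ∃ x ∈ s, ∃ y ∈ s, x (oth i) = K.lo (oth i) ∧ y (oth i) = K.hi (oth i) := by
  have hlt := fun k => (K.lo_lt_hi k)
  obtain ⟨k, b, rfl⟩ : ∃ k b, s = {x ∈ closure K.carrier | x k = K.bd k b} := by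
    obtain ⟨k, h | h⟩ := hs
    · exact ⟨k, false, h⟩
    · exact ⟨k, true, h⟩
  have hm : ∀ b b', pt i (K.bd i b) (K.bd (oth i) b') ∈ closure K.carrier := fun b b' =>
    K.vertices_subset_closure (K.pt_mem_vertices i b b')
  rcases eq_or_eq_oth i k with rfl | rfl
  · exact ⟨_, ⟨hm b false, by simp⟩, _, ⟨hm b true, by simp⟩, by simp, by simp⟩
  · exfalso
    have h1 := hc _ ⟨hm false b, by simp⟩
    have h2 := hc _ ⟨hm true b, by simp⟩
    simp at h1 h2
    linarith [hlt i]

/-- The whole-side condition in coordinates. -/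
theorem whole_side_of_adj (hM : IsMesh Ω M) {K K' : Rect} (hK : K ∈ M) (hK' : K' ∈ M)
    {i : Fin 2} {b : Bool} (h : K.Adj K' i b) :
    (K'.lo (oth i) ≤ K.lo (oth i) ∧ K.hi (oth i) ≤ K'.hi (oth i)) ∨
      (K.lo (oth i) ≤ K'.lo (oth i) ∧ K'.hi (oth i) ≤ K.hi (oth i)) := by
  have hi := hM.interface_eq_of_adj hK hK' h
  have hc : ∀ x ∈ K.interface K', x i = K.bd i b := fun x hx => by rw [hi] at hx; exact hx.1
  rcases hM.whole_side K hK K' hK' (hM.isInteriorSide_of_adj hK hK' h) with hs | hs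
  · obtain ⟨x, hx, y, hy, hxe, hye⟩ := Rect.exists_ends_of_mem_sides hs hc
    rw [hi] at hx hy
    have h1 := hx.2.1
    have h2 := hy.2.2
    rw [hxe] at h1; rw [hye] at h2
    exact Or.inl ⟨(le_max_right _ _).trans h1, h2.trans (min_le_right _ _)⟩
  · obtain ⟨x, hx, y, hy, hxe, hye⟩ := Rect.exists_ends_of_mem_sides hs hc
    rw [hi] at hx hy
    have h1 := hx.2.1
    have h2 := hy.2.2
    rw [hxe] at h1; rw [hye] at h2
    exact Or.inr ⟨(le_max_left _ _).trans h1, h2.trans (min_le_left _ _)⟩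

/-- Elements filling quadrants which differ in one coordinate are equal or adjacent. -/
theorem adj_of_covers (hM : IsMesh Ω M) {K K' : Rect} (hK : K ∈ M) (hK' : K' ∈ M) (hne : K ≠ K')
    {z : Plane} {e e' : Fin 2 → Bool} (h : K.Covers z e) (h' : K'.Covers z e') {i : Fin 2}
    (hi : e' i = !e i) (hj : e' (oth i) = e (oth i)) :
    K.Adj K' i (!e i) ∧ z i = K.bd i (!e i) := by
  obtain ⟨h1, h2⟩ := h i
  obtain ⟨h3, h4⟩ := h' i
  obtain ⟨h5, h6⟩ := h (oth i)
  obtain ⟨h7, h8⟩ := h' (oth i)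
  have hov : K.lo (oth i) < K'.hi (oth i) ∧ K'.lo (oth i) < K.hi (oth i) := by
    cases hb : e (oth i)
    · have a := h6 hb; have b := h8 (hj.trans hb)
      constructor <;> linarith [a.1, a.2, b.1, b.2]
    · have a := h5 hb; have b := h7 (hj.trans hb)
      constructor <;> linarith [a.1, a.2, b.1, b.2]
  have hsep : K.hi i ≤ K'.lo i ∨ K'.hi i ≤ K.lo i := by
    obtain ⟨k, hk⟩ := hM.exists_separated hK hK' hne
    rcases eq_or_eq_oth i k with rfl | rfl
    · exact hk
    · rcases hk with hk | hk <;> linarith [hov.1, hov.2]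
  cases hb : e i
  · rw [hb] at hi
    have a := h2 hb; have b := h3 hi
    have : K.hi i = z i ∧ K'.lo i = z i := by
      rcases hsep with h | h <;> constructor <;> linarith [a.1, a.2, b.1, b.2]
    exact ⟨⟨by simp [this], hov.1, hov.2⟩, by simp [this]⟩
  · rw [hb] at hi
    have a := h1 hb; have b := h4 hi
    have : K.lo i = z i ∧ K'.hi i = z i := by
      rcases hsep with h | h <;> constructor <;> linarith [a.1, a.2, b.1, b.2]
    exact ⟨⟨by simp [this], hov.1, hov.2⟩, by simp [this]⟩

/-- Two different elements with a common point in the interior of their sides. -/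
theorem adj_of_midSide (hM : IsMesh Ω M) {K K' : Rect} (hK : K ∈ M) (hK' : K' ∈ M) (hne : K ≠ K')
    {z : Plane} {i i' : Fin 2} {b b' : Bool} (h : K.MidSide z i b) (h' : K'.MidSide z i' b') :
    i' = i ∧ b' = !b ∧ K.Adj K' i b := by
  rcases eq_or_eq_oth i i' with rfl | rfl
  · have hb : b' = !b := by
      by_contra hb
      have hb' : b' = b := by cases b <;> cases b' <;> simp at hb ⊢
      exact hne (hM.covers_unique hK hK' (h.covers (e := fun _ => !b) rfl)
        (h'.covers (e := fun _ => !b) (by rw [hb'])))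
    subst hb
    exact ⟨rfl, rfl, h.eq.symm.trans h'.eq, h.lo_lt.trans h'.lt_hi, h'.lo_lt.trans h.lt_hi⟩
  · exfalso
    refine hne (hM.covers_unique hK hK' (h.covers (e := fun k => if k = i then !b else !b') ?_)
      (h'.covers (e := fun k => if k = i then !b else !b') ?_)) <;> simp

/-- A vertex lies in the interior of at most one side. -/
theorem midSide_unique (hM : IsMesh Ω M) {K₀ K K' : Rect} (hK₀ : K₀ ∈ M) (hK : K ∈ M)
    (hK' : K' ∈ M) {z : Plane} (hz : z ∈ K₀.vertices) {i i' : Fin 2} {b b' : Bool}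
    (h : K.MidSide z i b) (h' : K'.MidSide z i' b') : K = K' ∧ i = i' ∧ b = b' := by
  by_cases hne : K = K'
  · subst hne; exact ⟨rfl, h.unique h'⟩
  exfalso
  obtain ⟨rfl, rfl, -⟩ := hM.adj_of_midSide hK hK' hne h h'
  -- `K` and `K'` lie on opposite sides of one line and together fill all quadrants at `z`, so no
  -- quadrant is left for `K₀`.
  obtain ⟨e, he⟩ := Rect.exists_covers (K₀.vertices_subset_closure hz)
  have h1 : K₀ ≠ K := by rintro rfl; exact h.not_vertex hz
  have h2 : K₀ ≠ K' := by rintro rfl; exact h'.not_vertex hz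
  by_cases hb : e i' = !b
  · exact h1 (hM.covers_unique hK₀ hK he (h.covers hb))
  · refine h2 (hM.covers_unique hK₀ hK' he (h'.covers ?_))
    cases b <;> simpa using hb

end IsMesh

/-! ### Nodes, hanging nodes and the discrete maximum principle -/

/-- `z` is a vertex of some element. -/
def IsNode (M : Finset Rect) (z : Plane) : Prop := ∃ K ∈ M, z ∈ K.vertices

/-- `z` lies in the interior of a side of some element. -/
def IsMidSide (M : Finset Rect) (z : Plane) : Prop := ∃ K ∈ M, ∃ i b, K.MidSide z i b

theorem Rect.finite_vertices (K : Rect) : K.vertices.Finite := by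
  have : K.vertices ⊆ range (fun b : Bool × Bool => pt 0 (K.bd 0 b.1) (K.bd 1 b.2)) := by
    intro x hx
    rw [Rect.mem_vertices] at hx
    obtain ⟨b0, h0⟩ := hx 0
    obtain ⟨b1, h1⟩ := hx 1
    refine ⟨(b0, b1), ?_⟩
    have := pt_eta 0 x
    rw [show oth 0 = 1 from rfl] at this
    simp only [← h0, ← h1, this]
  exact (finite_range _).subset this

theorem finite_setOf_isNode (M : Finset Rect) : {z | IsNode M z}.Finite := by
  have : {z | IsNode M z} = ⋃ K ∈ M, K.vertices := by ext z; simp [IsNode]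
  rw [this]
  exact M.finite_toSet.biUnion fun K _ => K.finite_vertices

namespace IsMesh

variable {Ω : Set Plane} {M : Finset Rect}

theorem not_mem_carrier_of_isNode (hM : IsMesh Ω M) {z : Plane} (hz : IsNode M z) {K : Rect}
    (hK : K ∈ M) : z ∉ K.carrier := by
  intro h
  obtain ⟨K', hK', hv⟩ := hz
  have := hM.eq_of_mem_carrier_of_mem_closure hK hK' h (K'.vertices_subset_closure hv)
  subst this
  exact K.vertices_disjoint_carrier hv h

/-- At an interior node all four quadrants are filled. If the node is in no side interior, it is a
vertex of each filling element; a rectangle fills only one quadrant at its vertex, so there are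
exactly four elements and the node is conforming. -/
theorem isMidSide_of_not_conforming (hM : IsMesh Ω M) (hΩ : IsOpen Ω) {z : Plane}
    (hz : IsNode M z) (hc : ¬ IsConformingNode Ω M z) : IsMidSide M z := by
  by_contra hmid
  apply hc
  refine ⟨hz, ?_⟩
  by_cases hfr : z ∈ frontier Ω
  · exact Or.inl hfr
  right
  obtain ⟨K₀, hK₀, hv₀⟩ := id hz
  have hcl : z ∈ closure Ω := hM.closure_subset hK₀ (K₀.vertices_subset_closure hv₀)
  have hzΩ : z ∈ Ω := by
    by_contra h; exact hfr (by rw [hΩ.frontier_eq]; exact ⟨hcl, h⟩)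
  have hf := fun e => hM.filled_of_mem hΩ hzΩ e
  choose Q hQ hQc using hf
  have hQv : ∀ e, z ∈ (Q e).vertices := fun e => by
    rcases Rect.trichotomy (hQc e).mem_closure with h | ⟨i, b, h⟩ | h
    · exact (hM.not_mem_carrier_of_isNode hz (hQ e) h).elim
    · exact (hmid ⟨Q e, hQ e, i, b, h⟩).elim
    · exact h
  have hinj : Function.Injective Q := fun e e' h =>
    (hQc e).eq_of_vertex (hQv e) (h ▸ hQc e')
  have : {K | K ∈ M ∧ z ∈ K.vertices} = range Q := by
    ext K
    constructor
    · rintro ⟨hK, hKv⟩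
      obtain ⟨e, he⟩ := Rect.exists_covers (K.vertices_subset_closure hKv)
      exact ⟨e, hM.covers_unique (hQ e) hK (hQc e) he⟩
    · rintro ⟨e, rfl⟩; exact ⟨hQ e, hQv e⟩
  rw [this, ← Nat.card_coe_set_eq, Nat.card_range_of_injective hinj]
  simp

end IsMesh

/-- The discrete maximum principle: `u` attains its maximum outside the interiors of sides if at
each node in the interior of a side it is at most a convex combination of its values at the
two ends of the side. -/
theorem exists_max_not_isMidSide {M : Finset Rect} {S : Set Plane} (hS : S.Finite)
    (hne : S.Nonempty) (u : Plane → ℝ)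
    (h : ∀ z ∈ S, IsMidSide M z → ∃ a ∈ S, ∃ b ∈ S, z 0 + z 1 < b 0 + b 1 ∧
      ∃ s t : ℝ, 0 ≤ s ∧ 0 < t ∧ s + t = 1 ∧ u z ≤ s * u a + t * u b) :
    ∃ z ∈ S, ¬ IsMidSide M z ∧ ∀ y ∈ S, u y ≤ u z := by
  -- Ties in `u` are broken by the coordinate sum. If the maximizer were hanging, the positive
  -- weight of `b` would force `u b = u z`, and `b` has a larger coordinate sum.
  obtain ⟨z, hz, hmax⟩ := hS.exists_maximalFor (fun z => toLex (u z, z 0 + z 1)) S hne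
  have hmax' : ∀ y ∈ S, toLex (u y, y 0 + y 1) ≤ toLex (u z, z 0 + z 1) := fun y hy => by
    rcases le_total (toLex (u y, y 0 + y 1)) (toLex (u z, z 0 + z 1)) with h | h
    · exact h
    · exact hmax hy h
  have hu : ∀ y ∈ S, u y ≤ u z := fun y hy => by
    rcases Prod.Lex.toLex_le_toLex.1 (hmax' y hy) with h | h
    · exact h.le
    · exact h.1.le
  refine ⟨z, hz, fun hm => ?_, hu⟩
  obtain ⟨a, ha, b, hb, hlt, s, t, hs, ht, hst, hle⟩ := h z hz hm
  have h1 := hu a ha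
  have h2 := hu b hb
  have h3 : s * u a ≤ s * u z := mul_le_mul_of_nonneg_left h1 hs
  have h4 : u z ≤ u b := by
    have : t * u z ≤ t * u b := by
      have : u z = s * u z + t * u z := by rw [← add_mul, hst, one_mul]
      linarith
    exact le_of_mul_le_mul_left this ht
  rcases Prod.Lex.toLex_le_toLex.1 (hmax' b hb) with h | h
  · exact absurd h (not_lt.2 h4)
  · simp only at h; linarith [h.2]

/-! ### Diameters, side lengths and barycentric weights -/

namespace Rect

/-- The side length. -/
def width (K : Rect) (i : Fin 2) : ℝ := K.hi i - K.lo i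

theorem width_pos (K : Rect) (i : Fin 2) : 0 < K.width i := sub_pos.2 (K.lo_lt_hi i)

theorem dist_le_width_add {K : Rect} {x y : Plane} (hx : x ∈ closure K.carrier)
    (hy : y ∈ closure K.carrier) (i : Fin 2) : dist x y ≤ K.width i + K.width (oth i) := by
  rw [mem_closure] at hx hy
  refine (dist_le_coord x y i).trans (add_le_add ?_ ?_) <;>
    · rw [abs_le, width]
      constructor <;> linarith [(hx i).1, (hx i).2, (hy i).1, (hy i).2, (hx (oth i)).1,
        (hx (oth i)).2, (hy (oth i)).1, (hy (oth i)).2]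

theorem isBounded_carrier (K : Rect) : Bornology.IsBounded K.carrier :=
  Metric.isBounded_iff.2 ⟨K.width 0 + K.width (oth 0), fun _ hx _ hy =>
    dist_le_width_add (subset_closure hx) (subset_closure hy) 0⟩

theorem dist_le_h {K : Rect} {x y : Plane} (hx : x ∈ closure K.carrier)
    (hy : y ∈ closure K.carrier) : dist x y ≤ K.h := by
  rw [h, ← Metric.diam_closure]
  exact Metric.dist_le_diam_of_mem K.isBounded_carrier.closure hx hy

theorem h_le_width_add (K : Rect) (i : Fin 2) : K.h ≤ K.width i + K.width (oth i) :=
  Metric.diam_le_of_forall_dist_le (add_nonneg (K.width_pos i).le (K.width_pos _).le)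
    fun _ hx _ hy => dist_le_width_add (subset_closure hx) (subset_closure hy) i

theorem width_le_h (K : Rect) (i : Fin 2) : K.width i ≤ K.h := by
  have h1 := dist_le_h (K.vertices_subset_closure (K.pt_mem_vertices i true false))
    (K.vertices_subset_closure (K.pt_mem_vertices i false false))
  have h2 := abs_coord_sub_le_dist (pt i (K.bd i true) (K.bd (oth i) false))
    (pt i (K.bd i false) (K.bd (oth i) false)) i
  simp only [pt_self, bd_true, bd_false] at h2
  rw [abs_of_pos (sub_pos.2 (K.lo_lt_hi i))] at h2
  exact h2.trans h1

theorem h_pos (K : Rect) : 0 < K.h := (K.width_pos 0).trans_le (K.width_le_h 0)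

/-- The vertex of `K` at the end `b'` of the side `(i, b)`. -/
def endPt (K : Rect) (i : Fin 2) (b b' : Bool) : Plane := pt i (K.bd i b) (K.bd (oth i) b')

theorem endPt_mem_vertices (K : Rect) (i : Fin 2) (b b' : Bool) : K.endPt i b b' ∈ K.vertices :=
  K.pt_mem_vertices i b b'

/-- The barycentric weight of the end `b` of the interval `(lo j, hi j)` at `t`. -/
def weight (K : Rect) (j : Fin 2) (b : Bool) (t : ℝ) : ℝ :=
  if b then (t - K.lo j) / K.width j else (K.hi j - t) / K.width j

theorem weight_add (K : Rect) (j : Fin 2) (t : ℝ) : K.weight j false t + K.weight j true t = 1 := by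
  have := (K.width_pos j).ne'
  simp only [weight, Bool.false_eq_true, if_false, if_true]
  rw [← add_div, div_eq_one_iff_eq this, width]; ring

theorem MidSide.weight_pos {K : Rect} {z : Plane} {i : Fin 2} {b : Bool} (h : K.MidSide z i b)
    (b' : Bool) : 0 < K.weight (oth i) b' (z (oth i)) := by
  have h1 := h.lo_lt
  have h2 := h.lt_hi
  have h3 := K.width_pos (oth i)
  cases b' <;> simp only [weight, Bool.false_eq_true, if_false, if_true] <;>
    exact div_pos (by linarith) h3

end Rect

theorem IsShapeRegular.h_le {κ : ℝ} {M : Finset Rect} (h : IsShapeRegular κ M) {K : Rect}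
    (hK : K ∈ M) (i : Fin 2) : K.h ≤ (1 + κ) * K.width i := by
  have h1 := K.h_le_width_add i
  have h2 := h K hK (oth i) i
  rw [add_mul, one_mul]
  simp only [Rect.width] at *
  linarith

theorem Polynomial.eval_eq_of_natDegree_le_one {f : Polynomial ℝ} (hf : f.natDegree ≤ 1)
    (K : Rect) (j : Fin 2) (t : ℝ) :
    f.eval t = K.weight j false t * f.eval (K.bd j false) + K.weight j true t * f.eval (K.bd j true) := by
  obtain ⟨a, b, rfl⟩ := Polynomial.exists_eq_X_add_C_of_natDegree_le_one hf
  have := (K.width_pos j).ne'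
  simp only [Rect.weight, Bool.false_eq_true, if_false, if_true, Polynomial.eval_add,
    Polynomial.eval_mul, Polynomial.eval_C, Polynomial.eval_X, Rect.bd_true, Rect.bd_false]
  field_simp
  simp only [Rect.width]
  ring

/-! ### Consequences of the `K`-mesh condition -/

section KMesh

variable {Ω : Set Plane} {M : Finset Rect}

theorem IsNodalFunction.exists_eq_polyEval {P : Plane} {ψ : Plane → ℝ}
    (hψ : IsNodalFunction Ω M P ψ) (hM : IsMesh Ω M) {K : Rect} (hK : K ∈ M) :
    ∃ q ∈ Qp 1, ∀ x ∈ closure K.carrier, ψ x = polyEval q x := by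
  obtain ⟨q, hq, h⟩ := hψ.bilinear K hK
  exact ⟨q, hq, Set.EqOn.of_subset_closure (f := ψ) (g := polyEval q) (s := K.carrier)
    (fun x hx => h x hx) (hψ.continuousOn.mono (hM.closure_subset hK))
    (continuous_polyEval q).continuousOn subset_closure subset_rfl⟩

theorem IsNodalFunction.eq_of_midSide {P : Plane} {ψ : Plane → ℝ}
    (hψ : IsNodalFunction Ω M P ψ) (hM : IsMesh Ω M) {K : Rect} (hK : K ∈ M) {z : Plane}
    {i : Fin 2} {b : Bool} (hz : K.MidSide z i b) :
    ψ z = K.weight (oth i) false (z (oth i)) * ψ (K.endPt i b false) +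
      K.weight (oth i) true (z (oth i)) * ψ (K.endPt i b true) := by
  obtain ⟨q, hq, h⟩ := hψ.exists_eq_polyEval hM hK
  have he := fun b' => K.vertices_subset_closure (K.endPt_mem_vertices i b b')
  rw [h z hz.mem_closure, h _ (he false), h _ (he true)]
  simp only [Rect.endPt]
  rw [← eval_lineTrace, ← eval_lineTrace, ← pt_eta i z, ← eval_lineTrace, hz.eq]
  simp only [pt_oth]
  exact Polynomial.eval_eq_of_natDegree_le_one (natDegree_lineTrace_le hq i _) K (oth i) _

theorem Rect.endPt_sum_lt {K : Rect} {z : Plane} {i : Fin 2} {b : Bool} (h : K.MidSide z i b) :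
    z 0 + z 1 < K.endPt i b true 0 + K.endPt i b true 1 := by
  have h1 := h.lt_hi
  have h2 := h.eq
  have e : ∀ x : Plane, x 0 + x 1 = x i + x (oth i) := by
    intro x; fin_cases i
    · rfl
    · exact add_comm _ _
  rw [e, e, endPt, pt_self, pt_oth, h2, bd_true]
  linarith

/-- Conforming nodes do not lie in the interior of a side. -/
theorem IsConformingNode.not_isMidSide {C₀ : ℝ} (hKM : IsKMesh C₀ Ω M) (hM : IsMesh Ω M)
    (hΩ : IsOpen Ω) {P : Plane} (hP : IsConformingNode Ω M P) : ¬ IsMidSide M P := by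
  obtain ⟨ψ, hψ, -⟩ := hKM P hP
  -- A nodal function is affine on sides, so the maximum principle holds with equality. The maximum
  -- is at least `1` and is attained at a conforming node outside all side interiors; the only
  -- conforming node with a nonzero value is `P`.
  obtain ⟨z, hz, hnot, hmax⟩ := exists_max_not_isMidSide (finite_setOf_isNode M)
    ⟨P, hP.1⟩ ψ (M := M) (by
      rintro z - ⟨K, hK, i, b, hm⟩
      exact ⟨_, ⟨K, hK, K.endPt_mem_vertices i b false⟩, _,
        ⟨K, hK, K.endPt_mem_vertices i b true⟩, Rect.endPt_sum_lt hm, _, _,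
        (hm.weight_pos false).le, hm.weight_pos true, K.weight_add _ _,
        (hψ.eq_of_midSide hM hK hm).le⟩)
  have hzc : IsConformingNode Ω M z := by
    by_contra h; exact hnot (hM.isMidSide_of_not_conforming hΩ hz h)
  have h1 := hmax P hP.1
  rw [hψ.eq_one] at h1
  by_cases hzP : z = P
  · rwa [← hzP]
  · rw [hψ.eq_zero z hzc hzP] at h1; linarith

/-- The maximum principle for `-ψ`: its maximum over the nodes is attained at a conforming node,
where `ψ` is `0` or `1`. -/
theorem IsNodalFunction.nonneg {P : Plane} {ψ : Plane → ℝ}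
    (hψ : IsNodalFunction Ω M P ψ) (hM : IsMesh Ω M) (hΩ : IsOpen Ω) {x : Plane}
    (hx : IsNode M x) : 0 ≤ ψ x := by
  obtain ⟨z, hz, hnot, hmax⟩ := exists_max_not_isMidSide (finite_setOf_isNode M)
    ⟨x, hx⟩ (fun y => - ψ y) (M := M) (by
      rintro z - ⟨K, hK, i, b, hm⟩
      refine ⟨_, ⟨K, hK, K.endPt_mem_vertices i b false⟩, _,
        ⟨K, hK, K.endPt_mem_vertices i b true⟩, Rect.endPt_sum_lt hm, _, _,
        (hm.weight_pos false).le, hm.weight_pos true, K.weight_add _ _, ?_⟩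
      rw [hψ.eq_of_midSide hM hK hm]; linarith)
  have hzc : IsConformingNode Ω M z := by
    by_contra h; exact hnot (hM.isMidSide_of_not_conforming hΩ hz h)
  have h1 := hmax x hx
  by_cases hzP : z = P
  · rw [hzP, hψ.eq_one] at h1; linarith
  · rw [hψ.eq_zero z hzc hzP] at h1; linarith

/-- `a` is an end of a side with `z` in its interior. -/
def MeshStep (M : Finset Rect) (z a : Plane) : Prop :=
  ∃ K ∈ M, ∃ i b b', K.MidSide z i b ∧ a = K.endPt i b b'

/-- `a` is obtained from `z` by repeatedly passing to an end of a side. -/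
abbrev MeshReach (M : Finset Rect) : Plane → Plane → Prop := Relation.ReflTransGen (MeshStep M)

theorem MeshStep.isNode {z a : Plane} (h : MeshStep M z a) : IsNode M a := by
  obtain ⟨K, hK, i, b, b', -, rfl⟩ := h
  exact ⟨K, hK, K.endPt_mem_vertices i b b'⟩

theorem MeshReach.isNode {z a : Plane} (h : MeshReach M z a) (hz : IsNode M z) : IsNode M a := by
  induction h with
  | refl => exact hz
  | tail _ h _ => exact h.isNode

theorem finite_setOf_meshReach {z : Plane} (hz : IsNode M z) : {a | MeshReach M z a}.Finite :=
  (finite_setOf_isNode M).subset fun _ h => MeshReach.isNode h hz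

/-- The maximum principle for the constant function: only its tie-breaking by the coordinate sum is
at work, which shows that repeated passage to suitable ends terminates. -/
theorem exists_meshReach_not_isMidSide {z : Plane} (hz : IsNode M z) :
    ∃ a, MeshReach M z a ∧ ¬ IsMidSide M a := by
  obtain ⟨a, ha, hnot, -⟩ := exists_max_not_isMidSide (M := M) (finite_setOf_meshReach hz)
    ⟨z, .refl⟩ (fun _ => 0) (by
      rintro y hy ⟨K, hK, i, b, hm⟩
      exact ⟨_, hy.tail ⟨K, hK, i, b, false, hm, rfl⟩, _, hy.tail ⟨K, hK, i, b, true, hm, rfl⟩,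
        Rect.endPt_sum_lt hm, _, _, (hm.weight_pos false).le, hm.weight_pos true,
        K.weight_add _ _, by simp⟩)
  exact ⟨a, ha, hnot⟩

/-- The value at a hanging node is a combination, with positive weights, of nonnegative values at
the ends, so positivity at one end is inherited. -/
theorem IsNodalFunction.pos_of_meshReach {P : Plane} {ψ : Plane → ℝ}
    (hψ : IsNodalFunction Ω M P ψ) (hM : IsMesh Ω M) (hΩ : IsOpen Ω) {z a : Plane}
    (h : MeshReach M z a) (ha : 0 < ψ a) : 0 < ψ z := by
  induction h using Relation.ReflTransGen.head_induction_on with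
  | refl => exact ha
  | head h _ ih =>
    obtain ⟨K, hK, i, b, b', hm, rfl⟩ := h
    rw [hψ.eq_of_midSide hM hK hm]
    have hn := fun b' => hψ.nonneg hM hΩ ⟨K, hK, K.endPt_mem_vertices i b b'⟩
    have hw := fun b' => hm.weight_pos b'
    cases b'
    · exact add_pos_of_pos_of_nonneg (mul_pos (hw _) ih) (mul_nonneg (hw _).le (hn _))
    · exact add_pos_of_nonneg_of_pos (mul_nonneg (hw _).le (hn _)) (mul_pos (hw _) ih)

/-- A polynomial which vanishes on an open subset of an element vanishes on the line from there to
`z`. A nonzero value at one point of the closed element therefore puts the whole element into the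
support. -/
theorem IsNodalFunction.carrier_subset_nodalSupport {P : Plane} {ψ : Plane → ℝ}
    (hψ : IsNodalFunction Ω M P ψ) (hM : IsMesh Ω M) {z : Plane} (hz : ψ z ≠ 0)
    {K : Rect} (hK : K ∈ M) (hzK : z ∈ closure K.carrier) : K.carrier ⊆ nodalSupport Ω ψ := by
  obtain ⟨q, -, h⟩ := hψ.exists_eq_polyEval hM hK
  intro y hy
  rw [nodalSupport, mem_closure_iff]
  intro U hU hyU
  by_contra hcon
  have hz0 : ∀ x ∈ U ∩ K.carrier, polyEval q x = 0 := by
    intro x hx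
    by_contra h0
    exact hcon ⟨x, hx.1, hM.subset K hK hx.2, by rwa [h x (subset_closure hx.2)]⟩
  -- restrict to the line through `y` and `z`
  set f : Polynomial ℝ := MvPolynomial.aeval
    (fun k => Polynomial.C (y k) + Polynomial.X * Polynomial.C (z k - y k)) q with hf
  have hfe : ∀ t : ℝ, f.eval t = polyEval q (y + t • (z - y)) := by
    intro t
    rw [hf]
    clear hf hz0 h
    induction q using MvPolynomial.induction_on with
    | C a => simp [polyEval]
    | add q r hq hr => simp only [polyEval, map_add, Polynomial.eval_add] at *; rw [hq, hr]
    | mul_X q k hq =>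
      simp only [polyEval, map_mul, Polynomial.eval_mul] at *
      rw [hq]; simp
  have hcont : Continuous fun t : ℝ => y + t • (z - y) := by fun_prop
  have hopen : IsOpen ((fun t : ℝ => y + t • (z - y)) ⁻¹' (U ∩ K.carrier)) :=
    (hU.inter K.isOpen_carrier).preimage hcont
  have h0mem : (0 : ℝ) ∈ (fun t : ℝ => y + t • (z - y)) ⁻¹' (U ∩ K.carrier) := by
    simpa using ⟨hyU, hy⟩
  have hf0 : f = 0 := by
    apply Polynomial.eq_zero_of_infinite_isRoot
    refine Set.Infinite.mono (s := (fun t : ℝ => y + t • (z - y)) ⁻¹' (U ∩ K.carrier)) ?_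
      (infinite_of_mem_nhds 0 (hopen.mem_nhds h0mem))
    intro t ht
    show f.eval t = 0
    rw [hfe]; exact hz0 _ ht
  have := hfe 1
  rw [hf0] at this
  simp only [Polynomial.eval_zero, one_smul, add_sub_cancel] at this
  rw [h z hzK] at hz
  exact hz this.symm

/-- Elements at nodes connected by `MeshReach` have comparable size and distance. -/
theorem IsKMesh.comparable {C₀ : ℝ} (hKM : IsKMesh C₀ Ω M) (hM : IsMesh Ω M)
    (hΩ : IsBoundedLipschitz Ω) {z z' : Plane} (hz : IsNode M z) (hr : MeshReach M z z')
    {K K' : Rect} (hK : K ∈ M) (hK' : K' ∈ M) (hzK : z ∈ closure K.carrier)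
    (hzK' : z' ∈ closure K'.carrier) :
    K.h ≤ C₀ * K'.h ∧ K'.h ≤ C₀ * K.h ∧ dist z z' ≤ C₀ * K.h := by
  -- A conforming node reached from `z'` is also reached from `z`, so both elements lie in the
  -- support of one nodal function.
  obtain ⟨P, hP, hPnot⟩ := exists_meshReach_not_isMidSide (hr.isNode hz)
  have hPnode : IsNode M P := hP.isNode (hr.isNode hz)
  have hPc : IsConformingNode Ω M P := by
    by_contra h; exact hPnot (hM.isMidSide_of_not_conforming hΩ.1 hPnode h)
  obtain ⟨ψ, hψ, hdiam⟩ := hKM P hPc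
  have h1 : 0 < ψ P := by rw [hψ.eq_one]; exact one_pos
  have hz'pos := hψ.pos_of_meshReach hM hΩ.1 hP h1
  have hzpos := hψ.pos_of_meshReach hM hΩ.1 hr hz'pos
  have hs := hψ.carrier_subset_nodalSupport hM hzpos.ne' hK hzK
  have hs' := hψ.carrier_subset_nodalSupport hM hz'pos.ne' hK' hzK'
  have hcl : IsClosed (nodalSupport Ω ψ) := isClosed_closure
  have hb : Bornology.IsBounded (nodalSupport Ω ψ) :=
    (hΩ.2.1.subset fun x hx => hx.1).closure
  refine ⟨(Metric.diam_mono hs hb).trans (hdiam K' hK' hs'),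
    (Metric.diam_mono hs' hb).trans (hdiam K hK hs), ?_⟩
  exact (Metric.dist_le_diam_of_mem hb (closure_minimal hs hcl hzK)
    (closure_minimal hs' hcl hzK')).trans (hdiam K hK hs)

end KMesh

/-! ### Integrals over axis-parallel segments -/

theorem isometry_pt (i : Fin 2) (c : ℝ) : Isometry (pt i c) := by
  refine Isometry.of_dist_eq fun s t => ?_
  have h0 : dist (pt i c s) (pt i c t) = √(∑ k, dist (pt i c s k) (pt i c t k) ^ 2) :=
    EuclideanSpace.dist_eq _ _
  have h : ∑ k, dist (pt i c s k) (pt i c t k) ^ 2 = dist s t ^ 2 := by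
    rw [Fin.sum_univ_two]
    fin_cases i <;> simp [pt]
  rw [h0, h, Real.sqrt_sq dist_nonneg]

/-- The segment on the line `x_i = c` between the values `l` and `u` of the other coordinate. -/
def coordSegment (i : Fin 2) (c l u : ℝ) : Set Plane :=
  {x | x i = c ∧ l ≤ x (oth i) ∧ x (oth i) ≤ u}

theorem coordSegment_eq_image (i : Fin 2) (c l u : ℝ) :
    coordSegment i c l u = pt i c '' Icc l u := by
  ext x
  constructor
  · rintro ⟨h1, h2⟩
    exact ⟨x (oth i), h2, by rw [← h1, pt_eta]⟩
  · rintro ⟨t, ht, rfl⟩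
    exact ⟨by simp, by simpa using ht.1, by simpa using ht.2⟩

theorem restrict_coordSegment (i : Fin 2) (c l u : ℝ) :
    (μH[1] : Measure Plane).restrict (coordSegment i c l u) =
      (volume.restrict (Icc l u)).map (pt i c) := by
  have hiso := isometry_pt i c
  have hemb : MeasurableEmbedding (pt i c) := hiso.isClosedEmbedding.measurableEmbedding
  have h1 := hiso.map_hausdorffMeasure (d := 1) (Or.inl zero_le_one)
  rw [hausdorffMeasure_real] at h1
  have h2 : (volume.restrict (Icc l u)).map (pt i c) =
      (volume.map (pt i c)).restrict (pt i c '' Icc l u) := by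
    rw [hemb.restrict_map, hiso.injective.preimage_image]
  have hm : MeasurableSet (pt i c '' Icc l u) := hemb.measurableSet_image.2 measurableSet_Icc
  rw [h2, h1, Measure.restrict_restrict hm, coordSegment_eq_image,
    inter_eq_left.2 (image_subset_range _ _)]

theorem setIntegral_coordSegment (i : Fin 2) (c : ℝ) {l u : ℝ} (h : l ≤ u) (F : Plane → ℝ) :
    ∫ x in coordSegment i c l u, F x ∂(μH[1] : Measure Plane) = ∫ t in l..u, F (pt i c t) := by
  have hemb : MeasurableEmbedding (pt i c) := (isometry_pt i c).isClosedEmbedding.measurableEmbedding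
  rw [restrict_coordSegment, hemb.integral_map, intervalIntegral.integral_of_le h,
    integral_Icc_eq_integral_Ioc]

/-! ### Jumps -/

theorem bool_eq_not_of_ne {a b : Bool} (h : ¬ a = b) : a = !b := by
  cases a <;> cases b <;> simp at h ⊢

section Jumps

variable {Ω : Set Plane} {M : Finset Rect}

/-- The common side of adjacent elements, as an interval. -/
def Rect.commonLo (K K' : Rect) (j : Fin 2) : ℝ := max (K.lo j) (K'.lo j)
/-- The common side of adjacent elements, as an interval. -/
def Rect.commonHi (K K' : Rect) (j : Fin 2) : ℝ := min (K.hi j) (K'.hi j)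

theorem Rect.Adj.commonLo_lt {K K' : Rect} {i : Fin 2} {b : Bool} (h : K.Adj K' i b) :
    K.commonLo K' (oth i) < K.commonHi K' (oth i) :=
  max_lt (lt_min (K.lo_lt_hi _) h.lt₁) (lt_min h.lt₂ (K'.lo_lt_hi _))

/-- All jumps between adjacent elements of `S` have `L²` norm at most `B`. -/
def EdgeBound (V : Rect → MvPolynomial (Fin 2) ℝ) (S : Set Rect) (B : ℝ) : Prop :=
  ∀ K ∈ S, ∀ K' ∈ S, ∀ i b, K.Adj K' i b →
    ∫ t in K.commonLo K' (oth i)..K.commonHi K' (oth i),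
      (polyEval (V K - V K') (pt i (K.bd i b) t)) ^ 2 ≤ B ^ 2

/-- The common side is a whole side of one of the two elements, so it cannot be shorter than both
sides. -/
theorem IsMesh.width_le_common (hM : IsMesh Ω M) {K K' : Rect} (hK : K ∈ M) (hK' : K' ∈ M)
    {i : Fin 2} {b : Bool} (h : K.Adj K' i b) {w : ℝ} (hw : w ≤ K.width (oth i))
    (hw' : w ≤ K'.width (oth i)) : w ≤ K.commonHi K' (oth i) - K.commonLo K' (oth i) := by
  rcases hM.whole_side_of_adj hK hK' h with ⟨h1, h2⟩ | ⟨h1, h2⟩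
  · rw [Rect.commonHi, Rect.commonLo, min_eq_left h2, max_eq_left h1]; exact hw
  · rw [Rect.commonHi, Rect.commonLo, min_eq_right h2, max_eq_right h1]; exact hw'

/-- The mesh sizes in `S` are bounded below by `w`, up to shape regularity. -/
def WidthBound (S : Set Rect) (w : ℝ) : Prop := ∀ K ∈ S, ∀ i, w ≤ K.width i

variable {V : Rect → MvPolynomial (Fin 2) ℝ} {S : Set Rect} {B w : ℝ} {p : ℕ}

/-- The pointwise inverse inequality on the common side, whose length is at least `w`. -/
theorem EdgeBound.jump_sq_le (hV : ∀ K, V K ∈ Qp p) (hp : 1 ≤ p) (hB : EdgeBound V S B)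
    (hw : WidthBound S w) (hw0 : 0 < w) (hM : IsMesh Ω M) {K K' : Rect} (hK : K ∈ M)
    (hK' : K' ∈ M) (hKS : K ∈ S) (hKS' : K' ∈ S) {i : Fin 2} {b : Bool} (h : K.Adj K' i b)
    {z : Plane} (hz : z i = K.bd i b) (hz1 : z ∈ closure K.carrier)
    (hz2 : z ∈ closure K'.carrier) :
    (polyEval (V K) z - polyEval (V K') z) ^ 2 ≤ 264 * (p : ℝ) ^ 2 / w * B ^ 2 := by
  rw [Rect.mem_closure] at hz1 hz2
  have hq : V K - V K' ∈ Qp p := Submodule.sub_mem _ (hV K) (hV K')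
  have hlt := h.commonLo_lt
  have hmem : z (oth i) ∈ Icc (K.commonLo K' (oth i)) (K.commonHi K' (oth i)) :=
    ⟨max_le (hz1 _).1 (hz2 _).1, le_min (hz1 _).2 (hz2 _).2⟩
  have h1 := UnitIntervalPoly.eval_sq_le hp (natDegree_lineTrace_le hq i (K.bd i b)) hlt hmem
  simp only [Polynomial.eval_pow, eval_lineTrace] at h1
  rw [← hz, pt_eta, polyEval_sub] at h1
  refine h1.trans ?_
  have h2 := hB K hKS K' hKS' i b h
  have h3 := hM.width_le_common hK hK' h (hw K hKS _) (hw K' hKS' _)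
  rw [hz]
  have h4 : 0 ≤ ∫ t in K.commonLo K' (oth i)..K.commonHi K' (oth i),
      (polyEval (V K - V K') (pt i (K.bd i b) t)) ^ 2 :=
    intervalIntegral.integral_nonneg hlt.le fun t _ => sq_nonneg _
  gcongr

/-- Checkerboards do not occur. At a boundary point some filled quadrant `d` has an unfilled
opposite; since `e` and `e'` are opposite and both filled, `d` is neither of them and hence lies
between them. -/
theorem IsMesh.filled_between (hM : IsMesh Ω M) (hΩ : IsBoundedLipschitz Ω) {z : Plane}
    (hz : z ∈ closure Ω) {e e' : Fin 2 → Bool} (he : Filled M z e) (he' : Filled M z e')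
    (h : ∀ i, e' i = !e i) : ∃ i, ∃ e'', e'' i = !e i ∧ e'' (oth i) = e (oth i) ∧
      Filled M z e'' := by
  by_cases hzΩ : z ∈ Ω
  · exact ⟨0, fun k => if k = 0 then !e 0 else e k, by simp, by simp [oth], hM.filled_of_mem hΩ.1 hzΩ _⟩
  have hfr : z ∈ frontier Ω := by rw [hΩ.1.frontier_eq]; exact ⟨hz, hzΩ⟩
  obtain ⟨d, hd, hd'⟩ := hM.exists_filled_not_filled hΩ hfr
  have hee : e' = fun i => !e i := funext h
  have h1 : d ≠ e := by rintro rfl; exact hd' (hee ▸ he')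
  have h2 : d ≠ e' := by
    rintro rfl; apply hd'
    have : (fun i => !d i) = e := by ext i; rw [h i]; simp
    rwa [this]
  by_cases h0 : d 0 = e 0
  · refine ⟨1, d, ?_, h0, hd⟩
    by_contra h3
    apply h1
    ext i
    have : d 1 = e 1 := by_contra fun h4 => h3 (bool_eq_not_of_ne h4)
    fin_cases i <;> simp [h0, this]
  · refine ⟨0, d, ?_, ?_, hd⟩
    · exact bool_eq_not_of_ne h0
    · show d 1 = e 1
      by_contra h3
      apply h2
      ext i
      have e0 : d 0 = e' 0 := by rw [h]; exact bool_eq_not_of_ne h0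
      have e1 : d 1 = e' 1 := by rw [h]; exact bool_eq_not_of_ne h3
      fin_cases i <;> simp [e0, e1]

/-- The jump at a point between any two elements which contain it is controlled by the jumps over
the sides at the point. -/
theorem EdgeBound.abs_jump_le (hV : ∀ K, V K ∈ Qp p) (hp : 1 ≤ p) (hB : EdgeBound V S B)
    (hw : WidthBound S w) (hw0 : 0 < w) (hM : IsMesh Ω M) (hΩ : IsBoundedLipschitz Ω)
    {z : Plane} (hS : ∀ K ∈ M, z ∈ closure K.carrier → K ∈ S)
    {K K' : Rect} (hK : K ∈ M) (hK' : K' ∈ M) (hz : z ∈ closure K.carrier)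
    (hz' : z ∈ closure K'.carrier) :
    |polyEval (V K) z - polyEval (V K') z| ≤ 2 * √(264 * (p : ℝ) ^ 2 / w * B ^ 2) := by
  set J := √(264 * (p : ℝ) ^ 2 / w * B ^ 2) with hJ
  have hJ0 : 0 ≤ J := Real.sqrt_nonneg _
  have hop : ∀ K₁ ∈ M, ∀ K₂ ∈ M, ∀ e e' : Fin 2 → Bool, K₁.Covers z e → K₂.Covers z e' →
      ∀ i, e' i = (!e i) → e' (oth i) = e (oth i) →
      |polyEval (V K₁) z - polyEval (V K₂) z| ≤ J := by
    intro K₁ h1 K₂ h2 e e' hc1 hc2 i hi hj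
    by_cases hne : K₁ = K₂
    · rw [hne]; simpa using hJ0
    obtain ⟨ha, hzi⟩ := hM.adj_of_covers h1 h2 hne hc1 hc2 hi hj
    apply Real.abs_le_sqrt
    exact hB.jump_sq_le hV hp hw hw0 hM h1 h2 (hS _ h1 hc1.mem_closure) (hS _ h2 hc2.mem_closure)
      ha hzi hc1.mem_closure hc2.mem_closure
  obtain ⟨e, he⟩ := Rect.exists_covers hz
  obtain ⟨e', he'⟩ := Rect.exists_covers hz'
  by_cases h0 : e' 0 = e 0 <;> by_cases h1 : e' 1 = e 1
  · have : e' = e := by ext i; fin_cases i <;> simp [h0, h1]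
    subst this
    rw [hM.covers_unique hK hK' he he']; simpa using hJ0
  · have := hop K hK K' hK' e e' he he' 1 (bool_eq_not_of_ne h1) h0
    linarith
  · have := hop K hK K' hK' e e' he he' 0 (bool_eq_not_of_ne h0) h1
    linarith
  · have hopp : ∀ i, e' i = !e i := by
      rw [Fin.forall_fin_two]
      constructor
      · exact bool_eq_not_of_ne h0
      · exact bool_eq_not_of_ne h1
    -- Opposite quadrants are joined through an element between them; crossing two sides is the
    -- origin of the factor `2`.
    obtain ⟨i, d, hd1, hd2, K₂, hK₂, hc⟩ := hM.filled_between hΩ (hM.closure_subset hK hz)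
      ⟨K, hK, he⟩ ⟨K', hK', he'⟩ hopp
    have a1 := hop K hK K₂ hK₂ e d he hc i hd1 hd2
    have a2 := hop K₂ hK₂ K' hK' d e' hc he' (oth i) (by rw [hopp, hd2])
      (by rw [oth_oth, hopp, hd1])
    have := abs_sub_le (polyEval (V K) z) (polyEval (V K₂) z) (polyEval (V K') z)
    linarith

end Jumps

/-! ### Cutoff polynomials transported to the sides -/

/-- Polynomials `β` of degree at most `p` with `β(0) = 1`, `β(1) = 0`, `0 ≤ β(x) ≤ 1 - x` and
`‖β‖² ≤ 2 / p²` on the unit interval. -/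
structure IsCutoff (p : ℕ) (β : Polynomial ℝ) : Prop where
  natDegree_le : β.natDegree ≤ p
  eval_zero : β.eval 0 = 1
  eval_one : β.eval 1 = 0
  bounds : ∀ x ∈ Icc (0 : ℝ) 1, 0 ≤ β.eval x ∧ β.eval x ≤ 1 - x
  integral_le : ∫ x in (0 : ℝ)..1, (β ^ 2).eval x ≤ 2 / (p : ℝ) ^ 2

namespace Rect

theorem weight_not (K : Rect) (j : Fin 2) (b : Bool) (t : ℝ) :
    K.weight j (!b) t = 1 - K.weight j b t := by
  have := K.weight_add j t
  cases b <;> simp <;> linarith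

@[simp] theorem weight_bd_self (K : Rect) (j : Fin 2) (b : Bool) : K.weight j b (K.bd j b) = 1 := by
  have := (K.width_pos j).ne'
  cases b <;> simp [weight] <;> simp only [width] at * <;> exact div_self this

@[simp] theorem weight_bd_not (K : Rect) (j : Fin 2) (b : Bool) :
    K.weight j (!b) (K.bd j b) = 0 := by
  rw [weight_not, weight_bd_self, sub_self]

theorem weight_nonneg (K : Rect) {j : Fin 2} (b : Bool) {t : ℝ} (ht : t ∈ Icc (K.lo j) (K.hi j)) :
    0 ≤ K.weight j b t := by
  have := (K.width_pos j)
  cases b <;> simp only [weight, Bool.false_eq_true, if_false, if_true] <;>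
    apply div_nonneg _ this.le <;> linarith [ht.1, ht.2]

/-- The cutoff polynomial on the interval `(lo j, hi j)` with value one at the end `b`. -/
def shape (K : Rect) (β : Polynomial ℝ) (j : Fin 2) (b : Bool) : Polynomial ℝ :=
  β.comp (if b then .C (- (K.width j)⁻¹) * .X + .C (K.hi j / K.width j)
    else .C (K.width j)⁻¹ * .X + .C (- K.lo j / K.width j))

theorem eval_shape (K : Rect) (β : Polynomial ℝ) (j : Fin 2) (b : Bool) (t : ℝ) :
    (K.shape β j b).eval t = β.eval (K.weight j (!b) t) := by
  have h := (K.width_pos j).ne'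
  rw [shape, Polynomial.eval_comp]
  congr 1
  cases b <;> simp [weight] <;> field_simp <;> ring

end Rect

namespace IsCutoff

variable {p : ℕ} {β : Polynomial ℝ} (hβ : IsCutoff p β)
include hβ

theorem natDegree_shape_le (K : Rect) (j : Fin 2) (b : Bool) : (K.shape β j b).natDegree ≤ p := by
  rw [Rect.shape]
  split_ifs <;> exact UnitIntervalPoly.natDegree_comp_affine_le hβ.natDegree_le _ _

theorem shape_self (K : Rect) (j : Fin 2) (b : Bool) : (K.shape β j b).eval (K.bd j b) = 1 := by
  rw [Rect.eval_shape, Rect.weight_bd_not, hβ.eval_zero]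

theorem shape_not (K : Rect) (j : Fin 2) (b : Bool) : (K.shape β j (!b)).eval (K.bd j b) = 0 := by
  rw [Rect.eval_shape, Bool.not_not, Rect.weight_bd_self, hβ.eval_one]

theorem shape_bounds (K : Rect) {j : Fin 2} (b : Bool) {t : ℝ} (ht : t ∈ Icc (K.lo j) (K.hi j)) :
    0 ≤ (K.shape β j b).eval t ∧ (K.shape β j b).eval t ≤ K.weight j b t := by
  rw [Rect.eval_shape]
  have h0 := K.weight_nonneg b ht
  have h1 := K.weight_nonneg (!b) ht
  have h2 := K.weight_not j b t
  have := hβ.bounds (K.weight j (!b) t) ⟨h1, by linarith⟩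
  exact ⟨this.1, by linarith [this.2]⟩

theorem integral_shape_sq_le (K : Rect) (j : Fin 2) (b : Bool) :
    ∫ t in K.lo j..K.hi j, (K.shape β j b ^ 2).eval t ≤ 2 / (p : ℝ) ^ 2 * K.width j := by
  have h := K.width_pos j
  have key : ∫ t in K.lo j..K.hi j, (K.shape β j b ^ 2).eval t =
      K.width j * ∫ x in (0 : ℝ)..1, (β ^ 2).eval x := by
    simp only [Polynomial.eval_pow, Rect.eval_shape]
    have e0 : ∀ x : ℝ, x * (K.hi j - K.lo j) / (K.hi j - K.lo j) = x := fun x =>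
      mul_div_cancel_right₀ x (sub_ne_zero.2 (K.lo_lt_hi j).ne')
    cases b
    · have := intervalIntegral.integral_comp_div_sub (a := K.lo j) (b := K.hi j)
        (fun x => (β.eval x) ^ 2) h.ne' (K.lo j / K.width j)
      rw [smul_eq_mul, ← sub_div, ← sub_div, sub_self, zero_div, ← Rect.width, div_self h.ne'] at this
      rw [← this]
      congr 1; ext x; simp [Rect.weight, sub_div]
    · have := intervalIntegral.integral_comp_sub_div (a := K.lo j) (b := K.hi j)
        (fun x => (β.eval x) ^ 2) h.ne' (K.hi j / K.width j)
      rw [smul_eq_mul, ← sub_div, ← sub_div, sub_self, zero_div, ← Rect.width, div_self h.ne'] at this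
      rw [← this]
      congr 1; ext x; simp [Rect.weight, sub_div]
  rw [key, mul_comm]
  exact mul_le_mul_of_nonneg_right hβ.integral_le h.le

end IsCutoff

/-! ### Corrected traces, their transfinite blending, and conformity -/

section Construction

variable (M : Finset Rect) (β : Polynomial ℝ) (V : Rect → MvPolynomial (Fin 2) ℝ) (N : Plane → ℝ)

/-- The trace of `V K` on the side `(i, b)`, corrected to attain the values `N` at both ends. -/
def sideTrace (K : Rect) (i : Fin 2) (b : Bool) : Polynomial ℝ :=
  lineTrace i (K.bd i b) (V K) +
    (.C (N (K.endPt i b false) - polyEval (V K) (K.endPt i b false)) * K.shape β (oth i) false +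
      .C (N (K.endPt i b true) - polyEval (V K) (K.endPt i b true)) * K.shape β (oth i) true)

/-- The side `(i, b)` of `K` is contained in a side of `K'`, which determines the trace; one of two
equal sides is preferred. -/
structure OwnedBy (K K' : Rect) (i : Fin 2) (b : Bool) : Prop where
  mem : K' ∈ M
  adj : K.Adj K' i b
  lo_le : K'.lo (oth i) ≤ K.lo (oth i)
  le_hi : K.hi (oth i) ≤ K'.hi (oth i)
  pref : b = false ∨ ¬ (K'.lo (oth i) = K.lo (oth i) ∧ K'.hi (oth i) = K.hi (oth i))

open Classical in
/-- The trace on the side `(i, b)` of `K` of the conforming function. -/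
def ownerTrace (K : Rect) (i : Fin 2) (b : Bool) : Polynomial ℝ :=
  if h : ∃ K', OwnedBy M K K' i b then sideTrace β V N h.choose i (!b) else sideTrace β V N K i b

/-- The correction of the trace on the side `(i, b)` of `K`. -/
def traceDefect (K : Rect) (i : Fin 2) (b : Bool) : Polynomial ℝ :=
  ownerTrace M β V N K i b - lineTrace i (K.bd i b) (V K)

/-- The part of the blended correction which lifts the sides with normal direction `i`. -/
def liftSides (K : Rect) (i : Fin 2) : MvPolynomial (Fin 2) ℝ :=
  inCoord i (K.shape β i false) * inCoord (oth i) (traceDefect M β V N K i false) +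
    inCoord i (K.shape β i true) * inCoord (oth i) (traceDefect M β V N K i true)

/-- The bilinear blending of the vertex corrections. -/
def liftVertex (K : Rect) (b b' : Bool) : MvPolynomial (Fin 2) ℝ :=
  (N (K.endPt 0 b b') - polyEval (V K) (K.endPt 0 b b')) •
    (inCoord 0 (K.shape β 0 b) * inCoord 1 (K.shape β 1 b'))

/-- The transfinite blending of the trace corrections. -/
def blending (K : Rect) : MvPolynomial (Fin 2) ℝ :=
  liftSides M β V N K 0 + liftSides M β V N K 1 -
    (liftVertex β V N K false false + liftVertex β V N K false true +
      (liftVertex β V N K true false + liftVertex β V N K true true))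

variable {M β V N} {p : ℕ} {Ω : Set Plane}

theorem natDegree_sideTrace_le (hβ : IsCutoff p β) (hV : ∀ K, V K ∈ Qp p) (K : Rect) (i : Fin 2)
    (b : Bool) : (sideTrace β V N K i b).natDegree ≤ p := by
  rw [sideTrace]
  refine Polynomial.natDegree_add_le_of_degree_le (natDegree_lineTrace_le (hV K) _ _)
    (Polynomial.natDegree_add_le_of_degree_le ?_ ?_) <;>
    exact (Polynomial.natDegree_C_mul_le _ _).trans (hβ.natDegree_shape_le K _ _)

theorem natDegree_traceDefect_le (hβ : IsCutoff p β) (hV : ∀ K, V K ∈ Qp p) (K : Rect) (i : Fin 2)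
    (b : Bool) : (traceDefect M β V N K i b).natDegree ≤ p := by
  rw [traceDefect, ownerTrace]
  refine (Polynomial.natDegree_sub_le _ _).trans (max_le ?_ (natDegree_lineTrace_le (hV K) _ _))
  split_ifs <;> exact natDegree_sideTrace_le hβ hV _ _ _

theorem liftVertex_mem (hβ : IsCutoff p β) (K : Rect) (b b' : Bool) :
    liftVertex β V N K b b' ∈ Qp p :=
  Submodule.smul_mem _ _ (inCoord_mul_inCoord_mem (hβ.natDegree_shape_le K _ _)
    (hβ.natDegree_shape_le K _ _) 0)

theorem liftSides_mem (hβ : IsCutoff p β) (hV : ∀ K, V K ∈ Qp p) (K : Rect) (i : Fin 2) :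
    liftSides M β V N K i ∈ Qp p :=
  Submodule.add_mem _
    (inCoord_mul_inCoord_mem (hβ.natDegree_shape_le K _ _) (natDegree_traceDefect_le hβ hV K _ _) i)
    (inCoord_mul_inCoord_mem (hβ.natDegree_shape_le K _ _) (natDegree_traceDefect_le hβ hV K _ _) i)

theorem blending_mem (hβ : IsCutoff p β) (hV : ∀ K, V K ∈ Qp p) (K : Rect) :
    blending M β V N K ∈ Qp p :=
  Submodule.sub_mem _ (Submodule.add_mem _ (liftSides_mem hβ hV K _) (liftSides_mem hβ hV K _))
    (Submodule.add_mem _ (Submodule.add_mem _ (liftVertex_mem hβ K _ _) (liftVertex_mem hβ K _ _))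
      (Submodule.add_mem _ (liftVertex_mem hβ K _ _) (liftVertex_mem hβ K _ _)))

theorem eval_sideTrace_end (hβ : IsCutoff p β) (K : Rect) (i : Fin 2) (b b' : Bool) :
    (sideTrace β V N K i b).eval (K.bd (oth i) b') = N (K.endPt i b b') := by
  have h1 := hβ.shape_self K (oth i) b'
  have h2 := hβ.shape_not K (oth i) b'
  simp only [sideTrace, Polynomial.eval_add, Polynomial.eval_mul, Polynomial.eval_C, eval_lineTrace]
  cases b' <;> simp only [Bool.not_true, Bool.not_false] at h2 <;> rw [h1, h2] <;>
    simp [Rect.endPt]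

/-- The values `N` at nodes in the interior of sides are those of the corrected traces. -/
def IsConsistent (M : Finset Rect) (β : Polynomial ℝ) (V : Rect → MvPolynomial (Fin 2) ℝ)
    (N : Plane → ℝ) : Prop :=
  ∀ K ∈ M, ∀ z i b, IsNode M z → K.MidSide z i b →
    N z = (sideTrace β V N K i b).eval (z (oth i))

theorem OwnedBy.midSide {K K' : Rect} {i : Fin 2} {b : Bool} (h : OwnedBy M K K' i b) {x : Plane}
    (hx : K.MidSide x i b) : K'.MidSide x i (!b) :=
  ⟨hx.eq.trans h.adj.eq, h.lo_le.trans_lt hx.lo_lt, hx.lt_hi.trans_le h.le_hi⟩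

theorem Rect.exists_midSide (K : Rect) (i : Fin 2) (b : Bool) : ∃ x, K.MidSide x i b := by
  have := K.lo_lt_hi (oth i)
  exact ⟨pt i (K.bd i b) ((K.lo (oth i) + K.hi (oth i)) / 2), by simp, by simp; linarith,
    by simp; linarith⟩

theorem OwnedBy.unique (hM : IsMesh Ω M) {K K₁ K₂ : Rect} {i : Fin 2} {b : Bool}
    (h₁ : OwnedBy M K K₁ i b) (h₂ : OwnedBy M K K₂ i b) : K₁ = K₂ := by
  obtain ⟨x, hx⟩ := K.exists_midSide i b
  exact hM.covers_unique h₁.mem h₂.mem ((h₁.midSide hx).covers (e := fun _ => b) (by simp))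
    ((h₂.midSide hx).covers (e := fun _ => b) (by simp))

theorem OwnedBy.ownerTrace_eq (hM : IsMesh Ω M) {K K' : Rect} {i : Fin 2} {b : Bool}
    (h : OwnedBy M K K' i b) : ownerTrace M β V N K i b = sideTrace β V N K' i (!b) := by
  have hex : ∃ K', OwnedBy M K K' i b := ⟨K', h⟩
  rw [ownerTrace, dif_pos hex, OwnedBy.unique hM hex.choose_spec h]

theorem ownerTrace_eq_of_not {K : Rect} {i : Fin 2} {b : Bool}
    (h : ¬ ∃ K', OwnedBy M K K' i b) : ownerTrace M β V N K i b = sideTrace β V N K i b := by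
  rw [ownerTrace, dif_neg h]

/-- An end of the owned side is either an end of the owner's side, where the trace is corrected to
`N`, or a hanging node inside that side, where consistency supplies the value. -/
theorem eval_ownerTrace_end (hM : IsMesh Ω M) (hβ : IsCutoff p β) (hN : IsConsistent M β V N)
    {K : Rect} (hK : K ∈ M) (i : Fin 2) (b b' : Bool) :
    (ownerTrace M β V N K i b).eval (K.bd (oth i) b') = N (K.endPt i b b') := by
  by_cases hex : ∃ K', OwnedBy M K K' i b
  swap
  · rw [ownerTrace_eq_of_not hex, eval_sideTrace_end hβ]
  obtain ⟨K', h⟩ := hex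
  rw [h.ownerTrace_eq hM]
  by_cases h1 : ∃ b'', K.bd (oth i) b' = K'.bd (oth i) b''
  · obtain ⟨b'', hb⟩ := h1
    rw [hb, eval_sideTrace_end hβ, Rect.endPt, Rect.endPt, hb, h.adj.eq]
  · push Not at h1
    have hmid : K'.MidSide (K.endPt i b b') i (!b) := by
      refine ⟨by rw [Rect.endPt, pt_self, h.adj.eq], ?_, ?_⟩ <;> rw [Rect.endPt, pt_oth]
      · exact lt_of_le_of_ne (h.lo_le.trans (K.lo_le_bd _ _)) (h1 false).symm
      · exact lt_of_le_of_ne ((K.bd_le_hi _ _).trans h.le_hi) (h1 true)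
    rw [hN K' h.mem _ i (!b) ⟨K, hK, K.endPt_mem_vertices i b b'⟩ hmid, Rect.endPt, pt_oth]

theorem eval_traceDefect_end (hM : IsMesh Ω M) (hβ : IsCutoff p β) (hN : IsConsistent M β V N)
    {K : Rect} (hK : K ∈ M) (i : Fin 2) (b b' : Bool) :
    (traceDefect M β V N K i b).eval (K.bd (oth i) b') =
      N (K.endPt i b b') - polyEval (V K) (K.endPt i b b') := by
  rw [traceDefect, Polynomial.eval_sub, eval_ownerTrace_end hM hβ hN hK, eval_lineTrace, Rect.endPt]

theorem Rect.endPt_comm (K : Rect) (b b' : Bool) : K.endPt 1 b b' = K.endPt 0 b' b := by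
  have := pt_oth_comm 0 (K.bd 0 b') (K.bd 1 b)
  exact this

/-- On a side the blending attains the corrected trace. -/
theorem polyEval_blending (hM : IsMesh Ω M) (hβ : IsCutoff p β) (hN : IsConsistent M β V N)
    {K : Rect} (hK : K ∈ M) {x : Plane} {i : Fin 2} {b : Bool} (hx : x i = K.bd i b) :
    polyEval (blending M β V N K) x = (traceDefect M β V N K i b).eval (x (oth i)) := by
  have h1 := hβ.shape_self K i b
  have h2 := hβ.shape_not K i b
  -- On the side `(i, b)` the transverse lift contributes only the end values of its defects, which
  -- are exactly cancelled by the vertex terms.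
  have h3 := fun b'' => eval_traceDefect_end hM hβ hN hK (oth i) b'' b
  rw [oth_oth, ← hx] at h3
  rw [← hx] at h1 h2
  simp only [blending, liftSides, liftVertex, polyEval_sub, polyEval_add, polyEval_mul,
    polyEval_smul, polyEval_inCoord]
  have e0 : oth 0 = 1 := rfl
  have e1 : oth 1 = 0 := rfl
  rcases eq_or_eq_oth 0 i with rfl | rfl
  · simp only [e0, e1] at *
    rw [h3, h3]
    simp only [Rect.endPt_comm]
    cases b <;> simp only [Bool.not_true, Bool.not_false] at h2 <;> rw [h1, h2] <;> ring
  · simp only [e0, e1] at *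
    rw [h3, h3]
    cases b <;> simp only [Bool.not_true, Bool.not_false] at h2 <;> rw [h1, h2] <;> ring

theorem polyEval_add_blending (hM : IsMesh Ω M) (hβ : IsCutoff p β) (hN : IsConsistent M β V N)
    {K : Rect} (hK : K ∈ M) {x : Plane} {i : Fin 2} {b : Bool} (hx : x i = K.bd i b) :
    polyEval (V K + blending M β V N K) x = (ownerTrace M β V N K i b).eval (x (oth i)) := by
  rw [polyEval_add, polyEval_blending hM hβ hN hK hx, traceDefect, Polynomial.eval_sub,
    eval_lineTrace, ← hx, pt_eta]
  ring

theorem polyEval_add_blending_vertex (hM : IsMesh Ω M) (hβ : IsCutoff p β)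
    (hN : IsConsistent M β V N) {K : Rect} (hK : K ∈ M) {x : Plane} (hx : x ∈ K.vertices) :
    polyEval (V K + blending M β V N K) x = N x := by
  rw [Rect.mem_vertices] at hx
  obtain ⟨b, hb⟩ := hx 0
  obtain ⟨b', hb'⟩ := hx (oth 0)
  rw [polyEval_add_blending hM hβ hN hK hb, hb', eval_ownerTrace_end hM hβ hN hK, Rect.endPt, ← hb,
    ← hb', pt_eta]

/-- An owner would be a second element with the node in the interior of one of its sides. -/
theorem not_ownedBy_of_isNode (hM : IsMesh Ω M) {K : Rect} (hK : K ∈ M) {x : Plane}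
    (hx : IsNode M x) {i : Fin 2} {b : Bool} (h : K.MidSide x i b) :
    ¬ ∃ K', OwnedBy M K K' i b := by
  rintro ⟨K', hK'⟩
  obtain ⟨K₀, hK₀, hv⟩ := hx
  exact hK'.adj.ne (hM.midSide_unique hK₀ hK hK'.mem hv h (hK'.midSide h)).1

theorem polyEval_add_blending_node (hM : IsMesh Ω M) (hβ : IsCutoff p β)
    (hN : IsConsistent M β V N) {K : Rect} (hK : K ∈ M) {x : Plane} (hx : IsNode M x)
    (hxK : x ∈ closure K.carrier) : polyEval (V K + blending M β V N K) x = N x := by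
  rcases Rect.trichotomy hxK with h | ⟨i, b, h⟩ | h
  · exact (hM.not_mem_carrier_of_isNode hx hK h).elim
  · rw [polyEval_add_blending hM hβ hN hK h.eq,
      ownerTrace_eq_of_not (not_ownedBy_of_isNode hM hK hx h), ← hN K hK x i b hx h]
  · exact polyEval_add_blending_vertex hM hβ hN hK h

theorem ownedBy_or_ownedBy (hM : IsMesh Ω M) {K K' : Rect} (hK : K ∈ M) (hK' : K' ∈ M)
    {i : Fin 2} {b : Bool} (h : K.Adj K' i b) :
    OwnedBy M K K' i b ∨ OwnedBy M K' K i (!b) := by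
  by_cases heq : K'.lo (oth i) = K.lo (oth i) ∧ K'.hi (oth i) = K.hi (oth i)
  · cases b
    · exact Or.inl ⟨hK', h, heq.1.le, heq.2.ge, Or.inl rfl⟩
    · exact Or.inr ⟨hK, h.symm, heq.1.ge, heq.2.le, Or.inl rfl⟩
  · rcases hM.whole_side_of_adj hK hK' h with h1 | h1
    · exact Or.inl ⟨hK', h, h1.1, h1.2, Or.inr heq⟩
    · exact Or.inr ⟨hK, h.symm, h1.1, h1.2, Or.inr fun h2 => heq ⟨h2.1.symm, h2.2.symm⟩⟩

/-- It must be excluded that the owner's side is owned in turn. Its owner could only be `K`, the two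
sides would coincide, and the preference rule admits ownership in one direction only. -/
theorem OwnedBy.polyEval_eq (hM : IsMesh Ω M) (hβ : IsCutoff p β) (hN : IsConsistent M β V N)
    {K K' : Rect} (hK : K ∈ M) {i : Fin 2} {b : Bool} (h : OwnedBy M K K' i b) {x : Plane}
    (hx : K.MidSide x i b) :
    polyEval (V K + blending M β V N K) x = polyEval (V K' + blending M β V N K') x := by
  have hx' := h.midSide hx
  rw [polyEval_add_blending hM hβ hN hK hx.eq, polyEval_add_blending hM hβ hN h.mem hx'.eq,
    h.ownerTrace_eq hM, ownerTrace_eq_of_not]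
  rintro ⟨K'', h''⟩
  have hx'' := h''.midSide hx'
  rw [Bool.not_not] at hx''
  have : K'' = K := hM.covers_unique h''.mem hK (hx''.covers (e := fun _ => !b) rfl)
    (hx.covers (e := fun _ => !b) rfl)
  subst this
  have h1 := le_antisymm h.lo_le h''.lo_le
  have h2 := le_antisymm h''.le_hi h.le_hi
  rcases h.pref with hp | hp
  · rcases h''.pref with hp' | hp'
    · rw [hp] at hp'; simp at hp'
    · exact hp' ⟨h1.symm, h2.symm⟩
  · exact hp ⟨h1, h2⟩

/-- The corrected polynomials agree on common points of closed elements. -/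
theorem polyEval_add_blending_agree (hM : IsMesh Ω M) (hβ : IsCutoff p β)
    (hN : IsConsistent M β V N) {K K' : Rect} (hK : K ∈ M) (hK' : K' ∈ M) {x : Plane}
    (hx : x ∈ closure K.carrier) (hx' : x ∈ closure K'.carrier) :
    polyEval (V K + blending M β V N K) x = polyEval (V K' + blending M β V N K') x := by
  by_cases hne : K = K'
  · rw [hne]
  have node : IsNode M x → polyEval (V K + blending M β V N K) x =
      polyEval (V K' + blending M β V N K') x := fun h => by
    rw [polyEval_add_blending_node hM hβ hN hK h hx, polyEval_add_blending_node hM hβ hN hK' h hx']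
  rcases Rect.trichotomy hx with h | ⟨i, b, h⟩ | h
  · exact (hne (hM.eq_of_mem_carrier_of_mem_closure hK hK' h hx')).elim
  · rcases Rect.trichotomy hx' with h' | ⟨i', b', h'⟩ | h'
    · exact (hne (hM.eq_of_mem_carrier_of_mem_closure hK' hK h' hx).symm).elim
    · obtain ⟨rfl, rfl, ha⟩ := hM.adj_of_midSide hK hK' hne h h'
      rcases ownedBy_or_ownedBy hM hK hK' ha with ho | ho
      · exact ho.polyEval_eq hM hβ hN hK h
      · exact (ho.polyEval_eq hM hβ hN hK' h').symm
    · exact node ⟨K', hK', h'⟩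
  · exact node ⟨K, hK, h⟩

end Construction

/-! ### Solvability of the linear system for the nodal values -/

section NodalValues

variable {M : Finset Rect} {β : Polynomial ℝ} {p : ℕ} {Ω : Set Plane}

open Classical in
/-- The polynomials of `v`, extended by zero to all rectangles. -/
def extendPoly (M : Finset Rect) (p : ℕ) :
    BrokenPoly M p →ₗ[ℝ] (Rect → MvPolynomial (Fin 2) ℝ) where
  toFun v K := if h : K ∈ M then (v ⟨K, h⟩ : MvPolynomial (Fin 2) ℝ) else 0
  map_add' v w := by ext1 K; by_cases h : K ∈ M <;> simp [h]
  map_smul' c v := by ext1 K; by_cases h : K ∈ M <;> simp [h]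

theorem extendPoly_of_mem (v : BrokenPoly M p) (K : {K : Rect // K ∈ M}) :
    extendPoly M p v K.1 = v K := by simp [extendPoly]

theorem extendPoly_mem (v : BrokenPoly M p) (K : Rect) : extendPoly M p v K ∈ Qp p := by
  by_cases h : K ∈ M
  · simp [extendPoly, h]
  · simp [extendPoly, h]

open Classical in
/-- Extension by zero of a function on the nodes. -/
def extendNodal (M : Finset Rect) : ({z // IsNode M z} → ℝ) →ₗ[ℝ] (Plane → ℝ) where
  toFun n z := if h : IsNode M z then n ⟨z, h⟩ else 0
  map_add' v w := by ext1 z; by_cases h : IsNode M z <;> simp [h]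
  map_smul' c v := by ext1 z; by_cases h : IsNode M z <;> simp [h]

theorem extendNodal_of_isNode (n : {z // IsNode M z} → ℝ) (z : {z // IsNode M z}) :
    extendNodal M n z.1 = n z := by simp [extendNodal, z.2]

/-- The bound `β(x) ≤ 1 - x` dominates the cutoff weights by barycentric weights, so the maximum
principle applies to absolute values with no loss in `p`. -/
theorem shape_eval_abs_le (hβ : IsCutoff p β) {K : Rect} {z : Plane} {i : Fin 2} {b : Bool}
    (h : K.MidSide z i b) (x y : ℝ) :
    |(K.shape β (oth i) false).eval (z (oth i)) * x + (K.shape β (oth i) true).eval (z (oth i)) * y|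
      ≤ K.weight (oth i) false (z (oth i)) * |x| + K.weight (oth i) true (z (oth i)) * |y| := by
  have h1 := hβ.shape_bounds K (j := oth i) false ⟨h.lo_lt.le, h.lt_hi.le⟩
  have h2 := hβ.shape_bounds K (j := oth i) true ⟨h.lo_lt.le, h.lt_hi.le⟩
  refine (abs_add_le _ _).trans ?_
  rw [abs_mul, abs_mul, abs_of_nonneg h1.1, abs_of_nonneg h2.1]
  exact add_le_add (mul_le_mul_of_nonneg_right h1.2 (abs_nonneg _))
    (mul_le_mul_of_nonneg_right h2.2 (abs_nonneg _))

theorem eval_sideTrace_midSide {V : Rect → MvPolynomial (Fin 2) ℝ} {N : Plane → ℝ} {K : Rect}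
    {z : Plane} {i : Fin 2} {b : Bool} (h : K.MidSide z i b) :
    (sideTrace β V N K i b).eval (z (oth i)) = polyEval (V K) z +
      ((K.shape β (oth i) false).eval (z (oth i)) *
          (N (K.endPt i b false) - polyEval (V K) (K.endPt i b false)) +
        (K.shape β (oth i) true).eval (z (oth i)) *
          (N (K.endPt i b true) - polyEval (V K) (K.endPt i b true))) := by
  simp only [sideTrace, Polynomial.eval_add, Polynomial.eval_mul, Polynomial.eval_C, eval_lineTrace]
  rw [← h.eq, pt_eta]
  ring

open Classical in
/-- Consistent nodal values which are given by the elements `K₀ z` at the nodes `z` that do not lie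
in the interior of a side. -/
theorem exists_nodalValues (hM : IsMesh Ω M) (hβ : IsCutoff p β) (K₀ : Plane → Rect) :
    ∃ N : BrokenPoly M p →ₗ[ℝ] (Plane → ℝ), ∀ v,
      IsConsistent M β (extendPoly M p v) (N v) ∧
      ∀ z, IsNode M z → ¬ IsMidSide M z → N v z = polyEval (extendPoly M p v (K₀ z)) z := by
  have hfin : Finite {z // IsNode M z} := (finite_setOf_isNode M).to_subtype
  have hex : ∀ z : Plane, ∃ K i b, IsMidSide M z → K ∈ M ∧ K.MidSide z i b := by
    intro z
    by_cases h : IsMidSide M z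
    · obtain ⟨K, hK, i, b, hm⟩ := h
      exact ⟨K, i, b, fun _ => ⟨hK, hm⟩⟩
    · exact ⟨K₀ z, 0, false, fun h' => (h h').elim⟩
  choose K i b hKb using hex
  set c : Plane → Bool → ℝ := fun z b' =>
    if IsMidSide M z then ((K z).shape β (oth (i z)) b').eval (z (oth (i z))) else 0 with hc
  set en : Plane → Bool → Plane := fun z b' => (K z).endPt (i z) (b z) b' with hen
  -- `A n = R v` is the consistency system: the identity minus cutoff interpolation from the side
  -- ends at hanging nodes, and the plain identity at the others.
  let A : ({z // IsNode M z} → ℝ) →ₗ[ℝ] ({z // IsNode M z} → ℝ) :=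
    { toFun := fun n z => n z - (c z.1 false * extendNodal M n (en z.1 false) +
        c z.1 true * extendNodal M n (en z.1 true))
      map_add' := fun n m => by ext z; simp only [map_add, Pi.add_apply]; ring
      map_smul' := fun a n => by
        ext z; simp only [map_smul, Pi.smul_apply, smul_eq_mul, RingHom.id_apply]; ring }
  have hinj : Function.Injective A := by
    rw [← LinearMap.ker_eq_bot, LinearMap.ker_eq_bot']
    intro n hn
    by_contra hne
    obtain ⟨y, hy⟩ := Function.ne_iff.1 hne
    -- For a homogeneous solution the maximum of `|n|` is attained at a node outside all side
    -- interiors, where the equation reads `n z = 0`.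
    obtain ⟨z, hz, hnot, hmax⟩ := exists_max_not_isMidSide (M := M) (finite_setOf_isNode M)
      ⟨y.1, y.2⟩ (fun z => |extendNodal M n z|) (by
        intro z hz hmid
        obtain ⟨hK, hm⟩ := hKb z hmid
        refine ⟨en z false, ⟨K z, hK, (K z).endPt_mem_vertices _ _ _⟩, en z true,
          ⟨K z, hK, (K z).endPt_mem_vertices _ _ _⟩, Rect.endPt_sum_lt hm, _, _,
          (hm.weight_pos false).le, hm.weight_pos true, (K z).weight_add _ _, ?_⟩
        have h1 := congrFun hn ⟨z, hz⟩
        simp only [A, LinearMap.coe_mk, AddHom.coe_mk, Pi.zero_apply] at h1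
        rw [extendNodal_of_isNode n ⟨z, hz⟩, sub_eq_zero.1 h1]
        simp only [hc, if_pos hmid]
        exact shape_eval_abs_le hβ hm _ _)
    have h1 := congrFun hn ⟨z, hz⟩
    simp only [A, LinearMap.coe_mk, AddHom.coe_mk, Pi.zero_apply, hc, if_neg hnot, zero_mul,
      add_zero, sub_zero] at h1
    have h2 := hmax y.1 y.2
    rw [extendNodal_of_isNode n ⟨z, hz⟩, h1, extendNodal_of_isNode n y, abs_zero] at h2
    exact hy (abs_nonpos_iff.1 h2)
  let E := LinearEquiv.ofInjectiveEndo A hinj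
  let R : BrokenPoly M p →ₗ[ℝ] ({z // IsNode M z} → ℝ) :=
    { toFun := fun v z => if IsMidSide M z.1 then
          polyEval (extendPoly M p v (K z.1)) z.1 -
            (c z.1 false * polyEval (extendPoly M p v (K z.1)) (en z.1 false) +
              c z.1 true * polyEval (extendPoly M p v (K z.1)) (en z.1 true))
        else polyEval (extendPoly M p v (K₀ z.1)) z.1
      map_add' := fun v w => by
        ext z; simp only [map_add, Pi.add_apply, polyEval_add]; split_ifs <;> ring
      map_smul' := fun a v => by
        ext z
        simp only [map_smul, Pi.smul_apply, polyEval_smul, smul_eq_mul, RingHom.id_apply]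
        split_ifs <;> ring }
  refine ⟨extendNodal M ∘ₗ E.symm.toLinearMap ∘ₗ R, fun v => ?_⟩
  set n := E.symm (R v) with hn
  have hA : A n = R v := E.apply_symm_apply (R v)
  have hNv : (extendNodal M ∘ₗ E.symm.toLinearMap ∘ₗ R) v = extendNodal M n := rfl
  rw [hNv]
  constructor
  · intro K' hK' z i' b' hz hm'
    have hmid : IsMidSide M z := ⟨K', hK', i', b', hm'⟩
    obtain ⟨hK, hm⟩ := hKb z hmid
    obtain ⟨K₁, hK₁, hv⟩ := id hz
    -- Consistency concerns every side with `z` in its interior, but the system used one chosen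
    -- side; there is no other.
    obtain ⟨e1, e2, e3⟩ := hM.midSide_unique hK₁ hK' hK hv hm' hm
    have h1 := congrFun hA ⟨z, hz⟩
    simp only [A, R, LinearMap.coe_mk, AddHom.coe_mk, hc, hen, if_pos hmid] at h1
    rw [e1, e2, e3, eval_sideTrace_midSide hm, extendNodal_of_isNode n ⟨z, hz⟩]
    linarith
  · intro z hz hnot
    have h1 := congrFun hA ⟨z, hz⟩
    simp only [A, R, LinearMap.coe_mk, AddHom.coe_mk, hc, if_neg hnot, zero_mul, add_zero,
      sub_zero] at h1
    rw [extendNodal_of_isNode n ⟨z, hz⟩, h1]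

end NodalValues

/-! ### Bound of the nodal corrections by a quadratic barrier -/

section NodeBound

variable {M : Finset Rect} {β : Polynomial ℝ} {p : ℕ} {Ω : Set Plane} {C₀ : ℝ}

/-- On the boundary the node would be conforming, and conforming nodes are not hanging. -/
theorem IsMidSide.mem_of_isNode (hM : IsMesh Ω M) (hΩ : IsOpen Ω) (hKM : IsKMesh C₀ Ω M)
    {z : Plane} (hz : IsNode M z) (hm : IsMidSide M z) : z ∈ Ω := by
  obtain ⟨K, hK, hv⟩ := id hz
  have hcl := hM.closure_subset hK (K.vertices_subset_closure hv)
  by_contra h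
  exact IsConformingNode.not_isMidSide hKM hM hΩ
    ⟨hz, Or.inl (by rw [hΩ.frontier_eq]; exact ⟨hcl, h⟩)⟩ hm

/-- A node in the interior of a side has at least the distance of the width of some element at the
node to both ends of the side. -/
theorem exists_width_le (hM : IsMesh Ω M) (hΩ : IsOpen Ω) (hKM : IsKMesh C₀ Ω M) {z : Plane}
    (hz : IsNode M z) {K : Rect} (hK : K ∈ M) {i : Fin 2} {b : Bool} (hm : K.MidSide z i b)
    (b' : Bool) : ∃ K₁ ∈ M, z ∈ closure K₁.carrier ∧
      K₁.width (oth i) ≤ |z (oth i) - K.bd (oth i) b'| := by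
  have hzΩ := IsMidSide.mem_of_isNode hM hΩ hKM hz ⟨K, hK, i, b, hm⟩
  -- The element across the side, on the part towards the end `b'`. It has `z` as a vertex, and by
  -- the whole-side condition its side lies between `z` and that end.
  obtain ⟨K₁, hK₁, hc⟩ := hM.filled_of_mem hΩ hzΩ (fun k => if k = i then b else b')
  have hcK : K.Covers z (fun k => if k = i then !b else b') := hm.covers (by simp)
  have hne : K ≠ K₁ := by
    rintro rfl
    have h1 := hc i
    rw [hm.eq] at h1
    cases b <;> simp at h1
  obtain ⟨ha, -⟩ := hM.adj_of_covers hK hK₁ hne hcK hc (i := i) (by simp) (by simp)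
  simp only [if_true, Bool.not_not] at ha
  have hv : z ∈ K₁.vertices := by
    obtain ⟨K₂, hK₂, hv₂⟩ := id hz
    rcases Rect.trichotomy hc.mem_closure with h | ⟨i', b'', h⟩ | h
    · exact (hM.not_mem_carrier_of_isNode hz hK₁ h).elim
    · exact (hne (hM.midSide_unique hK₂ hK hK₁ hv₂ hm h).1).elim
    · exact h
  refine ⟨K₁, hK₁, hc.mem_closure, ?_⟩
  have hcj := hc (oth i)
  have hvj := hv (oth i)
  have h1 := hm.lo_lt
  have h2 := hm.lt_hi
  simp only [oth_ne, if_false] at hcj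
  rcases hM.whole_side_of_adj hK hK₁ ha with h | h
  · exfalso
    cases b' <;> simp at hcj <;> rcases hvj with hvj | hvj <;> linarith [h.1, h.2, hcj.1, hcj.2]
  · rw [Rect.width]
    cases b'
    · rw [Rect.bd_false, abs_of_pos (by linarith)]
      simp at hcj
      rcases hvj with hvj | hvj <;> linarith [h.1, h.2, hcj.1, hcj.2]
    · rw [Rect.bd_true, abs_of_neg (by linarith)]
      simp at hcj
      rcases hvj with hvj | hvj <;> linarith [h.1, h.2, hcj.1, hcj.2]

variable {V : Rect → MvPolynomial (Fin 2) ℝ} {N : Plane → ℝ} {S : Set Rect} {B w ρ : ℝ}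

/-- The nodal values are close to the values of the elements at the node. -/
theorem abs_nodal_sub_le (hM : IsMesh Ω M) (hΩ : IsBoundedLipschitz Ω) (hKM : IsKMesh C₀ Ω M)
    (hβ : IsCutoff p β) (hp : 1 ≤ p) (hV : ∀ K, V K ∈ Qp p) (hN : IsConsistent M β V N)
    {K₀ : Plane → Rect} (hK₀ : ∀ z, IsNode M z → K₀ z ∈ M ∧ z ∈ closure (K₀ z).carrier)
    (hN₀ : ∀ z, IsNode M z → ¬ IsMidSide M z → N z = polyEval (V (K₀ z)) z)
    (hB : EdgeBound V S B) (hw : WidthBound S w) (hw0 : 0 < w) {z₀ : Plane} (hz₀ : IsNode M z₀)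
    (hS : ∀ z, MeshReach M z₀ z → ∀ K ∈ M, z ∈ closure K.carrier → K ∈ S)
    (hρ : ∀ z, MeshReach M z₀ z → dist z₀ z ≤ ρ) {K : Rect} (hK : K ∈ M)
    (hz₀K : z₀ ∈ closure K.carrier) :
    |N z₀ - polyEval (V K) z₀| ≤
      (1 + 2 * (ρ / w) ^ 2) * (2 * √(264 * (p : ℝ) ^ 2 / w * B ^ 2)) := by
  classical
  set J := 2 * √(264 * (p : ℝ) ^ 2 / w * B ^ 2) with hJ
  have hJ0 : 0 ≤ J := by positivity
  have hjump : ∀ z, MeshReach M z₀ z → ∀ K₁ ∈ M, ∀ K₂ ∈ M, z ∈ closure K₁.carrier →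
      z ∈ closure K₂.carrier → |polyEval (V K₁) z - polyEval (V K₂) z| ≤ J :=
    fun z hz K₁ h1 K₂ h2 hz1 hz2 =>
      hB.abs_jump_le hV hp hw hw0 hM hΩ (hS z hz) h1 h2 hz1 hz2
  -- The reference element at a hanging node is the one with the long side, so that the consistency
  -- equation involves its defect directly; elsewhere it is `K₀ z`, with defect zero.
  have hex : ∀ z, ∃ K, IsNode M z → K ∈ M ∧ z ∈ closure K.carrier ∧
      (IsMidSide M z → ∃ i b, K.MidSide z i b) ∧ (¬ IsMidSide M z → K = K₀ z) := by
    intro z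
    by_cases h : IsMidSide M z
    · obtain ⟨K, hK, i, b, hm⟩ := id h
      exact ⟨K, fun _ => ⟨hK, hm.mem_closure, fun _ => ⟨i, b, hm⟩, fun h' => (h' h).elim⟩⟩
    · exact ⟨K₀ z, fun hz => ⟨(hK₀ z hz).1, (hK₀ z hz).2, fun h' => (h h').elim, fun _ => rfl⟩⟩
  choose ref href using hex
  set d : Plane → ℝ := fun z => N z - polyEval (V (ref z)) z with hd
  set q : Plane → ℝ := fun z => (z 0 - z₀ 0) ^ 2 + (z 1 - z₀ 1) ^ 2 with hq
  have hqi : ∀ i z, q z = (z i - z₀ i) ^ 2 + (z (oth i) - z₀ (oth i)) ^ 2 := by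
    intro i z
    rcases eq_or_eq_oth 0 i with rfl | rfl
    · rfl
    · rw [hq, oth_oth, add_comm]; rfl
  -- At a hanging node `|d|` exceeds the weighted mean of its end values by at most `J`, the cost of
  -- changing reference elements. The mean of the squared distance `q` exceeds `q z` by the product
  -- of the distances to the ends, which is at least `w²`. Thus `J / w² * q` compensates the excess.
  obtain ⟨z, hz, hnot, hmax⟩ := exists_max_not_isMidSide (M := M) (finite_setOf_meshReach hz₀)
    ⟨z₀, .refl⟩ (fun z => |d z| + J / w ^ 2 * q z) (by
      intro z hz hmid
      have hzn := hz.isNode hz₀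
      obtain ⟨hKM', hzK, hmid', -⟩ := href z hzn
      obtain ⟨i, b, hm⟩ := hmid' hmid
      set L := ref z with hL
      have hra : ∀ b', MeshReach M z₀ (L.endPt i b b') := fun b' =>
        hz.tail ⟨L, hKM', i, b, b', hm, rfl⟩
      refine ⟨_, hra false, _, hra true, Rect.endPt_sum_lt hm, _, _, (hm.weight_pos false).le,
        hm.weight_pos true, L.weight_add _ _, ?_⟩
      have hwf := hm.weight_pos false
      have hwt := hm.weight_pos true
      have hsum := L.weight_add (oth i) (z (oth i))
      have hend : ∀ b', |N (L.endPt i b b') - polyEval (V L) (L.endPt i b b')| ≤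
          |d (L.endPt i b b')| + J := by
        intro b'
        obtain ⟨h1, h2, -⟩ := href _ ((hra b').isNode hz₀)
        have := hjump _ (hra b') _ h1 L hKM' h2
          (L.vertices_subset_closure (L.endPt_mem_vertices i b b'))
        have h3 := abs_add_le (d (L.endPt i b b'))
          (polyEval (V (ref (L.endPt i b b'))) (L.endPt i b b') - polyEval (V L) (L.endPt i b b'))
        rw [hd, sub_add_sub_cancel] at h3
        linarith
      have hdz : d z = (L.shape β (oth i) false).eval (z (oth i)) *
          (N (L.endPt i b false) - polyEval (V L) (L.endPt i b false)) +
        (L.shape β (oth i) true).eval (z (oth i)) *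
          (N (L.endPt i b true) - polyEval (V L) (L.endPt i b true)) := by
        have h1 := hN L hKM' z i b hzn hm
        rw [eval_sideTrace_midSide hm] at h1
        simp only [hd]
        rw [← hL, h1]; ring
      have h1 := shape_eval_abs_le hβ hm (N (L.endPt i b false) - polyEval (V L) (L.endPt i b false))
        (N (L.endPt i b true) - polyEval (V L) (L.endPt i b true))
      rw [← hdz] at h1
      have h2 := mul_le_mul_of_nonneg_left (hend false) hwf.le
      have h3 := mul_le_mul_of_nonneg_left (hend true) hwt.le
      -- the quadratic function
      have hdist : ∀ b', w ≤ |z (oth i) - L.bd (oth i) b'| := fun b' => by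
        obtain ⟨K₁, hK₁, hzK₁, hle⟩ := exists_width_le hM hΩ.1 hKM hzn hKM' hm b'
        exact (hw K₁ (hS z hz K₁ hK₁ hzK₁) _).trans hle
      have hf := hdist false
      have ht := hdist true
      rw [Rect.bd_false, abs_of_pos (sub_pos.2 hm.lo_lt)] at hf
      rw [Rect.bd_true, abs_of_neg (sub_neg.2 hm.lt_hi)] at ht
      have hqz : L.weight (oth i) false (z (oth i)) * q (L.endPt i b false) +
          L.weight (oth i) true (z (oth i)) * q (L.endPt i b true) =
          q z + (z (oth i) - L.lo (oth i)) * (L.hi (oth i) - z (oth i)) := by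
        rw [hqi i, hqi i, hqi i, Rect.endPt, Rect.endPt, pt_self, pt_self, pt_oth, pt_oth, ← hm.eq]
        have := (L.width_pos (oth i)).ne'
        simp only [Rect.weight, Bool.false_eq_true, if_false, if_true, Rect.bd_true, Rect.bd_false]
        have e : L.width (oth i) = L.hi (oth i) - L.lo (oth i) := rfl
        field_simp
        rw [e]; ring
      have hww : w ^ 2 ≤ (z (oth i) - L.lo (oth i)) * (L.hi (oth i) - z (oth i)) := by nlinarith
      have hJw : J = J / w ^ 2 * w ^ 2 := by field_simp
      have hJw' : J ≤ J / w ^ 2 * ((z (oth i) - L.lo (oth i)) * (L.hi (oth i) - z (oth i))) := by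
        calc J = J / w ^ 2 * w ^ 2 := hJw
          _ ≤ _ := mul_le_mul_of_nonneg_left hww (by positivity)
      have h5 : J / w ^ 2 * (L.weight (oth i) false (z (oth i)) * q (L.endPt i b false) +
          L.weight (oth i) true (z (oth i)) * q (L.endPt i b true)) = J / w ^ 2 * q z +
          J / w ^ 2 * ((z (oth i) - L.lo (oth i)) * (L.hi (oth i) - z (oth i))) := by
        rw [hqz]; ring
      have h6 : L.weight (oth i) false (z (oth i)) * J + L.weight (oth i) true (z (oth i)) * J = J := by
        rw [← add_mul, hsum, one_mul]
      nlinarith)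
  have hzn := MeshReach.isNode hz hz₀
  have hd0 : d z = 0 := by
    obtain ⟨-, -, -, h⟩ := href z hzn
    have e : d z = N z - polyEval (V (ref z)) z := rfl
    rw [e, h hnot, hN₀ z hzn hnot, sub_self]
  have hle := hmax z₀ .refl
  have hq0 : q z₀ = 0 := by simp [hq]
  have hqz : q z ≤ 2 * ρ ^ 2 := by
    have h1 : ∀ k, |z k - z₀ k| ≤ ρ := fun k =>
      (abs_coord_sub_le_dist z z₀ k).trans (by rw [dist_comm]; exact hρ z hz)
    have h2 := pow_le_pow_left₀ (abs_nonneg _) (h1 0) 2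
    have h3 := pow_le_pow_left₀ (abs_nonneg _) (h1 1) 2
    rw [sq_abs] at h2 h3
    have e : q z = (z 0 - z₀ 0) ^ 2 + (z 1 - z₀ 1) ^ 2 := rfl
    linarith
  simp only [hd0, hq0, abs_zero, mul_zero, add_zero, zero_add] at hle
  have h1 : J / w ^ 2 * q z ≤ J / w ^ 2 * (2 * ρ ^ 2) := by gcongr
  have h2 : J / w ^ 2 * (2 * ρ ^ 2) = 2 * (ρ / w) ^ 2 * J := by field_simp
  -- One further jump passes from the reference element at `z₀` to `K`.
  obtain ⟨h3, h4, -⟩ := href z₀ hz₀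
  have h5 := hjump z₀ .refl _ h3 K hK h4 hz₀K
  have h6 := abs_add_le (d z₀) (polyEval (V (ref z₀)) z₀ - polyEval (V K) z₀)
  rw [hd, sub_add_sub_cancel] at h6
  simp only [hd] at hle
  linarith

end NodeBound

/-! ### Integrals over rectangles -/

theorem continuous_pt (i : Fin 2) : Continuous fun a : ℝ × ℝ => pt i a.1 a.2 := by
  refine (PiLp.continuous_toLp 2 _).comp (continuous_pi fun k => ?_)
  by_cases h : k = i <;> simp [h] <;> fun_prop

theorem measurableEmbedding_pt (i : Fin 2) :
    MeasurableEmbedding fun a : ℝ × ℝ => pt i a.1 a.2 := by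
  refine (continuous_pt i).measurableEmbedding fun a b h => ?_
  have h1 := congrArg (fun x : Plane => x i) h
  have h2 := congrArg (fun x : Plane => x (oth i)) h
  simp only [pt_self, pt_oth] at h1 h2
  exact Prod.ext h1 h2

theorem measurePreserving_pt (i : Fin 2) :
    MeasurePreserving (fun a : ℝ × ℝ => pt i a.1 a.2) volume volume := by
  have h0 : MeasurePreserving (fun a : ℝ × ℝ => pt 0 a.1 a.2) volume volume := by
    have h1 := (volume_preserving_finTwoArrow ℝ).symm
    have h2 := PiLp.volume_preserving_toLp (Fin 2)
    have h3 := h2.comp h1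
    have e : (fun a : ℝ × ℝ => pt 0 a.1 a.2) =
        WithLp.toLp 2 ∘ MeasurableEquiv.finTwoArrow.symm := by
      funext a
      ext k
      fin_cases k <;> rfl
    rw [e]
    exact h3
  rcases eq_or_eq_oth 0 i with rfl | rfl
  · exact h0
  · have h4 := h0.comp (Measure.measurePreserving_swap (μ := (volume : Measure ℝ))
      (ν := (volume : Measure ℝ)))
    have e : (fun a : ℝ × ℝ => pt (oth 0) a.1 a.2) =
        (fun a : ℝ × ℝ => pt 0 a.1 a.2) ∘ Prod.swap := by
      funext a
      exact pt_oth_comm 0 a.2 a.1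
    rw [e]
    exact h4

theorem Rect.preimage_pt_carrier (K : Rect) (i : Fin 2) :
    (fun a : ℝ × ℝ => pt i a.1 a.2) ⁻¹' K.carrier =
      Ioo (K.lo i) (K.hi i) ×ˢ Ioo (K.lo (oth i)) (K.hi (oth i)) := by
  ext a
  simp only [mem_preimage, Rect.carrier, mem_ofPred_eq, forall_coord i, pt_self, pt_oth, mem_prod,
    mem_Ioo]

theorem integrableOn_of_continuous {F : Plane → ℝ} (hF : Continuous F) (K : Rect) :
    IntegrableOn F K.carrier :=
  (hF.continuousOn.integrableOn_compact K.isBounded_carrier.isCompact_closure).mono_set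
    subset_closure

theorem Rect.setIntegral_eq (K : Rect) (i : Fin 2) {F : Plane → ℝ} (hF : Continuous F) :
    ∫ x in K.carrier, F x =
      ∫ a in K.lo i..K.hi i, ∫ c in K.lo (oth i)..K.hi (oth i), F (pt i a c) := by
  rw [← (measurePreserving_pt i).setIntegral_preimage_emb (measurableEmbedding_pt i),
    K.preimage_pt_carrier i, Measure.volume_eq_prod, setIntegral_prod]
  · rw [intervalIntegral.integral_of_le (K.lo_lt_hi i).le, integral_Ioc_eq_integral_Ioo]
    congr 1; ext a
    rw [intervalIntegral.integral_of_le (K.lo_lt_hi _).le, integral_Ioc_eq_integral_Ioo]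
  · have h1 : IntegrableOn (fun a : ℝ × ℝ => F (pt i a.1 a.2))
        (Icc (K.lo i) (K.hi i) ×ˢ Icc (K.lo (oth i)) (K.hi (oth i))) (volume.prod volume) :=
      (hF.comp (continuous_pt i)).continuousOn.integrableOn_compact
        (isCompact_Icc.prod isCompact_Icc)
    exact h1.mono_set (prod_mono Ioo_subset_Icc_self Ioo_subset_Icc_self)

theorem Rect.setIntegral_mul (K : Rect) (i : Fin 2) (f g : ℝ → ℝ) :
    ∫ x in K.carrier, f (x i) * g (x (oth i)) =
      (∫ a in K.lo i..K.hi i, f a) * ∫ c in K.lo (oth i)..K.hi (oth i), g c := by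
  rw [← (measurePreserving_pt i).setIntegral_preimage_emb (measurableEmbedding_pt i),
    K.preimage_pt_carrier i, Measure.volume_eq_prod]
  simp only [pt_self, pt_oth]
  rw [setIntegral_prod_mul, intervalIntegral.integral_of_le (K.lo_lt_hi i).le,
    integral_Ioc_eq_integral_Ioo, intervalIntegral.integral_of_le (K.lo_lt_hi _).le,
    integral_Ioc_eq_integral_Ioo]

theorem lineTrace_pderiv (i : Fin 2) (c : ℝ) (q : MvPolynomial (Fin 2) ℝ) :
    lineTrace i c (MvPolynomial.pderiv (oth i) q) = Polynomial.derivative (lineTrace i c q) := by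
  induction q using MvPolynomial.induction_on with
  | C a => simp [lineTrace]
  | add q r hq hr => simp [hq, hr]
  | mul_X q k hq =>
    rw [Derivation.leibniz, map_add, smul_eq_mul, smul_eq_mul, map_mul, map_mul, hq, map_mul,
      Polynomial.derivative_mul, MvPolynomial.pderiv_X]
    rcases eq_or_eq_oth i k with rfl | rfl
    · simp [lineTrace]; ring
    · simp [lineTrace]; ring

/-- The inverse inequality for partial derivatives on rectangles. -/
theorem Rect.integral_pderiv_sq_le (K : Rect) {p : ℕ} (hp : 1 ≤ p) {q : MvPolynomial (Fin 2) ℝ}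
    (hq : q ∈ Qp p) (k : Fin 2) :
    ∫ x in K.carrier, polyEval (MvPolynomial.pderiv k q) x ^ 2 ≤
      8448 * (p : ℝ) ^ 4 / K.width k ^ 2 * ∫ x in K.carrier, polyEval q x ^ 2 := by
  obtain ⟨i, rfl⟩ : ∃ i, k = oth i := ⟨oth k, (oth_oth k).symm⟩
  have hs := fun r : MvPolynomial (Fin 2) ℝ =>
    K.setIntegral_eq i (F := fun x => polyEval r x ^ 2) ((continuous_polyEval r).pow 2)
  rw [hs, hs, ← intervalIntegral.integral_const_mul]
  have hc : ∀ r : MvPolynomial (Fin 2) ℝ, Continuous fun a =>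
      ∫ c in K.lo (oth i)..K.hi (oth i), polyEval r (pt i a c) ^ 2 := fun r =>
    intervalIntegral.continuous_parametric_intervalIntegral_of_continuous'
      (f := fun a c => polyEval r (pt i a c) ^ 2)
      (by exact ((continuous_polyEval r).comp (continuous_pt i)).pow 2) _ _
  refine intervalIntegral.integral_mono_on (K.lo_lt_hi i).le ((hc _).intervalIntegrable _ _)
    (((hc _).intervalIntegrable _ _).const_mul _) fun a _ => ?_
  have h := UnitIntervalPoly.integral_derivative_sq_le hp (natDegree_lineTrace_le hq i a)
    (K.lo_lt_hi (oth i))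
  rw [← lineTrace_pderiv] at h
  simpa only [Polynomial.eval_pow, eval_lineTrace, Rect.width] using h

/-! ### The `L²` norm of the blending -/

section Blending

variable {M : Finset Rect} {β : Polynomial ℝ} {p : ℕ} {Ω : Set Plane}
  {V : Rect → MvPolynomial (Fin 2) ℝ} {N : Plane → ℝ} {S : Set Rect} {B D W : ℝ}

theorem integral_sq_le_integral_sq {f : Polynomial ℝ} {a b a' b' : ℝ} (h1 : a' ≤ a) (h3 : b ≤ b') : ∫ t in a..b, (f ^ 2).eval t ≤ ∫ t in a'..b', (f ^ 2).eval t := by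
  rw [← intervalIntegral.integral_add_adjacent_intervals
    (UnitIntervalPoly.intervalIntegrable_eval (f ^ 2) a' a)
    (UnitIntervalPoly.intervalIntegrable_eval (f ^ 2) a b'),
    ← intervalIntegral.integral_add_adjacent_intervals
    (UnitIntervalPoly.intervalIntegrable_eval (f ^ 2) a b)
    (UnitIntervalPoly.intervalIntegrable_eval (f ^ 2) b b')]
  linarith [UnitIntervalPoly.integral_sq_nonneg f h1, UnitIntervalPoly.integral_sq_nonneg f h3]

theorem integral_add_sq_le (f g h : Polynomial ℝ) {a b : ℝ} (hab : a ≤ b) :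
    ∫ t in a..b, ((f + (g + h)) ^ 2).eval t ≤ 3 * ((∫ t in a..b, (f ^ 2).eval t) +
      ((∫ t in a..b, (g ^ 2).eval t) + ∫ t in a..b, (h ^ 2).eval t)) := by
  have hi := fun f : Polynomial ℝ => UnitIntervalPoly.intervalIntegrable_eval f a b
  rw [← intervalIntegral.integral_add (hi _) (hi _), ← intervalIntegral.integral_add (hi _)
    ((hi _).add (hi _)), ← intervalIntegral.integral_const_mul]
  refine intervalIntegral.integral_mono_on hab (hi _)
    (((hi _).add ((hi _).add (hi _))).const_mul _) fun t _ => ?_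
  simp only [Polynomial.eval_pow, Polynomial.eval_add]
  nlinarith [sq_nonneg (f.eval t - g.eval t), sq_nonneg (f.eval t - h.eval t),
    sq_nonneg (g.eval t - h.eval t)]

theorem integral_C_mul_shape_sq_le (hβ : IsCutoff p β) {K K' : Rect} {j : Fin 2} (b : Bool)
    (h1 : K'.lo j ≤ K.lo j) (h2 : K.hi j ≤ K'.hi j) (hW : K'.width j ≤ W) {δ : ℝ} (hδ : |δ| ≤ D) :
    ∫ t in K.lo j..K.hi j, ((Polynomial.C δ * K'.shape β j b) ^ 2).eval t ≤ D ^ 2 * (2 / (p : ℝ) ^ 2 * W) := by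
  refine (integral_sq_le_integral_sq h1 h2).trans ?_
  have e : ∀ t, ((Polynomial.C δ * K'.shape β j b) ^ 2).eval t = δ ^ 2 * (K'.shape β j b ^ 2).eval t := by
    intro t; simp [mul_pow]
  simp only [e]
  rw [intervalIntegral.integral_const_mul]
  have h3 := hβ.integral_shape_sq_le K' j b
  have h4 := UnitIntervalPoly.integral_sq_nonneg (K'.shape β j b) (K'.lo_lt_hi j).le
  have h5 : δ ^ 2 ≤ D ^ 2 := sq_le_sq' (abs_le.1 hδ).1 (abs_le.1 hδ).2
  have h6 : 2 / (p : ℝ) ^ 2 * K'.width j ≤ 2 / (p : ℝ) ^ 2 * W :=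
    mul_le_mul_of_nonneg_left hW (by positivity)
  exact mul_le_mul h5 (h3.trans h6) h4 (sq_nonneg _)

/-- On an owned side the defect is the jump to the owner plus two cutoff terms. On any other side
only the cutoff terms remain. -/
theorem integral_traceDefect_sq_le (hM : IsMesh Ω M) (hβ : IsCutoff p β)
    {K : Rect} {i : Fin 2} {b : Bool}
    (hKS : K ∈ S) (hB : EdgeBound V S B)
    (hW : K.width (oth i) ≤ W)
    (hD : ∀ b', |N (K.endPt i b b') - polyEval (V K) (K.endPt i b b')| ≤ D)
    (hO : ∀ K', OwnedBy M K K' i b → K' ∈ S ∧ K'.width (oth i) ≤ W ∧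
      ∀ b', |N (K'.endPt i (!b) b') - polyEval (V K') (K'.endPt i (!b) b')| ≤ D) :
    ∫ t in K.lo (oth i)..K.hi (oth i), (traceDefect M β V N K i b ^ 2).eval t ≤
      3 * (B ^ 2 + 2 * (D ^ 2 * (2 / (p : ℝ) ^ 2 * W))) := by
  by_cases hex : ∃ K', OwnedBy M K K' i b
  · obtain ⟨K', h⟩ := hex
    obtain ⟨hS, hW', hD'⟩ := hO K' h
    have e : traceDefect M β V N K i b = (lineTrace i (K'.bd i (!b)) (V K') -
        lineTrace i (K.bd i b) (V K)) + (Polynomial.C (N (K'.endPt i (!b) false) -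
          polyEval (V K') (K'.endPt i (!b) false)) * K'.shape β (oth i) false +
        Polynomial.C (N (K'.endPt i (!b) true) - polyEval (V K') (K'.endPt i (!b) true)) *
          K'.shape β (oth i) true) := by
      rw [traceDefect, h.ownerTrace_eq hM, sideTrace]; ring
    rw [e]
    refine (integral_add_sq_le _ _ _ (K.lo_lt_hi _).le).trans ?_
    have h1 := integral_C_mul_shape_sq_le hβ false h.lo_le h.le_hi hW' (hD' false)
    have h2 := integral_C_mul_shape_sq_le hβ true h.lo_le h.le_hi hW' (hD' true)
    have h3 := hB K hKS K' hS i b h.adj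
    rw [Rect.commonLo, Rect.commonHi, max_eq_left h.lo_le, min_eq_left h.le_hi] at h3
    have h4 : ∀ t, ((lineTrace i (K'.bd i (!b)) (V K') - lineTrace i (K.bd i b) (V K)) ^ 2).eval t =
        polyEval (V K - V K') (pt i (K.bd i b) t) ^ 2 := by
      intro t
      rw [Polynomial.eval_pow, Polynomial.eval_sub, eval_lineTrace, eval_lineTrace, ← h.adj.eq,
        polyEval_sub]
      ring
    simp only [← h4] at h3
    linarith
  · have e : traceDefect M β V N K i b = 0 + (Polynomial.C (N (K.endPt i b false) -
          polyEval (V K) (K.endPt i b false)) * K.shape β (oth i) false +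
        Polynomial.C (N (K.endPt i b true) - polyEval (V K) (K.endPt i b true)) *
          K.shape β (oth i) true) := by
      rw [traceDefect, ownerTrace_eq_of_not hex, sideTrace]; ring
    rw [e]
    refine (integral_add_sq_le _ _ _ (K.lo_lt_hi _).le).trans ?_
    have h1 := integral_C_mul_shape_sq_le hβ (K := K) false le_rfl le_rfl hW (hD false)
    have h2 := integral_C_mul_shape_sq_le hβ (K := K) true le_rfl le_rfl hW (hD true)
    have h3 : ∫ t in K.lo (oth i)..K.hi (oth i), ((0 : Polynomial ℝ) ^ 2).eval t = 0 := by simp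
    rw [h3]
    nlinarith [sq_nonneg B]

theorem integral_lift_sq_le (K : Rect) (i : Fin 2) (f g : Polynomial ℝ) {a c : ℝ}
    (ha : ∫ t in K.lo i..K.hi i, (f ^ 2).eval t ≤ a)
    (hc : ∫ t in K.lo (oth i)..K.hi (oth i), (g ^ 2).eval t ≤ c) :
    ∫ x in K.carrier, polyEval (inCoord i f * inCoord (oth i) g) x ^ 2 ≤ a * c := by
  simp only [polyEval_mul, polyEval_inCoord, mul_pow]
  rw [K.setIntegral_mul i (fun t => f.eval t ^ 2) (fun t => g.eval t ^ 2)]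
  simp only [Polynomial.eval_pow] at ha hc
  exact mul_le_mul ha hc
    (intervalIntegral.integral_nonneg (K.lo_lt_hi _).le fun _ _ => sq_nonneg _)
    ((intervalIntegral.integral_nonneg (K.lo_lt_hi _).le fun _ _ => sq_nonneg _).trans ha)

theorem Rect.integral_sq_add_le (K : Rect) (q r : MvPolynomial (Fin 2) ℝ) {a c : ℝ}
    (ha : ∫ x in K.carrier, polyEval q x ^ 2 ≤ a) (hc : ∫ x in K.carrier, polyEval r x ^ 2 ≤ c) :
    ∫ x in K.carrier, polyEval (q + r) x ^ 2 ≤ 2 * (a + c) := by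
  have hi : ∀ q, IntegrableOn (fun x => polyEval q x ^ 2) K.carrier := fun q =>
    integrableOn_of_continuous ((continuous_polyEval q).pow 2) K
  calc ∫ x in K.carrier, polyEval (q + r) x ^ 2
      ≤ ∫ x in K.carrier, 2 * (polyEval q x ^ 2 + polyEval r x ^ 2) := by
        refine integral_mono (hi _) (((hi q).add (hi r)).const_mul 2) fun x => ?_
        simp only [polyEval_add]
        nlinarith [sq_nonneg (polyEval q x - polyEval r x)]
    _ = 2 * ((∫ x in K.carrier, polyEval q x ^ 2) + ∫ x in K.carrier, polyEval r x ^ 2) := by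
        rw [integral_const_mul, integral_add (hi q) (hi r)]
    _ ≤ _ := by linarith

/-- Every summand is a product of functions of one coordinate, so its squared norm factors into that
of a cutoff and that of a defect or of a second cutoff. The numerical factors come from repeated use
of `(a + b)² ≤ 2 (a² + b²)` over the eight summands. -/
theorem integral_blending_sq_le (hM : IsMesh Ω M) (hβ : IsCutoff p β)
    {K : Rect} (hKS : K ∈ S) (hB : EdgeBound V S B) (hW : ∀ i, K.width i ≤ W)
    (hD : ∀ i b b', |N (K.endPt i b b') - polyEval (V K) (K.endPt i b b')| ≤ D)
    (hO : ∀ i b K', OwnedBy M K K' i b → K' ∈ S ∧ (∀ k, K'.width k ≤ W) ∧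
      ∀ b' b'', |N (K'.endPt i b' b'') - polyEval (V K') (K'.endPt i b' b'')| ≤ D) :
    ∫ x in K.carrier, polyEval (blending M β V N K) x ^ 2 ≤
      (2 / (p : ℝ) ^ 2 * W) * (96 * (B ^ 2 + 2 * (D ^ 2 * (2 / (p : ℝ) ^ 2 * W)))) +
      32 * (D ^ 2 * (2 / (p : ℝ) ^ 2 * W) ^ 2) := by
  set s := 2 / (p : ℝ) ^ 2 * W with hs
  set G := 3 * (B ^ 2 + 2 * (D ^ 2 * s)) with hG
  have hshape : ∀ i b, ∫ t in K.lo i..K.hi i, (K.shape β i b ^ 2).eval t ≤ s := fun i b =>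
    (hβ.integral_shape_sq_le K i b).trans (mul_le_mul_of_nonneg_left (hW i) (by positivity))
  have hdef : ∀ i b, ∫ t in K.lo (oth i)..K.hi (oth i), (traceDefect M β V N K i b ^ 2).eval t ≤ G :=
    fun i b => integral_traceDefect_sq_le hM hβ hKS hB (hW _) (hD i b) fun K' h =>
      ⟨(hO i b K' h).1, (hO i b K' h).2.1 _, (hO i b K' h).2.2 _⟩
  have hsides : ∀ i, ∫ x in K.carrier, polyEval (liftSides M β V N K i) x ^ 2 ≤
      2 * (s * G + s * G) := fun i =>
    K.integral_sq_add_le _ _ (integral_lift_sq_le K i _ _ (hshape i false) (hdef i false))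
      (integral_lift_sq_le K i _ _ (hshape i true) (hdef i true))
  have hvert : ∀ b b', ∫ x in K.carrier, polyEval (-liftVertex β V N K b b') x ^ 2 ≤
      D ^ 2 * s ^ 2 := by
    intro b b'
    simp only [liftVertex, polyEval_neg, neg_sq, polyEval_smul, mul_pow]
    rw [integral_const_mul]
    have h1 := integral_lift_sq_le K 0 _ _ (hshape 0 b) (hshape (oth 0) b')
    have h2 := hD 0 b b'
    rw [sq s]
    exact mul_le_mul (sq_le_sq' (abs_le.1 h2).1 (abs_le.1 h2).2) h1
      (setIntegral_nonneg K.isOpen_carrier.measurableSet fun _ _ => sq_nonneg _) (sq_nonneg _)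
  have e : blending M β V N K = (liftSides M β V N K 0 + liftSides M β V N K 1) +
      ((-liftVertex β V N K false false + -liftVertex β V N K false true) +
        (-liftVertex β V N K true false + -liftVertex β V N K true true)) := by
    rw [blending]; ring
  rw [e]
  refine (K.integral_sq_add_le _ _ (K.integral_sq_add_le _ _ (hsides 0) (hsides 1))
    (K.integral_sq_add_le _ _ (K.integral_sq_add_le _ _ (hvert _ _) (hvert _ _))
      (K.integral_sq_add_le _ _ (hvert _ _) (hvert _ _)))).trans (le_of_eq ?_)
  rw [hG]; ring

end Blending

/-! ### Piecewise smooth functions -/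

theorem MeasureTheory.integral_eq_zero_of_hasDerivAt_off_countable {f f' : ℝ → ℝ}
    (hf : Continuous f) (hc : HasCompactSupport f) {s : Set ℝ} (hs : s.Countable)
    (hd : ∀ t, t ∉ s → HasDerivAt f (f' t) t) (hi : Integrable f') : ∫ t, f' t = 0 := by
  have h1 := intervalIntegral_tendsto_integral hi tendsto_neg_atTop_atBot tendsto_id
  obtain ⟨R, hR⟩ := hc.isCompact.isBounded.subset_closedBall 0
  have hz : ∀ t : ℝ, R < |t| → f t = 0 := fun t ht => by
    by_contra h
    have := hR (subset_tsupport f h)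
    rw [mem_closedBall_zero_iff, Real.norm_eq_abs] at this
    linarith
  refine tendsto_nhds_unique h1 ((tendsto_const_nhds (x := (0 : ℝ))).congr' ?_)
  filter_upwards [eventually_gt_atTop (max R 0)] with r hr
  have h0 : 0 < r := (le_max_right _ _).trans_lt hr
  have hr' : R < |r| := by rw [abs_of_pos h0]; exact (le_max_left _ _).trans_lt hr
  rw [id, integral_eq_of_hasDerivAt_off_countable f f' hs hf.continuousOn
    (fun t ht => hd t ht.2) hi.intervalIntegrable, hz r hr', hz (-r) (by rwa [abs_neg]), sub_zero]

/-- The integral of a partial derivative, which exists off countably many grid lines, of a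
continuous compactly supported function vanishes. -/
theorem integral_partialDeriv_eq_zero {G D : Plane → ℝ} (i : Fin 2) (hG : Continuous G)
    (hc : HasCompactSupport G) (hD : Integrable D) {s : Set ℝ} (hs : s.Countable)
    (hd : ∀ x : Plane, (∀ k, x k ∉ s) → HasDerivAt (fun t => G (pt i t (x (oth i)))) (D x) (x i)) :
    ∫ x, D x = 0 := by
  have hmp := measurePreserving_pt i
  have hi : Integrable (fun a : ℝ × ℝ => D (pt i a.1 a.2)) (volume.prod volume) :=
    hmp.integrable_comp_of_integrable hD
  rw [← hmp.integral_comp (measurableEmbedding_pt i), Measure.volume_eq_prod,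
    integral_prod_symm _ hi]
  refine integral_eq_zero_of_ae ?_
  filter_upwards [hi.prod_left_ae, hs.ae_notMem volume] with c hc1 hc2
  have hcont : Continuous fun t : ℝ => pt i t c :=
    (continuous_pt i).comp (continuous_id.prodMk continuous_const)
  refine integral_eq_zero_of_hasDerivAt_off_countable (f := fun t => G (pt i t c))
    (hG.comp hcont) ?_ hs (fun t ht => ?_) hc1
  · obtain ⟨R, hR⟩ := hc.isCompact.isBounded.subset_closedBall 0
    refine HasCompactSupport.of_support_subset_isCompact (isCompact_closedBall (0 : ℝ) R)
      fun t ht => ?_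
    have h1 := hR (subset_tsupport G ht)
    rw [mem_closedBall_zero_iff, Real.norm_eq_abs]
    rw [Metric.mem_closedBall] at h1
    have h2 := abs_coord_sub_le_dist (pt i t c) 0 i
    simp only [pt_self, PiLp.zero_apply, sub_zero] at h2
    exact h2.trans h1
  · have := hd (pt i t c) ((forall_coord i).2 ⟨by simpa using ht, by simpa using hc2⟩)
    simpa using this

theorem hasDerivAt_polyEval_line (q : MvPolynomial (Fin 2) ℝ) (i : Fin 2) (x : Plane) :
    HasDerivAt (fun t => polyEval q (pt i t (x (oth i)))) (polyEval (MvPolynomial.pderiv i q) x)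
      (x i) := by
  obtain ⟨j, rfl⟩ : ∃ j, i = oth j := ⟨oth i, (oth_oth i).symm⟩
  have h := (lineTrace j (x j) q).hasDerivAt (x (oth j))
  rw [← lineTrace_pderiv, eval_lineTrace, pt_eta] at h
  simpa only [eval_lineTrace, oth_oth, pt_oth_comm] using h

theorem hasDerivAt_line {φ : Plane → ℝ} (hφ : Differentiable ℝ φ) (i : Fin 2) (x : Plane) :
    HasDerivAt (fun t => φ (pt i t (x (oth i)))) (partialDeriv i φ x) (x i) := by
  have h1 : HasDerivAt (fun t : ℝ => pt i t (x (oth i))) (EuclideanSpace.single i (1 : ℝ)) (x i) := by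
    have e : (fun t : ℝ => pt i t (x (oth i))) =
        fun t => pt i 0 (x (oth i)) + t • EuclideanSpace.single i (1 : ℝ) := by
      funext t
      exact plane_ext i (by simp) (by simp)
    rw [e]
    simpa using ((hasDerivAt_id (x i)).smul_const (EuclideanSpace.single i (1 : ℝ))).const_add
      (pt i 0 (x (oth i)))
  have h2 : HasFDerivAt φ (fderiv ℝ φ x) (pt i (x i) (x (oth i))) := by
    rw [pt_eta]; exact (hφ x).hasFDerivAt
  exact h2.comp_hasDerivAt (x i) h1

theorem eventually_line {x : Plane} {i : Fin 2} {P : Plane → Prop} (h : ∀ᶠ y in 𝓝 x, P y) :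
    ∀ᶠ t in 𝓝 (x i), P (pt i t (x (oth i))) := by
  have hcont : Continuous fun t : ℝ => pt i t (x (oth i)) :=
    (continuous_pt i).comp (continuous_id.prodMk continuous_const)
  have := hcont.tendsto (x i)
  rw [pt_eta] at this
  exact this.eventually h

/-! ### Gluing elementwise polynomials; the weak gradient -/

section Glue

/-- Elementwise polynomials which agree on common points of the closed elements. -/
def Agrees (M : Finset Rect) (P : Rect → MvPolynomial (Fin 2) ℝ) : Prop :=
  ∀ K ∈ M, ∀ K' ∈ M, ∀ x ∈ closure K.carrier, x ∈ closure K'.carrier →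
    polyEval (P K) x = polyEval (P K') x

variable {M : Finset Rect} {P : Rect → MvPolynomial (Fin 2) ℝ} {Ω : Set Plane}

open Classical in
/-- The function on the region of `M` given by elementwise polynomials, extended by zero. -/
def glue (M : Finset Rect) (P : Rect → MvPolynomial (Fin 2) ℝ) (x : Plane) : ℝ :=
  if h : ∃ K ∈ M, x ∈ closure K.carrier then polyEval (P h.choose) x else 0

/-- The elementwise partial derivative. -/
def brokenPartial (M : Finset Rect) (P : Rect → MvPolynomial (Fin 2) ℝ) (i : Fin 2) (x : Plane) : ℝ :=
  ∑ K ∈ M, K.carrier.indicator (polyEval (MvPolynomial.pderiv i (P K))) x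

/-- The coordinates of the grid lines. -/
def gridCoords (M : Finset Rect) : Set ℝ := ⋃ K ∈ M, ⋃ k, {K.lo k, K.hi k}

theorem countable_gridCoords (M : Finset Rect) : (gridCoords M).Countable :=
  M.countable_toSet.biUnion fun _ _ => countable_iUnion fun _ => (toFinite _).countable

theorem glue_eq (hP : Agrees M P) {K : Rect} (hK : K ∈ M) {x : Plane}
    (hx : x ∈ closure K.carrier) : glue M P x = polyEval (P K) x := by
  have h : ∃ K ∈ M, x ∈ closure K.carrier := ⟨K, hK, hx⟩
  rw [glue, dif_pos h]
  exact hP _ h.choose_spec.1 K hK x h.choose_spec.2 hx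

theorem glue_eq_zero {x : Plane} (hx : x ∉ region M) : glue M P x = 0 := by
  rw [glue, dif_neg]
  rwa [← mem_region]

theorem continuousOn_glue (hP : Agrees M P) : ContinuousOn (glue M P) (region M) := by
  have e : region M = ⋃ K : {K // K ∈ M}, closure K.1.carrier := by
    ext x; simp [mem_region]
  rw [e]
  refine (locallyFinite_of_finite _).continuousOn_iUnion (fun _ => isClosed_closure) fun K => ?_
  exact (continuous_polyEval (P K.1)).continuousOn.congr fun x hx => glue_eq hP K.2 hx

theorem mem_carrier_of_notMem_gridCoords {x : Plane} (hx : ∀ k, x k ∉ gridCoords M) {K : Rect}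
    (hK : K ∈ M) (h : x ∈ closure K.carrier) : x ∈ K.carrier := by
  rw [Rect.mem_closure] at h
  intro k
  have h1 : ∀ t ∈ ({K.lo k, K.hi k} : Set ℝ), t ∈ gridCoords M := fun t ht =>
    mem_iUnion₂.2 ⟨K, hK, mem_iUnion.2 ⟨k, ht⟩⟩
  exact ⟨lt_of_le_of_ne (h k).1 fun e => hx k (e ▸ h1 _ (by simp)),
    lt_of_le_of_ne (h k).2 fun e => hx k (e ▸ h1 _ (by simp))⟩

theorem brokenPartial_eq (hM : IsMesh Ω M) {K : Rect} (hK : K ∈ M) {x : Plane} (hx : x ∈ K.carrier)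
    (i : Fin 2) : brokenPartial M P i x = polyEval (MvPolynomial.pderiv i (P K)) x := by
  rw [brokenPartial, Finset.sum_eq_single K, indicator_of_mem hx]
  · exact fun K' hK' hne => indicator_of_notMem (fun h =>
      hne (hM.eq_of_mem_carrier_of_mem_closure hK' hK h (subset_closure hx))) _
  · exact fun h => (h hK).elim

theorem brokenPartial_eq_zero {x : Plane} (hx : x ∉ region M) (i : Fin 2) :
    brokenPartial M P i x = 0 :=
  Finset.sum_eq_zero fun K hK => indicator_of_notMem
    (fun h => hx (mem_region.2 ⟨K, hK, subset_closure h⟩)) _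

theorem hasDerivAt_glue (hM : IsMesh Ω M) (hP : Agrees M P) {x : Plane}
    (hx : ∀ k, x k ∉ gridCoords M) (i : Fin 2) :
    HasDerivAt (fun t => glue M P (pt i t (x (oth i)))) (brokenPartial M P i x) (x i) := by
  by_cases h : x ∈ region M
  · obtain ⟨K, hK, hxK⟩ := mem_region.1 h
    have hxK' := mem_carrier_of_notMem_gridCoords hx hK hxK
    rw [brokenPartial_eq hM hK hxK']
    refine (hasDerivAt_polyEval_line (P K) i x).congr_of_eventuallyEq ?_
    refine eventually_line (P := fun y => glue M P y = polyEval (P K) y) ?_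
    filter_upwards [K.isOpen_carrier.mem_nhds hxK'] with y hy
    exact glue_eq hP hK (subset_closure hy)
  · rw [brokenPartial_eq_zero h]
    refine (hasDerivAt_const (x i) (0 : ℝ)).congr_of_eventuallyEq ?_
    refine eventually_line (P := fun y => glue M P y = 0) ?_
    filter_upwards [(isClosed_region M).isOpen_compl.mem_nhds h] with y hy
    exact glue_eq_zero hy

theorem ae_notMem_gridCoords (M : Finset Rect) : ∀ᵐ x : Plane, ∀ k, x k ∉ gridCoords M := by
  rw [ae_all_iff]
  intro k
  have h1 : ∀ᵐ a : ℝ × ℝ ∂(volume.prod volume), a.1 ∉ gridCoords M :=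
    Measure.quasiMeasurePreserving_fst.ae ((countable_gridCoords M).ae_notMem volume)
  have h2 := (measurePreserving_pt k).map_eq
  rw [← h2]
  refine ((measurableEmbedding_pt k).ae_map_iff).2 ?_
  rw [Measure.volume_eq_prod]
  filter_upwards [h1] with a ha
  simpa using ha

theorem memLp_indicator_polyEval (K : Rect) (q : MvPolynomial (Fin 2) ℝ) (r : ℝ≥0∞) :
    MemLp (K.carrier.indicator (polyEval q)) r := by
  rw [memLp_indicator_iff_restrict K.isOpen_carrier.measurableSet]
  have hf : IsFiniteMeasure (volume.restrict K.carrier) :=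
    ⟨by rw [Measure.restrict_apply_univ]; exact K.isBounded_carrier.measure_lt_top⟩
  obtain ⟨C, hC⟩ := K.isBounded_carrier.isCompact_closure.exists_bound_of_continuousOn
    (continuous_polyEval q).continuousOn
  refine MemLp.of_bound (continuous_polyEval q).aestronglyMeasurable C ?_
  filter_upwards [ae_restrict_mem K.isOpen_carrier.measurableSet] with x hx
  exact hC x (subset_closure hx)

theorem memLp_brokenPartial (i : Fin 2) (r : ℝ≥0∞) : MemLp (brokenPartial M P i) r := by
  have := memLp_finsetSum M (f := fun K => K.carrier.indicator
    (polyEval (MvPolynomial.pderiv i (P K)))) (p := r) (μ := (volume : Measure Plane))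
    fun K _ => memLp_indicator_polyEval K _ r
  exact this

theorem toFunction_eq_glue (hM : IsMesh Ω M) {p : ℕ} (v : BrokenPoly M p)
    (hv : ∀ K : {K // K ∈ M}, (v K : MvPolynomial (Fin 2) ℝ) = P K.1) (hP : Agrees M P) {x : Plane}
    (hx : ∀ k, x k ∉ gridCoords M) : v.toFunction x = glue M P x := by
  rw [BrokenPoly.toFunction]
  by_cases h : x ∈ region M
  · obtain ⟨K, hK, hxK⟩ := mem_region.1 h
    have hxK' := mem_carrier_of_notMem_gridCoords hx hK hxK
    rw [Finset.sum_eq_single ⟨K, hK⟩, indicator_of_mem hxK', hv, glue_eq hP hK hxK]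
    · exact fun K' _ hne => indicator_of_notMem (fun h => hne (Subtype.ext
        (hM.eq_of_mem_carrier_of_mem_closure K'.2 hK h hxK))) _
    · simp
  · rw [glue_eq_zero h]
    exact Finset.sum_eq_zero fun K _ => indicator_of_notMem
      (fun hK => h (mem_region.2 ⟨K.1, K.2, subset_closure hK⟩)) _

theorem memLp_toFunction {p : ℕ} (v : BrokenPoly M p) (r : ℝ≥0∞) : MemLp v.toFunction r := by
  have := memLp_finsetSum Finset.univ (f := fun K : {K // K ∈ M} => K.1.carrier.indicator
    (polyEval (v K : MvPolynomial (Fin 2) ℝ))) (p := r) (μ := (volume : Measure Plane))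
    fun K _ => memLp_indicator_polyEval K.1 _ r
  exact this

/-- Continuous piecewise polynomials have a weak gradient in `L²`. -/
theorem isL2WeakGradient_toFunction (hM : IsMesh Ω M) (hΩ : IsOpen Ω) {p : ℕ}
    (v : BrokenPoly M p) (hv : ∀ K : {K // K ∈ M}, (v K : MvPolynomial (Fin 2) ℝ) = P K.1)
    (hP : Agrees M P) : IsL2WeakGradient Ω v.toFunction (brokenPartial M P) := by
  refine ⟨(memLp_toFunction v 2).restrict Ω, fun i => ⟨(memLp_brokenPartial i 2).restrict Ω, ?_⟩⟩
  rintro φ ⟨hφ, hφc, hφs⟩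
  have hsub : Ω ⊆ region M := hM.cover ▸ subset_closure
  have hφ1 : Differentiable ℝ φ := hφ.differentiable (by simp)
  have hdc : Continuous (partialDeriv i φ) :=
    (hφ.continuous_fderiv (by simp)).clm_apply continuous_const
  have hds : tsupport (partialDeriv i φ) ⊆ tsupport φ :=
    closure_minimal (fun x hx => by
      by_contra h
      refine hx ?_
      have : φ =ᶠ[𝓝 x] 0 := notMem_tsupport_iff_eventuallyEq.1 h
      simp [partialDeriv, this.fderiv_eq]) (isClosed_tsupport φ)
  have hdcs : HasCompactSupport (partialDeriv i φ) :=
    hφc.of_isClosed_subset (isClosed_tsupport _) hds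
  -- The extension of the glued function by zero may jump across the boundary of `Ω`; its product
  -- with a function supported in `Ω` is continuous on the plane.
  have hcont : ∀ w : Plane → ℝ, Continuous w → tsupport w ⊆ Ω → Continuous fun x => glue M P x * w x := by
    intro w hw hws
    refine continuous_of_tsupport fun x hx => ?_
    have hxΩ := hws (tsupport_mul_subset_right hx)
    exact (((continuousOn_glue hP).mono hsub).continuousAt (hΩ.mem_nhds hxΩ)).mul hw.continuousAt
  have hcs : ∀ w : Plane → ℝ, HasCompactSupport w → HasCompactSupport fun x => glue M P x * w x :=
    fun w hw => hw.mul_left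
  have hI1 : Integrable fun x => glue M P x * partialDeriv i φ x :=
    (hcont _ hdc (hds.trans hφs)).integrable_of_hasCompactSupport (hcs _ hdcs)
  have hI2 : Integrable fun x => brokenPartial M P i x * φ x :=
    (memLp_brokenPartial (P := P) (M := M) i 2).integrable_mul
      (hφ.continuous.memLp_of_hasCompactSupport (p := 2) hφc)
  have key : ∫ x, (brokenPartial M P i x * φ x + glue M P x * partialDeriv i φ x) = 0 :=
    integral_partialDeriv_eq_zero i (hcont φ hφ.continuous hφs) (hcs φ hφc) (hI2.add hI1)
      (countable_gridCoords M) fun x hx => by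
        have := (hasDerivAt_glue hM hP hx i).mul (hasDerivAt_line hφ1 i x)
        rw [pt_eta] at this
        exact this
  rw [integral_add hI2 hI1] at key
  have hz : ∀ w : Plane → ℝ, tsupport w ⊆ Ω → ∀ u : Plane → ℝ,
      ∫ x in Ω, u x * w x = ∫ x, u x * w x := fun w hw u =>
    setIntegral_eq_integral_of_forall_compl_eq_zero fun x hx => by
      rw [image_eq_zero_of_notMem_tsupport fun h => hx (hw h), mul_zero]
  rw [hz _ (hds.trans hφs), hz _ hφs]
  have e : ∫ x, v.toFunction x * partialDeriv i φ x = ∫ x, glue M P x * partialDeriv i φ x := by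
    refine integral_congr_ae ?_
    filter_upwards [ae_notMem_gridCoords M] with x hx
    rw [toFunction_eq_glue hM v hv hP hx]
  rw [e]
  linarith

end Glue

/-! ### Approximation by test functions -/

theorem tendsto_eLpNorm_two_of_bounded {α : Type*} [MeasurableSpace α] {μ : Measure α}
    [IsFiniteMeasure μ] {f : ℕ → α → ℝ} {C : ℝ} (hf : ∀ n, AEStronglyMeasurable (f n) μ)
    (hb : ∀ n, ∀ᵐ x ∂μ, |f n x| ≤ C) (hl : ∀ᵐ x ∂μ, Tendsto (fun n => f n x) atTop (𝓝 0)) :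
    Tendsto (fun n => eLpNorm (f n) 2 μ) atTop (𝓝 0) := by
  have h0 : ∀ n, eLpNorm (f n) 2 μ = (∫⁻ x, ‖f n x‖ₑ ^ (2 : ℝ) ∂μ) ^ (1 / (2 : ℝ)) := fun n => by
    rw [eLpNorm_eq_lintegral_rpow_enorm_toReal (by simp) (by simp)]
    simp
  simp only [h0]
  have h1 : Tendsto (fun n => ∫⁻ x, ‖f n x‖ₑ ^ (2 : ℝ) ∂μ) atTop (𝓝 (∫⁻ _, 0 ∂μ)) := by
    refine tendsto_lintegral_of_dominated_convergence' (fun _ => ENNReal.ofReal C ^ (2 : ℝ))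
      (fun n => (hf n).enorm.pow_const _) (fun n => ?_) ?_ ?_
    · filter_upwards [hb n] with x hx
      refine ENNReal.rpow_le_rpow ?_ (by norm_num)
      rw [← ofReal_norm]
      exact ENNReal.ofReal_le_ofReal hx
    · rw [lintegral_const]
      exact ENNReal.mul_ne_top (ENNReal.rpow_ne_top_of_nonneg (by norm_num) ENNReal.ofReal_ne_top)
        (measure_ne_top _ _)
    · filter_upwards [hl] with x hx
      have h2 : Tendsto (fun n => ‖f n x‖ₑ) atTop (𝓝 0) := by simpa using hx.enorm
      have h3 := (ENNReal.continuous_rpow_const (y := (2 : ℝ))).tendsto 0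
      rw [ENNReal.zero_rpow_of_pos (by norm_num)] at h3
      exact h3.comp h2
  rw [lintegral_zero] at h1
  have h3 := (ENNReal.continuous_rpow_const (y := 1 / (2 : ℝ))).tendsto 0
  rw [ENNReal.zero_rpow_of_pos (by norm_num)] at h3
  exact h3.comp h1

section Mollification

variable {Ω : Set Plane} {u : Plane → ℝ} {D : Fin 2 → Plane → ℝ} {s : Set ℝ} {C : ℝ}

/-- The derivative first falls on the mollifier; it moves to `u` because the integral of the
derivative of `t ↦ ρ t * u (x - t)` vanishes. -/
theorem partialDeriv_convolution (hu : Continuous u) {ρ : Plane → ℝ}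
    (hρ : ContDiff ℝ ∞ ρ) (hρc : HasCompactSupport ρ) (hs : s.Countable) {i : Fin 2}
    {d : Plane → ℝ} (hdi : Integrable d)
    (hd : ∀ x : Plane, (∀ k, x k ∉ s) → HasDerivAt (fun t => u (pt i t (x (oth i)))) (d x) (x i))
    (x : Plane) :
    partialDeriv i (convolution ρ u (ContinuousLinearMap.lsmul ℝ ℝ) volume) x =
      convolution ρ d (ContinuousLinearMap.lsmul ℝ ℝ) volume x := by
  have hρ1 : Differentiable ℝ ρ := hρ.differentiable (by simp)
  have hF : Continuous (fderiv ℝ ρ) := hρ.continuous_fderiv (by simp)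
  have hux : Continuous fun t => u (x - t) := hu.comp (continuous_const.sub continuous_id)
  have h1 := hρc.hasFDerivAt_convolution_left (ContinuousLinearMap.lsmul ℝ ℝ)
    (hρ.of_le (by simp)) (hu.locallyIntegrable (μ := volume)) x
  have hI0 : Integrable (fun t => ((ContinuousLinearMap.lsmul ℝ ℝ).precompL Plane (fderiv ℝ ρ t))
      (u (x - t))) := by
    refine Continuous.integrable_of_hasCompactSupport ?_ ?_
    · exact ((ContinuousLinearMap.continuous _).comp hF).clm_apply hux
    · refine (hρc.fderiv (𝕜 := ℝ)).mono fun t ht h => ht ?_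
      simp [h]
  rw [partialDeriv, h1.fderiv, convolution_def, ContinuousLinearMap.integral_apply hI0,
    convolution_def]
  simp only [ContinuousLinearMap.precompL_apply, ContinuousLinearMap.lsmul_apply, smul_eq_mul]
  have hI1 : Integrable fun t => fderiv ℝ ρ t (EuclideanSpace.single i 1) * u (x - t) := by
    refine Continuous.integrable_of_hasCompactSupport
      ((hF.clm_apply continuous_const).mul hux) ?_
    refine (hρc.fderiv (𝕜 := ℝ)).mono fun t ht h => ht ?_
    simp [h]
  have hI2 : Integrable fun t => ρ t * d (x - t) := by
    obtain ⟨B, hB⟩ := hρc.exists_bound_of_continuous hρ.continuous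
    exact (hdi.comp_sub_left x).bdd_mul hρ.continuous.aestronglyMeasurable (.of_forall hB)
  have hI3 : Integrable fun t => ρ t * -d (x - t) := by
    simp only [mul_neg]
    exact hI2.neg
  -- The exceptional grid lines are those of `u`, reflected by `t ↦ x - t`.
  have key : ∫ t, (fderiv ℝ ρ t (EuclideanSpace.single i 1) * u (x - t) + ρ t * -d (x - t)) = 0 := by
    refine integral_partialDeriv_eq_zero i (G := fun t => ρ t * u (x - t)) (hρ.continuous.mul hux)
      hρc.mul_right (hI1.add hI3)
      (s := ⋃ k, (fun a => x k - a) '' s) (countable_iUnion fun k => hs.image _) fun t ht => ?_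
    have h2 : HasDerivAt (fun a => u (x - pt i a (t (oth i)))) (-d (x - t)) (t i) := by
      have h3 := hd (x - t) fun k hk => ht k (mem_iUnion.2 ⟨k, x k - t k, hk, by ring⟩)
      have h4 := h3.comp_const_sub (x i) (t i)
      refine h4.congr_of_eventuallyEq (.of_forall fun a => ?_)
      refine congrArg u ?_
      exact plane_ext i (by simp) (by simp)
    have h5 := (hasDerivAt_line hρ1 i t).mul h2
    rw [pt_eta] at h5
    exact h5
  rw [integral_add hI1 hI3] at key
  simp only [mul_neg, integral_neg] at key
  linarith

/-- A continuous function with compact support in `Ω` which has bounded partial derivatives off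
countably many grid lines is a limit of test functions in `H¹`. -/
theorem exists_testFunction_near (hΩ : IsOpen Ω) (hΩb : Bornology.IsBounded Ω) (hu : Continuous u)
    (huc : HasCompactSupport u) (hus : tsupport u ⊆ Ω) (hs : s.Countable)
    (hdi : ∀ i, Integrable (D i)) (hdb : ∀ i x, |D i x| ≤ C)
    (hd : ∀ i, ∀ x : Plane, (∀ k, x k ∉ s) →
      HasDerivAt (fun t => u (pt i t (x (oth i)))) (D i x) (x i)) {η : ℝ≥0∞} (hη : 0 < η) :
    ∃ ψ, IsTestFunction Ω ψ ∧ eLpNorm (fun x => ψ x - u x) 2 (volume.restrict Ω) < η ∧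
      ∀ i, eLpNorm (fun x => partialDeriv i ψ x - D i x) 2 (volume.restrict Ω) < η := by
  have hfin : IsFiniteMeasure (volume.restrict Ω) :=
    ⟨by rw [Measure.restrict_apply_univ]; exact hΩb.measure_lt_top⟩
  let b : ℕ → ContDiffBump (0 : Plane) := fun n =>
    ⟨1 / ((n : ℝ) + 1), 2 * (1 / ((n : ℝ) + 1)), by positivity, by
      have : 0 < 1 / ((n : ℝ) + 1) := by positivity
      linarith⟩
  have hr : Tendsto (fun n => (b n).rOut) atTop (𝓝 0) := by
    have h := (tendsto_one_div_add_atTop_nhds_zero_nat (𝕜 := ℝ)).const_mul 2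
    rwa [mul_zero] at h
  -- The gradient is only bounded and integrable, so its mollifications converge almost everywhere
  -- by Lebesgue differentiation, which needs comparable inner and outer radii.
  have hr' : ∀ᶠ n in atTop, (b n).rOut ≤ 2 * (b n).rIn := .of_forall fun n => le_rfl
  let ψ : ℕ → Plane → ℝ := fun n =>
    convolution ((b n).normed volume) u (ContinuousLinearMap.lsmul ℝ ℝ) volume
  have hψ : ∀ n, ContDiff ℝ ∞ (ψ n) := fun n =>
    (b n).hasCompactSupport_normed.contDiff_convolution_left _ (b n).contDiff_normed
      hu.locallyIntegrable
  have hψc : ∀ n, HasCompactSupport (ψ n) := fun n =>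
    (b n).hasCompactSupport_normed.convolution _ huc
  have hψs : ∀ᶠ n in atTop, tsupport (ψ n) ⊆ Ω := by
    obtain ⟨δ, hδ, hδ'⟩ := huc.isCompact.exists_cthickening_subset_open hΩ hus
    filter_upwards [hr.eventually (ge_mem_nhds hδ)] with n hn
    refine Subset.trans (closure_minimal ?_ (Metric.isClosed_cthickening (δ := δ))) hδ'
    refine (support_convolution_subset_swap _).trans ?_
    rintro x ⟨y, hy, z, hz, rfl⟩
    rw [(b n).support_normed_eq, mem_ball_zero_iff] at hz
    refine Metric.mem_cthickening_of_dist_le _ y _ _ (subset_tsupport u hy) ?_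
    rw [dist_eq_norm, add_sub_cancel_left]
    exact hz.le.trans hn
  have hbd : ∀ (w : Plane → ℝ) (B : ℝ), (∀ x, |w x| ≤ B) → ∀ n x,
      |convolution ((b n).normed volume) w (ContinuousLinearMap.lsmul ℝ ℝ) volume x| ≤ B := by
    intro w B hw n x
    rw [convolution_lsmul, ← Real.norm_eq_abs]
    have h2 := norm_integral_le_of_norm_le (μ := volume) ((b n).integrable_normed.mul_const B)
      (f := fun t => (b n).normed volume t • w (x - t)) (.of_forall fun t => by
        rw [norm_smul, Real.norm_eq_abs, Real.norm_eq_abs, abs_of_nonneg ((b n).nonneg_normed t)]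
        exact mul_le_mul_of_nonneg_left (hw _) ((b n).nonneg_normed t))
    rwa [integral_mul_const, (b n).integral_normed, one_mul] at h2
  obtain ⟨B, hB⟩ := huc.exists_bound_of_continuous hu
  have hpd : ∀ i n x, partialDeriv i (ψ n) x =
      convolution ((b n).normed volume) (D i) (ContinuousLinearMap.lsmul ℝ ℝ) volume x :=
    fun i n x => partialDeriv_convolution hu (b n).contDiff_normed (b n).hasCompactSupport_normed
      hs (hdi i) (hd i) x
  have hc1 : Tendsto (fun n => eLpNorm (fun x => ψ n x - u x) 2 (volume.restrict Ω)) atTop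
      (𝓝 0) := by
    refine tendsto_eLpNorm_two_of_bounded (C := B + B)
      (fun n => ((hψ n).continuous.sub hu).aestronglyMeasurable)
      (fun n => .of_forall fun x => (abs_sub _ _).trans (add_le_add (hbd u B hB n x) (hB x)))
      (.of_forall fun x => ?_)
    simpa using (ContDiffBump.convolution_tendsto_right_of_continuous (μ := volume) hr hu
      x).sub_const (u x)
  have hc2 : ∀ i, Tendsto (fun n => eLpNorm (fun x => partialDeriv i (ψ n) x - D i x) 2
      (volume.restrict Ω)) atTop (𝓝 0) := by
    intro i
    refine tendsto_eLpNorm_two_of_bounded (C := C + C) (fun n => ?_)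
      (fun n => .of_forall fun x => (abs_sub _ _).trans (add_le_add ?_ (hdb i x))) ?_
    · exact ((((hψ n).continuous_fderiv (by simp)).clm_apply
        continuous_const).aestronglyMeasurable).sub (hdi i).aestronglyMeasurable.restrict
    · rw [hpd]; exact hbd _ _ (hdb i) n x
    · refine ae_restrict_of_ae ?_
      filter_upwards [ContDiffBump.ae_convolution_tendsto_right_of_locallyIntegrable (μ := volume)
        hr hr' (hdi i).locallyIntegrable] with x hx
      simp only [hpd]
      simpa using hx.sub_const (D i x)
  have hall := hψs.and ((hc1.eventually (gt_mem_nhds hη)).and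
    (eventually_all.2 fun i => (hc2 i).eventually (gt_mem_nhds hη)))
  obtain ⟨n, h1, h2, h3⟩ := hall.exists
  exact ⟨ψ n, ⟨hψ n, hψc n, h1⟩, h2, h3⟩

end Mollification

/-! ### Functions vanishing on the boundary -/

/-- A smooth function which vanishes near zero, is the identity outside `[-2, 2]`, and has a bounded
derivative. -/
theorem exists_truncation : ∃ T T' : ℝ → ℝ, ∃ C : ℝ, (∀ t, HasDerivAt T (T' t) t) ∧
    Continuous T' ∧ (∀ t, |T' t| ≤ C) ∧ (∀ t, |t| ≤ 1 → T t = 0) ∧ T' 0 = 0 ∧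
    (∀ t, 2 ≤ |t| → T t = t ∧ T' t = 1) ∧ ∀ t, |T t| ≤ |t| := by
  set T : ℝ → ℝ := fun t => t * Real.smoothTransition (t ^ 2 - 1) with hT
  have hsm : ContDiff ℝ 1 T := contDiff_id.mul
    (Real.smoothTransition.contDiff.comp ((contDiff_id.pow 2).sub contDiff_const))
  have hc : Continuous (deriv T) := hsm.continuous_deriv le_rfl
  have h0 : ∀ t, |t| ≤ 1 → T t = 0 := fun t ht => by
    have h1 : t ^ 2 ≤ 1 := (sq_le_one_iff_abs_le_one t).2 ht
    simp only [hT, Real.smoothTransition.zero_of_nonpos (sub_nonpos.2 h1), mul_zero]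
  have hlarge : ∀ t, 2 < t ^ 2 → T t = t := fun t ht => by
    simp only [hT, Real.smoothTransition.one_of_one_le (by linarith : 1 ≤ t ^ 2 - 1), mul_one]
  have h4 : ∀ t : ℝ, 2 ≤ |t| → 4 ≤ t ^ 2 := fun t ht => by
    rw [← sq_abs]; nlinarith
  have h2 : ∀ t, 2 ≤ |t| → T t = t ∧ deriv T t = 1 := by
    intro t ht
    refine ⟨hlarge t (by linarith [h4 t ht]), ?_⟩
    have he : T =ᶠ[𝓝 t] fun y => y := by
      have o2 : ∀ᶠ y in 𝓝 t, 2 < y ^ 2 :=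
        (continuous_pow 2).continuousAt.eventually (lt_mem_nhds (by linarith [h4 t ht]))
      filter_upwards [o2] with y hy using hlarge y hy
    rw [he.deriv_eq, deriv_id'']
  obtain ⟨C, hC⟩ := (isCompact_Icc (a := (-2 : ℝ)) (b := 2)).exists_bound_of_continuousOn
    hc.continuousOn
  refine ⟨T, deriv T, max C 1, fun t => (hsm.differentiable one_ne_zero t).hasDerivAt, hc,
    fun t => ?_, h0, ?_, h2, fun t => ?_⟩
  · rcases le_total 2 |t| with h | h
    · rw [(h2 t h).2, abs_one]; exact le_max_right _ _
    · exact (hC t (abs_le.1 h)).trans (le_max_left _ _)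
  · have he : T =ᶠ[𝓝 0] fun _ => 0 := by
      have o1 : ∀ᶠ y in 𝓝 (0 : ℝ), |y| < 1 :=
        continuous_abs.continuousAt.eventually (gt_mem_nhds (by simp))
      filter_upwards [o1] with y hy using h0 y hy.le
    rw [he.deriv_eq, deriv_const]
  · simp only [hT, abs_mul, abs_of_nonneg (Real.smoothTransition.nonneg _)]
    exact mul_le_of_le_one_right (abs_nonneg _) (Real.smoothTransition.le_one _)

theorem eventually_two_le_abs_mul {a : ℝ} (ha : a ≠ 0) :
    ∀ᶠ n : ℕ in atTop, 2 ≤ |((n : ℝ) + 1) * a| := by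
  have h : Tendsto (fun n : ℕ => ((n : ℝ) + 1) * |a|) atTop atTop :=
    (tendsto_atTop_add_const_right _ _ tendsto_natCast_atTop_atTop).atTop_mul_const (abs_pos.2 ha)
  filter_upwards [h.eventually_ge_atTop 2] with n hn
  rwa [abs_mul, abs_of_pos (by positivity : (0 : ℝ) < (n : ℝ) + 1)]

/-- The derivatives of a polynomial vanish almost everywhere on its zero set. -/
theorem ae_pderiv_eq_zero (q : MvPolynomial (Fin 2) ℝ) (i : Fin 2) :
    ∀ᵐ x : Plane, polyEval q x = 0 → polyEval (MvPolynomial.pderiv i q) x = 0 := by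
  obtain ⟨j, rfl⟩ : ∃ j, i = oth j := ⟨oth i, (oth_oth i).symm⟩
  rw [← (measurePreserving_pt j).map_eq, (measurableEmbedding_pt j).ae_map_iff,
    Measure.volume_eq_prod, ae_iff]
  have hm : MeasurableSet {a : ℝ × ℝ | ¬ (polyEval q (pt j a.1 a.2) = 0 →
      polyEval (MvPolynomial.pderiv (oth j) q) (pt j a.1 a.2) = 0)} := by
    have hc : ∀ r : MvPolynomial (Fin 2) ℝ,
        MeasurableSet {a : ℝ × ℝ | polyEval r (pt j a.1 a.2) = 0} := fun r =>
      (isClosed_singleton.preimage ((continuous_polyEval r).comp (continuous_pt j))).measurableSet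
    have := (hc q).diff (hc (MvPolynomial.pderiv (oth j) q))
    convert this using 1
    ext a
    simp
  rw [Measure.measure_prod_null hm]
  refine .of_forall fun c => ?_
  refine Set.Countable.measure_zero ?_ _
  -- On each line the restriction either vanishes identically, together with its derivative, or has
  -- finitely many zeros; Fubini does the rest.
  by_cases h : lineTrace j c q = 0
  · refine Set.countable_empty.mono fun t ht => ?_
    simp only [mem_preimage, mem_ofPred_eq, ← eval_lineTrace, lineTrace_pderiv, h] at ht
    simp at ht
  · refine Set.Countable.mono (fun t ht => ?_) (lineTrace j c q).roots.toFinset.countable_toSet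
    simp only [mem_preimage, mem_ofPred_eq, Classical.not_imp, ← eval_lineTrace] at ht
    simpa [h] using ht.1

section Glue

variable {M : Finset Rect} {P : Rect → MvPolynomial (Fin 2) ℝ} {Ω : Set Plane}

theorem ae_brokenPartial_eq_zero (hM : IsMesh Ω M) (hP : Agrees M P) (i : Fin 2) :
    ∀ᵐ x : Plane, glue M P x = 0 → brokenPartial M P i x = 0 := by
  have h : ∀ᵐ x : Plane, ∀ K ∈ M, polyEval (P K) x = 0 →
      polyEval (MvPolynomial.pderiv i (P K)) x = 0 :=
    (ae_ball_iff M.countable_toSet).2 fun K _ => ae_pderiv_eq_zero (P K) i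
  filter_upwards [h, ae_notMem_gridCoords M] with x hx hgrid h0
  by_cases hr : x ∈ region M
  · obtain ⟨K, hK, hxK⟩ := mem_region.1 hr
    rw [brokenPartial_eq hM hK (mem_carrier_of_notMem_gridCoords hgrid hK hxK)]
    exact hx K hK (by rwa [← glue_eq hP hK hxK])
  · exact brokenPartial_eq_zero hr i

theorem exists_bound_brokenPartial (M : Finset Rect) (P : Rect → MvPolynomial (Fin 2) ℝ) :
    ∃ C, 0 ≤ C ∧ ∀ i x, |brokenPartial M P i x| ≤ C := by
  have h : ∀ K : Rect, ∀ i, ∃ c, 0 ≤ c ∧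
      ∀ x, |K.carrier.indicator (polyEval (MvPolynomial.pderiv i (P K))) x| ≤ c := by
    intro K i
    obtain ⟨c, hc⟩ := K.isBounded_carrier.isCompact_closure.exists_bound_of_continuousOn
      (continuous_polyEval (MvPolynomial.pderiv i (P K))).continuousOn
    refine ⟨max c 0, le_max_right _ _, fun x => ?_⟩
    by_cases hx : x ∈ K.carrier
    · rw [indicator_of_mem hx]; exact (hc x (subset_closure hx)).trans (le_max_left _ _)
    · rw [indicator_of_notMem hx, abs_zero]; exact le_max_right _ _
  choose c hc0 hc using h
  refine ⟨∑ K ∈ M, ∑ i, c K i,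
    Finset.sum_nonneg fun K _ => Finset.sum_nonneg fun i _ => hc0 K i, fun i x => ?_⟩
  refine (Finset.abs_sum_le_sum_abs _ _).trans (Finset.sum_le_sum fun K _ => (hc K i x).trans ?_)
  exact Finset.single_le_sum (fun k _ => hc0 K k) (Finset.mem_univ i)

theorem isBounded_region (M : Finset Rect) : Bornology.IsBounded (region M) :=
  (Bornology.isBounded_biUnion_finset M).2 fun K _ => K.isBounded_carrier.closure

theorem continuous_glue (hM : IsMesh Ω M) (hΩ : IsOpen Ω) (hP : Agrees M P)
    (h0 : ∀ x ∉ Ω, glue M P x = 0) : Continuous (glue M P) := by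
  rw [← continuousOn_univ]
  have hu : closure Ω ∪ Ωᶜ = univ :=
    eq_univ_of_forall fun x => (em (x ∈ Ω)).imp (fun h => subset_closure h) id
  rw [← hu]
  refine ContinuousOn.union_of_isClosed ?_ ?_ isClosed_closure hΩ.isClosed_compl
  · exact hM.cover ▸ continuousOn_glue hP
  · exact continuousOn_const.congr fun x hx => h0 x hx

/-- With `m = n + 1`, the truncation `T (m g) / m` of the glued function `g` vanishes where `|g| ≤ 1
/ m`, so its support is compact in `Ω`. Its gradient `T' (m g) ∇g` tends to `∇g` almost everywhere,
because `∇g = 0` almost everywhere on the zero set of `g`. Each truncation is then mollified. -/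
theorem memH10_toFunction (hM : IsMesh Ω M) (hΩ : IsOpen Ω) (hΩb : Bornology.IsBounded Ω) {p : ℕ}
    (v : BrokenPoly M p) (hv : ∀ K : {K // K ∈ M}, (v K : MvPolynomial (Fin 2) ℝ) = P K.1)
    (hP : Agrees M P) (h0 : ∀ x ∈ frontier Ω, glue M P x = 0) : MemH10 Ω v.toFunction := by
  have h0' : ∀ x ∉ Ω, glue M P x = 0 := by
    intro x hx
    by_cases h : x ∈ region M
    · rw [hM.cover] at h
      exact h0 x ⟨h, by rwa [hΩ.interior_eq]⟩
    · exact glue_eq_zero h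
  have hfin : IsFiniteMeasure (volume.restrict Ω) :=
    ⟨by rw [Measure.restrict_apply_univ]; exact hΩb.measure_lt_top⟩
  have hg := continuous_glue hM hΩ hP h0'
  have hgc : HasCompactSupport (glue M P) :=
    HasCompactSupport.of_support_subset_isCompact
      ((isBounded_region M).isCompact_closure) fun x hx => subset_closure (by
        by_contra h; exact hx (glue_eq_zero h))
  obtain ⟨T, T', C, hT, hT'c, hT'b, hT0, hT'0, hT2, hTle⟩ := exists_truncation
  obtain ⟨B, hB0, hB⟩ := exists_bound_brokenPartial M P
  have hTc : Continuous T := continuous_iff_continuousAt.2 fun t => (hT t).continuousAt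
  let u : ℕ → Plane → ℝ := fun n x => 1 / ((n : ℝ) + 1) * T (((n : ℝ) + 1) * glue M P x)
  let D : ℕ → Fin 2 → Plane → ℝ := fun n i x =>
    T' (((n : ℝ) + 1) * glue M P x) * brokenPartial M P i x
  have hn0 : ∀ n : ℕ, 0 < (n : ℝ) + 1 := fun n => by positivity
  have hTz : T 0 = 0 := hT0 0 (by simp)
  have huc : ∀ n, Continuous (u n) := fun n =>
    continuous_const.mul (hTc.comp (continuous_const.mul hg))
  have hucs : ∀ n, HasCompactSupport (u n) := fun n => hgc.mono fun x hx h => hx (by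
    simp only [u, h, mul_zero, hTz])
  have hus : ∀ n, tsupport (u n) ⊆ Ω := by
    intro n
    have hcl : IsClosed {x | 1 / ((n : ℝ) + 1) ≤ |glue M P x|} :=
      isClosed_le continuous_const hg.abs
    refine (closure_minimal (fun x hx => ?_) hcl).trans fun x hx => ?_
    · by_contra h
      refine hx ?_
      have h1 : |((n : ℝ) + 1) * glue M P x| ≤ 1 := by
        rw [abs_mul, abs_of_pos (hn0 n)]
        have : |glue M P x| ≤ 1 / ((n : ℝ) + 1) := (lt_of_not_ge h).le
        rwa [le_div_iff₀ (hn0 n), mul_comm] at this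
      simp only [u, hT0 _ h1, mul_zero]
    · by_contra h
      have h1 : 1 / ((n : ℝ) + 1) ≤ |glue M P x| := hx
      rw [h0' x h, abs_zero] at h1
      exact (div_pos one_pos (hn0 n)).not_ge h1
  have hDb : ∀ n i x, |D n i x| ≤ C * B := fun n i x => by
    simp only [D, abs_mul]
    exact mul_le_mul (hT'b _) (hB i x) (abs_nonneg _) ((abs_nonneg _).trans (hT'b 0))
  have hDi : ∀ n i, Integrable (D n i) := fun n i =>
    (memLp_one_iff_integrable.1 (memLp_brokenPartial i 1)).bdd_mul
      (hT'c.comp (continuous_const.mul hg)).aestronglyMeasurable (.of_forall fun x => hT'b _)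
  have hd : ∀ n i, ∀ x : Plane, (∀ k, x k ∉ gridCoords M) →
      HasDerivAt (fun t => u n (pt i t (x (oth i)))) (D n i x) (x i) := by
    intro n i x hx
    have h1 := (hasDerivAt_glue hM hP hx i).const_mul ((n : ℝ) + 1)
    have h2 := ((hT _).comp (x i) h1).const_mul (1 / ((n : ℝ) + 1))
    rw [pt_eta] at h2
    have e : D n i x = 1 / ((n : ℝ) + 1) * (T' (((n : ℝ) + 1) * glue M P x) *
        (((n : ℝ) + 1) * brokenPartial M P i x)) := by
      simp only [D]
      field_simp [(hn0 n).ne']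
    rw [e]
    exact h2
  have hl1 : Tendsto (fun n => eLpNorm (fun x => u n x - v.toFunction x) 2 (volume.restrict Ω))
      atTop (𝓝 0) := by
    obtain ⟨A, hA⟩ := hgc.exists_bound_of_continuous hg
    have e : ∀ n, eLpNorm (fun x => u n x - v.toFunction x) 2 (volume.restrict Ω) =
        eLpNorm (fun x => u n x - glue M P x) 2 (volume.restrict Ω) := fun n => by
      refine eLpNorm_congr_ae (ae_restrict_of_ae ?_)
      filter_upwards [ae_notMem_gridCoords M] with x hx
      rw [toFunction_eq_glue hM v hv hP hx]
    simp only [e]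
    refine tendsto_eLpNorm_two_of_bounded (C := A + A)
      (fun n => ((huc n).sub hg).aestronglyMeasurable) (fun n => .of_forall fun x => ?_)
      (.of_forall fun x => ?_)
    · refine (abs_sub _ _).trans (add_le_add (le_trans ?_ (hA x)) (hA x))
      simp only [u, abs_mul, abs_of_pos (div_pos one_pos (hn0 n)), Real.norm_eq_abs]
      rw [div_mul_eq_mul_div, one_mul, div_le_iff₀ (hn0 n)]
      refine (hTle _).trans (le_of_eq ?_)
      rw [abs_mul, abs_of_pos (hn0 n), mul_comm]
    · by_cases hx : glue M P x = 0
      · simp only [u, hx, mul_zero, hTz, sub_zero]; exact tendsto_const_nhds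
      · refine tendsto_const_nhds.congr' ?_
        filter_upwards [eventually_two_le_abs_mul hx] with n hn
        simp only [u, (hT2 _ hn).1]
        field_simp [(hn0 n).ne']
        ring
  have hl2 : ∀ i, Tendsto (fun n => eLpNorm (fun x => D n i x - brokenPartial M P i x) 2
      (volume.restrict Ω)) atTop (𝓝 0) := by
    intro i
    refine tendsto_eLpNorm_two_of_bounded (C := C * B + B) (fun n => ?_)
      (fun n => .of_forall fun x => (abs_sub _ _).trans (add_le_add (hDb n i x) (hB i x))) ?_
    · exact ((hDi n i).aestronglyMeasurable.sub
        (memLp_brokenPartial i 2).aestronglyMeasurable).restrict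
    · refine ae_restrict_of_ae ?_
      filter_upwards [ae_brokenPartial_eq_zero hM hP i] with x hx
      by_cases h : glue M P x = 0
      · simp only [D, hx h, mul_zero, sub_zero]; exact tendsto_const_nhds
      · refine tendsto_const_nhds.congr' ?_
        filter_upwards [eventually_two_le_abs_mul h] with n hn
        simp only [D, (hT2 _ hn).2, one_mul, sub_self]
  refine ⟨brokenPartial M P, isL2WeakGradient_toFunction hM hΩ v hv hP, ?_⟩
  have hη : ∀ n : ℕ, (0 : ℝ≥0∞) < ((n : ℝ≥0∞) + 1)⁻¹ := fun n =>
    ENNReal.inv_pos.2 (by simp)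
  have hη0 : Tendsto (fun n : ℕ => ((n : ℝ≥0∞) + 1)⁻¹) atTop (𝓝 0) := by
    have := (tendsto_add_atTop_iff_nat 1).2 ENNReal.tendsto_inv_nat_nhds_zero
    simpa using this
  -- A test function within `1 / (n + 1)` of the truncation `u n`, in value and gradient.
  choose φ hφ hφ1 hφ2 using fun n => exists_testFunction_near hΩ hΩb (huc n) (hucs n) (hus n)
    (countable_gridCoords M) (hDi n) (hDb n) (hd n) (hη n)
  refine ⟨φ, hφ, ?_, fun i => ?_⟩
  · refine tendsto_of_tendsto_of_tendsto_of_le_of_le tendsto_const_nhds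
      (by simpa using hη0.add hl1) (fun n => zero_le) fun n => ?_
    refine le_trans ?_ (add_le_add_left (hφ1 n).le _)
    refine le_trans (le_of_eq ?_) (eLpNorm_add_le ?_ ?_ (by norm_num))
    · congr 1; ext x; simp
    · exact ((hφ n).1.continuous.sub (huc n)).aestronglyMeasurable
    · exact ((huc n).aestronglyMeasurable.sub (memLp_toFunction v 2).aestronglyMeasurable).restrict
  · refine tendsto_of_tendsto_of_tendsto_of_le_of_le tendsto_const_nhds
      (by simpa using hη0.add (hl2 i)) (fun n => zero_le) fun n => ?_
    refine le_trans ?_ (add_le_add_left (hφ2 n i).le _)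
    refine le_trans (le_of_eq ?_) (eLpNorm_add_le ?_ ?_ (by norm_num))
    · congr 1; ext x; simp
    · exact ((((hφ n).1.continuous_fderiv (by simp)).clm_apply
        continuous_const).aestronglyMeasurable).sub (hDi n i).aestronglyMeasurable.restrict
    · exact ((hDi n i).aestronglyMeasurable.sub
        (memLp_brokenPartial i 2).aestronglyMeasurable).restrict

end Glue

/-! ### Boundary values -/

section Boundary

variable {Ω : Set Plane} {M : Finset Rect} {p : ℕ}

/-- If the traces of `v` vanish on the boundary, then a polynomial vanishes on the line through any
boundary segment in its element. -/
theorem BrokenPoly.VanishesOnBoundary.lineTrace_eq_zero {v : BrokenPoly M p}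
    (hv : v.VanishesOnBoundary Ω) {K : Rect} (hK : K ∈ M) {i : Fin 2} {c l u : ℝ} (hlu : l < u)
    (hs : coordSegment i c l u ⊆ frontier K.carrier ∩ frontier Ω) :
    lineTrace i c (extendPoly M p v K) = 0 := by
  by_contra hne
  have h1 := ae_restrict_of_ae_restrict_of_subset hs (hv ⟨K, hK⟩)
  have hemb : MeasurableEmbedding (pt i c) := (isometry_pt i c).isClosedEmbedding.measurableEmbedding
  rw [restrict_coordSegment, hemb.ae_map_iff, ← extendPoly_of_mem v ⟨K, hK⟩] at h1
  have h2 : ∀ᵐ t ∂volume.restrict (Icc l u), t ∉ ((lineTrace i c (extendPoly M p v K)).roots.toFinset : Set ℝ) :=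
    ae_restrict_of_ae ((Finset.countable_toSet _).ae_notMem volume)
  have h3 : ∀ᵐ t ∂volume.restrict (Icc l u), False := by
    filter_upwards [h1, h2] with t ht1 ht2
    refine ht2 ?_
    rw [← eval_lineTrace] at ht1
    simpa [hne] using ht1
  rw [eventually_false_iff_eq_bot, ae_eq_bot, Measure.restrict_eq_zero, Real.volume_Icc,
    ENNReal.ofReal_eq_zero] at h3
  linarith

/-- Every boundary point is the end of a boundary segment. -/
theorem IsMesh.exists_boundary_segment (hM : IsMesh Ω M) (hΩ : IsBoundedLipschitz Ω) {z : Plane}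
    (hz : z ∈ frontier Ω) : ∃ K ∈ M, z ∈ closure K.carrier ∧ ∃ i l u, l < u ∧
      coordSegment i (z i) l u ⊆ frontier K.carrier ∩ frontier Ω := by
  -- Two coordinate flips lead from a filled quadrant to its unfilled opposite, and one of them
  -- passes from filled to unfilled. The half-axis between these two quadrants lies in the boundary
  -- near `z`.
  have hflip : ∃ e i, Filled M z e ∧ ¬ Filled M z (Function.update e i (!e i)) := by
    obtain ⟨e, h1, h2⟩ := hM.exists_filled_not_filled hΩ hz
    by_cases h : Filled M z (Function.update e 0 (!e 0))
    · refine ⟨_, 1, h, ?_⟩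
      convert h2 using 2
      funext k
      fin_cases k <;> simp
    · exact ⟨e, 0, h1, h⟩
  obtain ⟨e, i, ⟨K, hK, hc⟩, hnot⟩ := hflip
  obtain ⟨r₁, hr₁, h₁⟩ := hc.exists_quadrant_subset
  obtain ⟨r₂, hr₂, h₂⟩ := exists_quadrant_disjoint_region hnot
  obtain ⟨r, hr0, hrl, hrr⟩ : ∃ r : ℝ, 0 < r ∧ r ≤ r₁ ∧ r ≤ r₂ :=
    ⟨min r₁ r₂, lt_min hr₁ hr₂, min_le_left _ _, min_le_right _ _⟩
  have key : ∀ t, ((e (oth i) = true → z (oth i) < t ∧ t < z (oth i) + r) ∧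
      (e (oth i) = false → z (oth i) - r < t ∧ t < z (oth i))) →
      pt i (z i) t ∈ frontier K.carrier ∩ frontier Ω := by
    intro t ht
    have hcl : pt i (z i) t ∈ closure K.carrier := by
      have h3 : pt i (if e i then z i + r / 2 else z i - r / 2) t ∈ K.carrier := by
        refine h₁ (quadrant_mono z e hrl ((forall_coord i).2 ⟨?_, ?_⟩))
        · rw [pt_self]
          constructor <;> intro h <;> simp only [h, if_true, Bool.false_eq_true, if_false] <;>
            constructor <;> linarith
        · rwa [pt_oth]
      rw [Rect.mem_closure, forall_coord i, pt_self, pt_oth]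
      have h4 := h3 (oth i)
      rw [pt_oth] at h4
      exact ⟨Rect.mem_closure.1 hc.mem_closure i, h4.1.le, h4.2.le⟩
    have hnΩ : pt i (z i) t ∉ Ω := by
      intro hmem
      obtain ⟨δ, hδ, hδ'⟩ := exists_coord_nhds hΩ.1 hmem
      set ε := min δ r / 2 with hε
      have hε0 : 0 < ε := by have := lt_min hδ hr0; positivity
      have hεδ : ε < δ := by have := min_le_left δ r; linarith [lt_min hδ hr0]
      have hεr : ε < r := by have := min_le_right δ r; linarith [lt_min hδ hr0]
      refine h₂ (pt i (if e i then z i - ε else z i + ε) t) ?_ (hM.cover ▸ subset_closure (hδ' _ ?_))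
      · refine quadrant_mono z _ hrr ((forall_coord i).2 ⟨?_, ?_⟩)
        · rw [pt_self, Function.update_self]
          cases h : e i <;> simp <;> constructor <;> linarith
        · rw [pt_oth, Function.update_of_ne (oth_ne i)]
          exact ht
      · rw [forall_coord i]
        simp only [pt_self, pt_oth, sub_self, abs_zero]
        refine ⟨?_, hδ⟩
        split_ifs
        · rw [sub_sub_cancel_left, abs_neg, abs_of_pos hε0]; exact hεδ
        · rw [add_sub_cancel_left, abs_of_pos hε0]; exact hεδ
    refine ⟨⟨hcl, ?_⟩, hM.closure_subset hK hcl, ?_⟩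
    · rw [K.isOpen_carrier.interior_eq]; exact fun h => hnΩ (hM.subset K hK h)
    · rwa [hΩ.1.interior_eq]
  refine ⟨K, hK, hc.mem_closure, i, ?_⟩
  cases he : e (oth i)
  · refine ⟨z (oth i) - r / 2, z (oth i) - r / 4, by linarith, ?_⟩
    rintro x ⟨hx1, hx2, hx3⟩
    rw [← pt_eta i x, hx1]
    exact key _ ⟨fun h => by simp [h] at he, fun _ => ⟨by linarith, by linarith⟩⟩
  · refine ⟨z (oth i) + r / 4, z (oth i) + r / 2, by linarith, ?_⟩
    rintro x ⟨hx1, hx2, hx3⟩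
    rw [← pt_eta i x, hx1]
    exact key _ ⟨fun _ => ⟨by linarith, by linarith⟩, fun h => by simp [h] at he⟩

/-- The two elements fill all quadrants at `z`, whereas a boundary point has an unfilled one. -/
theorem IsMesh.not_midSide_midSide (hM : IsMesh Ω M) (hΩ : IsBoundedLipschitz Ω) {z : Plane}
    (hz : z ∈ frontier Ω) {K K' : Rect} (hK : K ∈ M) (hK' : K' ∈ M) {i : Fin 2} {b : Bool}
    (h : K.MidSide z i b) (h' : K'.MidSide z i (!b)) : False := by
  obtain ⟨e, -, hn⟩ := hM.exists_filled_not_filled hΩ hz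
  refine hn ?_
  by_cases he : e i = b
  · exact ⟨K, hK, h.covers (by rw [he])⟩
  · exact ⟨K', hK', h'.covers (by rw [bool_eq_not_of_ne he])⟩

theorem IsMesh.isConformingNode_of_mem_frontier {z : Plane} (hz : z ∈ frontier Ω)
    (hn : IsNode M z) : IsConformingNode Ω M z := ⟨hn, Or.inl hz⟩

/-- A side with an interior point on the boundary is contained in the boundary. -/
theorem IsMesh.side_subset_frontier {C₀ : ℝ} (hM : IsMesh Ω M) (hΩ : IsBoundedLipschitz Ω)
    (hKM : IsKMesh C₀ Ω M) {K : Rect} (hK : K ∈ M) {x : Plane} {i : Fin 2} {b : Bool}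
    (hx : x ∈ frontier Ω) (h : K.MidSide x i b) :
    coordSegment i (K.bd i b) (K.lo (oth i)) (K.hi (oth i)) ⊆ frontier K.carrier ∩ frontier Ω := by
  classical
  have hlt := K.lo_lt_hi (oth i)
  have hpt : Continuous fun t : ℝ => pt i (K.bd i b) t := (isometry_pt i _).continuous
  have hmid : ∀ t ∈ Ioo (K.lo (oth i)) (K.hi (oth i)), K.MidSide (pt i (K.bd i b) t) i b :=
    fun t ht => ⟨by simp, by simpa using ht.1, by simpa using ht.2⟩
  set u : Set ℝ := (fun t => pt i (K.bd i b) t) ⁻¹' Ω with hu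
  have huo : IsOpen u := hΩ.1.preimage hpt
  -- The part of the open side inside `Ω` is open and relatively closed, hence empty, as `x` is not
  -- in it. A limit point outside `Ω` would also lie in a closed element across the side: not in its
  -- interior, not inside a side (all quadrants would be filled), and not at a vertex (a conforming
  -- node is not hanging).
  have hcl : closure u ∩ Ioo (K.lo (oth i)) (K.hi (oth i)) ⊆ u := by
    rintro t ⟨htu, ht⟩
    by_contra hn
    have hm := hmid t ht
    have hf : pt i (K.bd i b) t ∈ frontier Ω :=
      ⟨hM.closure_subset hK hm.mem_closure, by rwa [hΩ.1.interior_eq]⟩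
    have hreg : pt i (K.bd i b) t ∈ region (M.erase K) := by
      have hclosed : IsClosed ((fun t => pt i (K.bd i b) t) ⁻¹' region (M.erase K)) :=
        (isClosed_region _).preimage hpt
      have hsub : u ∩ Ioo (K.lo (oth i)) (K.hi (oth i)) ⊆
          (fun t => pt i (K.bd i b) t) ⁻¹' region (M.erase K) := by
        rintro s ⟨hs, hs'⟩
        obtain ⟨K', hK', hc⟩ := hM.filled_of_mem hΩ.1 hs (fun _ => b)
        refine mem_region.2 ⟨K', Finset.mem_erase.2 ⟨?_, hK'⟩, hc.mem_closure⟩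
        rintro rfl
        have := hc i
        rw [pt_self] at this
        cases b <;> simp at this
      have h2 : t ∈ closure (u ∩ Ioo (K.lo (oth i)) (K.hi (oth i))) := by
        rw [mem_closure_iff_nhds] at htu ⊢
        intro s hs
        obtain ⟨y, hy, hyu⟩ := htu _ (inter_mem hs (Ioo_mem_nhds ht.1 ht.2))
        exact ⟨y, hy.1, hyu, hy.2⟩
      exact closure_minimal hsub hclosed h2
    obtain ⟨K', hK', hz⟩ := mem_region.1 hreg
    obtain ⟨hne, hK'M⟩ := Finset.mem_erase.1 hK'
    rcases Rect.trichotomy hz with h1 | ⟨i', b', h1⟩ | h1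
    · exact hn (hM.subset K' hK'M h1)
    · obtain ⟨rfl, rfl, -⟩ := hM.adj_of_midSide hK hK'M hne.symm hm h1
      exact hM.not_midSide_midSide hΩ hf hK hK'M hm h1
    · exact (IsMesh.isConformingNode_of_mem_frontier hf ⟨K', hK'M, h1⟩).not_isMidSide hKM hM hΩ.1
        ⟨K, hK, i, b, hm⟩
  have hall : ∀ t ∈ Ioo (K.lo (oth i)) (K.hi (oth i)), pt i (K.bd i b) t ∉ Ω := by
    intro t ht htΩ
    have h1 := isPreconnected_Ioo.subset_of_closure_inter_subset huo ⟨t, ht, htΩ⟩ hcl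
    have h2 : pt i (K.bd i b) (x (oth i)) ∈ Ω := h1 ⟨h.lo_lt, h.lt_hi⟩
    rw [← h.eq, pt_eta] at h2
    rw [hΩ.1.frontier_eq] at hx
    exact hx.2 h2
  have hclosed : IsClosed ((fun t => pt i (K.bd i b) t) ⁻¹' Ωᶜ) := hΩ.1.isClosed_compl.preimage hpt
  have hIcc : Icc (K.lo (oth i)) (K.hi (oth i)) ⊆ (fun t => pt i (K.bd i b) t) ⁻¹' Ωᶜ := by
    rw [← closure_Ioo hlt.ne]
    exact closure_minimal hall hclosed
  rintro y ⟨hy1, hy2⟩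
  have hyK : y ∈ closure K.carrier := by
    rw [Rect.mem_closure, forall_coord i, hy1]
    exact ⟨⟨K.lo_le_bd _ _, K.bd_le_hi _ _⟩, hy2⟩
  have hyΩ : y ∉ Ω := by
    have := hIcc hy2
    rwa [mem_preimage, ← hy1, pt_eta] at this
  refine ⟨⟨hyK, ?_⟩, hM.closure_subset hK hyK, ?_⟩
  · rw [K.isOpen_carrier.interior_eq]; exact fun h => hyΩ (hM.subset K hK h)
  · rwa [hΩ.1.interior_eq]

/-- Elements touching the nodes whose polynomials vanish at the node if `v` vanishes on the
boundary. -/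
theorem IsMesh.exists_nodeElement (hM : IsMesh Ω M) (hΩ : IsBoundedLipschitz Ω) :
    ∃ K₀ : Plane → Rect, (∀ z, IsNode M z → K₀ z ∈ M ∧ z ∈ closure (K₀ z).carrier) ∧
      ∀ z ∈ frontier Ω, ∀ (p : ℕ) (v : BrokenPoly M p), v.VanishesOnBoundary Ω →
        polyEval (extendPoly M p v (K₀ z)) z = 0 := by
  have h : ∀ z, ∃ K : Rect, (IsNode M z → K ∈ M ∧ z ∈ closure K.carrier) ∧
      (z ∈ frontier Ω → ∀ (p : ℕ) (v : BrokenPoly M p), v.VanishesOnBoundary Ω →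
        polyEval (extendPoly M p v K) z = 0) := by
    intro z
    by_cases hz : z ∈ frontier Ω
    · obtain ⟨K, hK, hzK, i, l, u, hlu, hs⟩ := hM.exists_boundary_segment hΩ hz
      refine ⟨K, fun _ => ⟨hK, hzK⟩, fun _ p v hv => ?_⟩
      have := hv.lineTrace_eq_zero hK hlu hs
      rw [← pt_eta i z, ← eval_lineTrace, this, Polynomial.eval_zero]
    · by_cases hn : IsNode M z
      · obtain ⟨K, hK, hv⟩ := hn
        exact ⟨K, fun _ => ⟨hK, K.vertices_subset_closure hv⟩, fun h => (hz h).elim⟩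
      · exact ⟨⟨fun _ => 0, fun _ => 1, fun _ => one_pos⟩, fun h => (hn h).elim,
          fun h => (hz h).elim⟩
  choose K₀ h1 h2 using h
  exact ⟨K₀, h1, h2⟩

theorem agrees_add_blending {β : Polynomial ℝ} {V : Rect → MvPolynomial (Fin 2) ℝ} {N : Plane → ℝ}
    (hM : IsMesh Ω M) (hβ : IsCutoff p β) (hN : IsConsistent M β V N) :
    Agrees M (fun K => V K + blending M β V N K) := fun _ hK _ hK' _ hx hx' =>
  polyEval_add_blending_agree hM hβ hN hK hK' hx hx'

/-- Boundary nodes are not hanging, so their values come from the elements `K₀`, which vanish there.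
A side meeting the boundary in an interior point lies in it entirely and has no owner; its own trace
and both end corrections are zero. -/
theorem glue_eq_zero_of_mem_frontier {C₀ : ℝ} {β : Polynomial ℝ} {N : Plane → ℝ} {K₀ : Plane → Rect}
    (hM : IsMesh Ω M) (hΩ : IsBoundedLipschitz Ω) (hKM : IsKMesh C₀ Ω M) (hβ : IsCutoff p β)
    {v : BrokenPoly M p} (hv : v.VanishesOnBoundary Ω)
    (hN : IsConsistent M β (extendPoly M p v) N)
    (hN' : ∀ z, IsNode M z → ¬ IsMidSide M z → N z = polyEval (extendPoly M p v (K₀ z)) z)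
    (hK₀ : ∀ z ∈ frontier Ω, polyEval (extendPoly M p v (K₀ z)) z = 0) {x : Plane}
    (hx : x ∈ frontier Ω) :
    glue M (fun K => extendPoly M p v K + blending M β (extendPoly M p v) N K) x = 0 := by
  have hnode : ∀ z ∈ frontier Ω, IsNode M z → N z = 0 := fun z hz hn => by
    rw [hN' z hn ((IsMesh.isConformingNode_of_mem_frontier hz hn).not_isMidSide hKM hM hΩ.1),
      hK₀ z hz]
  have hxr : x ∈ region M := by rw [hM.cover]; exact hx.1
  obtain ⟨K, hK, hxK⟩ := mem_region.1 hxr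
  rw [glue_eq (agrees_add_blending hM hβ hN) hK hxK]
  rcases Rect.trichotomy hxK with h | ⟨i, b, h⟩ | h
  · rw [hΩ.1.frontier_eq] at hx
    exact (hx.2 (hM.subset K hK h)).elim
  · have hs := hM.side_subset_frontier hΩ hKM hK hx h
    have hl := hv.lineTrace_eq_zero hK (K.lo_lt_hi (oth i)) hs
    have hend : ∀ b', N (K.endPt i b b') = 0 ∧
        polyEval (extendPoly M p v K) (K.endPt i b b') = 0 := by
      intro b'
      refine ⟨hnode _ (hs ?_).2 ⟨K, hK, K.endPt_mem_vertices i b b'⟩, ?_⟩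
      · rw [Rect.endPt]
        exact ⟨by simp, by simpa using K.lo_le_bd _ b', by simpa using K.bd_le_hi _ b'⟩
      · rw [Rect.endPt, ← eval_lineTrace, hl, Polynomial.eval_zero]
    rw [polyEval_add_blending hM hβ hN hK h.eq, ownerTrace_eq_of_not, sideTrace, hl, (hend _).1,
      (hend _).1, (hend _).2, (hend _).2]
    · simp
    · rintro ⟨K', hK'⟩
      exact hM.not_midSide_midSide hΩ hx hK hK'.mem h (hK'.midSide h)
  · rw [polyEval_add_blending_vertex hM hβ hN hK h]
    exact hnode x hx ⟨K, hK, h⟩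

end Boundary

/-! ### The projection -/

section Linearity

variable {M : Finset Rect} {β : Polynomial ℝ} (V V' : Rect → MvPolynomial (Fin 2) ℝ)
  (N N' : Plane → ℝ) (a : ℝ)

theorem sideTrace_add (K : Rect) (i : Fin 2) (b : Bool) :
    sideTrace β (V + V') (N + N') K i b = sideTrace β V N K i b + sideTrace β V' N' K i b := by
  simp only [sideTrace, Pi.add_apply, map_add, polyEval_add, map_sub]
  ring

theorem sideTrace_smul (K : Rect) (i : Fin 2) (b : Bool) :
    sideTrace β (a • V) (a • N) K i b = a • sideTrace β V N K i b := by
  simp only [sideTrace, Pi.smul_apply, map_smul, polyEval_smul, map_sub, smul_eq_mul, map_mul,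
    Polynomial.smul_eq_C_mul]
  ring

theorem traceDefect_add (K : Rect) (i : Fin 2) (b : Bool) :
    traceDefect M β (V + V') (N + N') K i b =
      traceDefect M β V N K i b + traceDefect M β V' N' K i b := by
  rw [traceDefect, traceDefect, traceDefect, ownerTrace, ownerTrace, ownerTrace]
  split_ifs <;> rw [sideTrace_add, Pi.add_apply, map_add] <;> ring

theorem traceDefect_smul (K : Rect) (i : Fin 2) (b : Bool) :
    traceDefect M β (a • V) (a • N) K i b = a • traceDefect M β V N K i b := by
  rw [traceDefect, traceDefect, ownerTrace, ownerTrace]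
  split_ifs <;> rw [sideTrace_smul, Pi.smul_apply, map_smul, smul_sub]

theorem liftSides_add (K : Rect) (i : Fin 2) :
    liftSides M β (V + V') (N + N') K i = liftSides M β V N K i + liftSides M β V' N' K i := by
  simp only [liftSides, traceDefect_add, map_add]
  ring

theorem liftSides_smul (K : Rect) (i : Fin 2) :
    liftSides M β (a • V) (a • N) K i = a • liftSides M β V N K i := by
  simp only [liftSides, traceDefect_smul, map_smul, mul_smul_comm, smul_add]

theorem liftVertex_add (K : Rect) (b b' : Bool) :
    liftVertex β (V + V') (N + N') K b b' = liftVertex β V N K b b' + liftVertex β V' N' K b b' := by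
  simp only [liftVertex, Pi.add_apply, polyEval_add, ← add_smul]
  congr 1; ring

theorem liftVertex_smul (K : Rect) (b b' : Bool) :
    liftVertex β (a • V) (a • N) K b b' = a • liftVertex β V N K b b' := by
  simp only [liftVertex, Pi.smul_apply, polyEval_smul, smul_eq_mul, smul_smul, mul_sub]

theorem blending_add (K : Rect) :
    blending M β (V + V') (N + N') K = blending M β V N K + blending M β V' N' K := by
  simp only [blending, liftSides_add, liftVertex_add]
  ring

theorem blending_smul (K : Rect) :
    blending M β (a • V) (a • N) K = a • blending M β V N K := by
  simp only [blending, liftSides_smul, liftVertex_smul, ← smul_add, ← smul_sub]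

end Linearity

/-- The conforming projection determined by a cutoff polynomial and nodal values. -/
def blendingProjection {M : Finset Rect} {β : Polynomial ℝ} {p : ℕ} (hβ : IsCutoff p β)
    (N : BrokenPoly M p →ₗ[ℝ] (Plane → ℝ)) : BrokenPoly M p →ₗ[ℝ] BrokenPoly M p where
  toFun v K := ⟨extendPoly M p v K.1 + blending M β (extendPoly M p v) (N v) K.1,
    Submodule.add_mem _ (extendPoly_mem v K.1) (blending_mem hβ (extendPoly_mem v) K.1)⟩
  map_add' v w := by
    ext1 K
    refine Subtype.ext ?_
    simp only [map_add, blending_add, Pi.add_apply, Submodule.coe_add]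
    ring
  map_smul' a v := by
    ext1 K
    refine Subtype.ext ?_
    simp only [map_smul, blending_smul, Pi.smul_apply, Submodule.coe_smul, RingHom.id_apply,
      smul_add]

/-! ### Patches of comparable elements and the local estimate by the jumps -/

section Estimate

variable {Ω : Set Plane} {M : Finset Rect} {κ C₀ R c : ℝ} {p : ℕ}

open Classical in
/-- The elements within distance `R h_K`. -/
def patch (M : Finset Rect) (R : ℝ) (K : Rect) : Finset Rect :=
  M.filter fun K' => K'.carrier ⊆ Metric.closedBall (K.endPt 0 false false) (R * K.h)

theorem mem_patch {K K' : Rect} : K' ∈ patch M R K ↔ K' ∈ M ∧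
    K'.carrier ⊆ Metric.closedBall (K.endPt 0 false false) (R * K.h) := by
  simp [patch]

/-- The elements of the patch with a size comparable to `h_K`. -/
def comparablePatch (M : Finset Rect) (R : ℝ) (K : Rect) : Set Rect :=
  {K' | K' ∈ patch M R K ∧ K.h ≤ R * K'.h ∧ K'.h ≤ R * K.h}

theorem diam_region_patch_le (hR : 0 ≤ R) (K : Rect) :
    Metric.diam (region (patch M R K)) ≤ 2 * R * K.h := by
  have hsub : region (patch M R K) ⊆ Metric.closedBall (K.endPt 0 false false) (R * K.h) := by
    intro x hx
    obtain ⟨K', hK', hxK⟩ := mem_region.1 hx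
    exact closure_minimal (mem_patch.1 hK').2 Metric.isClosed_closedBall hxK
  refine (Metric.diam_mono hsub Metric.isBounded_closedBall).trans ?_
  refine (Metric.diam_closedBall (mul_nonneg hR K.h_pos.le)).trans (le_of_eq ?_)
  ring

theorem endPt_mem_closure (K : Rect) (i : Fin 2) (b b' : Bool) :
    K.endPt i b b' ∈ closure K.carrier :=
  K.vertices_subset_closure (K.endPt_mem_vertices i b b')

/-- Comparison of `K` with itself. -/
theorem IsKMesh.one_le (hKM : IsKMesh C₀ Ω M) (hM : IsMesh Ω M) (hΩ : IsBoundedLipschitz Ω)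
    {K : Rect} (hK : K ∈ M) : 1 ≤ C₀ := by
  have h := (hKM.comparable hM hΩ ⟨K, hK, K.endPt_mem_vertices 0 false false⟩ .refl hK hK
    (endPt_mem_closure K _ _ _) (endPt_mem_closure K _ _ _)).1
  exact le_of_mul_le_mul_right (by linarith) K.h_pos

/-- Elements at nodes which can be reached from a vertex of an element `K₁` that shares a node with
`K` belong to the comparable patch of `K`. -/
theorem mem_comparablePatch (hM : IsMesh Ω M) (hΩ : IsBoundedLipschitz Ω) (hKM : IsKMesh C₀ Ω M)
    (hR : 1 + C₀ + 2 * C₀ ^ 2 ≤ R) {K K₁ K' : Rect} (hK : K ∈ M) (hK₁ : K₁ ∈ M) (hK' : K' ∈ M)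
    {z z₁ z' : Plane} (hz : IsNode M z) (hzK : z ∈ closure K.carrier)
    (hzK₁ : z ∈ closure K₁.carrier) (hz₁ : IsNode M z₁) (hz₁K₁ : z₁ ∈ closure K₁.carrier)
    (hr : MeshReach M z₁ z') (hz' : z' ∈ closure K'.carrier) :
    K' ∈ comparablePatch M R K ∧ dist z₁ z' ≤ R * K.h := by
  have h1 := hKM.one_le hM hΩ hK
  obtain ⟨a1, a2, -⟩ := hKM.comparable hM hΩ hz .refl hK hK₁ hzK hzK₁
  obtain ⟨b1, b2, b3⟩ := hKM.comparable hM hΩ hz₁ hr hK₁ hK' hz₁K₁ hz'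
  have hh := K.h_pos
  have hh' := K'.h_pos
  have c1 : C₀ * K₁.h ≤ C₀ ^ 2 * K.h := by nlinarith
  have c2 : K.h ≤ C₀ ^ 2 * K'.h := by nlinarith
  have hR' : C₀ ^ 2 ≤ R := by nlinarith
  have c3 : C₀ ^ 2 * K.h ≤ R * K.h := mul_le_mul_of_nonneg_right hR' hh.le
  have c4 : C₀ ^ 2 * K'.h ≤ R * K'.h := mul_le_mul_of_nonneg_right hR' hh'.le
  have c5 : (1 + C₀ + 2 * C₀ ^ 2) * K.h ≤ R * K.h := mul_le_mul_of_nonneg_right hR hh.le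
  refine ⟨⟨mem_patch.2 ⟨hK', fun x hx => ?_⟩, by linarith, by linarith⟩, by linarith⟩
  rw [Metric.mem_closedBall, dist_comm]
  have d1 := K.dist_le_h (endPt_mem_closure K 0 false false) hzK
  have d2 := K₁.dist_le_h hzK₁ hz₁K₁
  have d3 := K'.dist_le_h hz' (subset_closure hx)
  have d4 := dist_triangle (K.endPt 0 false false) z x
  have d5 := dist_triangle z z₁ x
  have d6 := dist_triangle z₁ z' x
  linarith

theorem mem_comparablePatch_self (hM : IsMesh Ω M) (hΩ : IsBoundedLipschitz Ω)
    (hKM : IsKMesh C₀ Ω M) (hR : 1 + C₀ + 2 * C₀ ^ 2 ≤ R) {K : Rect} (hK : K ∈ M) :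
    K ∈ comparablePatch M R K :=
  have hz : IsNode M (K.endPt 0 false false) := ⟨K, hK, K.endPt_mem_vertices _ _ _⟩
  have hc := endPt_mem_closure K 0 false false
  (mem_comparablePatch hM hΩ hKM hR hK hK hK hz hc hc hz hc .refl hc).1

/-- The constant in the bound of the blending by the jumps. -/
def blendingConst (R c : ℝ) : ℝ :=
  2 * R * (96 + 448 * R * (1056 * R * c * (1 + 2 * (R ^ 2 * c) ^ 2) ^ 2))

/-- All elements entering the correction on `K`, including those on which the vertex values of an
owner depend, lie in the comparable patch. Hence one width `w`, proportional to `h_K`, serves in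
every inverse inequality and in the barrier. -/
theorem blending_sq_le_of_edgeBound {β : Polynomial ℝ} {V : Rect → MvPolynomial (Fin 2) ℝ}
    {N : Plane → ℝ} {K₀ : Plane → Rect} {B : ℝ} (hM : IsMesh Ω M) (hΩ : IsBoundedLipschitz Ω)
    (hsr : IsShapeRegular κ M) (hKM : IsKMesh C₀ Ω M) (hβ : IsCutoff p β) (hp : 1 ≤ p)
    (hV : ∀ K, V K ∈ Qp p) (hN : IsConsistent M β V N)
    (hK₀ : ∀ z, IsNode M z → K₀ z ∈ M ∧ z ∈ closure (K₀ z).carrier)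
    (hN₀ : ∀ z, IsNode M z → ¬ IsMidSide M z → N z = polyEval (V (K₀ z)) z)
    (hR : 1 + C₀ + 2 * C₀ ^ 2 ≤ R) (hc : 1 + κ ≤ c) (hc0 : 0 < c) {K : Rect} (hK : K ∈ M)
    (hB : EdgeBound V (comparablePatch M R K) B) :
    ∫ x in K.carrier, polyEval (blending M β V N K) x ^ 2 ≤
      blendingConst R c * (B ^ 2 * K.h / (p : ℝ) ^ 2) := by
  have h1 := hKM.one_le hM hΩ hK
  have hR0 : 0 < R := by nlinarith
  have hh := K.h_pos
  have hp0 : (0 : ℝ) < p := by exact_mod_cast hp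
  -- Comparability costs `R` and shape regularity costs `c` in the lower bound for side lengths.
  set w := K.h / (R * c) with hw
  have hw0 : 0 < w := by positivity
  have hwidth : WidthBound (comparablePatch M R K) w := by
    intro K' hK' i
    have h2 := hsr.h_le (mem_patch.1 hK'.1).1 i
    have h3 : K'.h ≤ c * K'.width i :=
      h2.trans (mul_le_mul_of_nonneg_right hc (K'.width_pos i).le)
    rw [hw, div_le_iff₀ (by positivity)]
    calc K.h ≤ R * K'.h := hK'.2.1
      _ ≤ R * (c * K'.width i) := mul_le_mul_of_nonneg_left h3 hR0.le
      _ = K'.width i * (R * c) := by ring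
  set D := (1 + 2 * (R * K.h / w) ^ 2) * (2 * √(264 * (p : ℝ) ^ 2 / w * B ^ 2)) with hD
  have hnode : ∀ K₁ ∈ M, ∀ z, IsNode M z → z ∈ closure K.carrier → z ∈ closure K₁.carrier →
      ∀ i b b', |N (K₁.endPt i b b') - polyEval (V K₁) (K₁.endPt i b b')| ≤ D := by
    intro K₁ hK₁ z hz hzK hzK₁ i b b'
    have hz₁ : IsNode M (K₁.endPt i b b') := ⟨K₁, hK₁, K₁.endPt_mem_vertices _ _ _⟩
    have hz₁K := endPt_mem_closure K₁ i b b'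
    have hreach : ∀ z', MeshReach M (K₁.endPt i b b') z' → ∀ K' ∈ M, z' ∈ closure K'.carrier →
        K' ∈ comparablePatch M R K ∧ dist (K₁.endPt i b b') z' ≤ R * K.h := fun z' hr K' hK' hz' =>
      mem_comparablePatch hM hΩ hKM hR hK hK₁ hK' hz hzK hzK₁ hz₁ hz₁K hr hz'
    refine abs_nodal_sub_le hM hΩ hKM hβ hp hV hN hK₀ hN₀ hB hwidth hw0 hz₁
      (fun z' hr K' hK' hz' => (hreach z' hr K' hK' hz').1) (fun z' hr => ?_) hK₁ hz₁K
    obtain ⟨K', hK', hv⟩ := hr.isNode hz₁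
    exact (hreach z' hr K' hK' (K'.vertices_subset_closure hv)).2
  have hself := mem_comparablePatch_self hM hΩ hKM hR hK
  have hend : ∀ i b b', IsNode M (K.endPt i b b') := fun i b b' =>
    ⟨K, hK, K.endPt_mem_vertices _ _ _⟩
  have hbound := integral_blending_sq_le (S := comparablePatch M R K) (W := R * K.h) (D := D) hM hβ
    hself hB (fun i => (K.width_le_h i).trans hself.2.2)
    (hnode K hK _ (hend 0 false false) (endPt_mem_closure K _ _ _) (endPt_mem_closure K _ _ _))
    (N := N) fun i b K₁ ho => by
      have hzK₁ : K.endPt i b false ∈ closure K₁.carrier := by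
        rw [Rect.mem_closure, forall_coord i, Rect.endPt, pt_self, pt_oth, ho.adj.eq]
        exact ⟨⟨K₁.lo_le_bd _ _, K₁.bd_le_hi _ _⟩, ho.lo_le.trans (K.lo_le_bd _ _),
          (K.bd_le_hi _ _).trans ho.le_hi⟩
      have hzK := endPt_mem_closure K i b false
      have hmem := (mem_comparablePatch hM hΩ hKM hR hK hK ho.mem (hend i b false) hzK hzK
        (hend i b false) hzK .refl hzK₁).1
      exact ⟨hmem, fun k => (K₁.width_le_h k).trans hmem.2.2,
        hnode K₁ ho.mem _ (hend i b false) hzK hzK₁ i⟩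
  refine hbound.trans (le_of_eq ?_)
  -- The factor `p²` lost here to the inverse inequality cancels against the extra `p⁻²` that
  -- accompanies `D²` in the bound of the blending.
  have hD2 : D ^ 2 = 1056 * R * c * (1 + 2 * (R ^ 2 * c) ^ 2) ^ 2 * ((p : ℝ) ^ 2 * B ^ 2 / K.h) := by
    have e : R * K.h / w = R ^ 2 * c := by rw [hw]; field_simp
    rw [hD, mul_pow, mul_pow, Real.sq_sqrt (by positivity), e, hw]
    field_simp
    ring
  rw [hD2, blendingConst]
  field_simp
  ring

/-- All terms are nonnegative, so one ordered pair is kept; the factor `2` undoes the `1 / 2` in the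
norm. -/
theorem setIntegral_interface_le_jumpNorm (ρ : ℝ → ℝ) (v : BrokenPoly M p) {S : Finset Rect}
    {K K' : Rect} (hK : K ∈ M) (hK' : K' ∈ M) (hs : IsInteriorSide K K')
    (hS : K.interface K' ⊆ region S) :
    ∫ x in K.interface K', (ρ ((K.h + K'.h) / 2) *
        (polyEval (extendPoly M p v K) x - polyEval (extendPoly M p v K') x)) ^ 2
      ∂(μH[1] : Measure Plane) ≤ 2 * jumpNorm ρ v S ^ 2 := by
  classical
  have hnn : ∀ K K' : {K // K ∈ M}, 0 ≤
      (if IsInteriorSide K.1 K'.1 ∧ K.1.interface K'.1 ⊆ region S then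
      ∫ x in K.1.interface K'.1, (ρ ((K.1.h + K'.1.h) / 2) *
        (polyEval (v K : MvPolynomial (Fin 2) ℝ) x -
          polyEval (v K' : MvPolynomial (Fin 2) ℝ) x)) ^ 2 ∂(μH[1] : Measure Plane)
    else 0) := by
    intro K K'
    split_ifs
    · exact integral_nonneg fun _ => sq_nonneg _
    · exact le_rfl
  have h1 := Finset.single_le_sum (fun K' _ => hnn ⟨K, hK⟩ K') (Finset.mem_univ ⟨K', hK'⟩)
  have h2 := Finset.single_le_sum (fun K _ => Finset.sum_nonneg (s := Finset.univ) fun K' _ => hnn K K')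
    (Finset.mem_univ (⟨K, hK⟩ : {K // K ∈ M}))
  rw [if_pos ⟨hs, hS⟩] at h1
  rw [jumpNorm, Real.sq_sqrt (mul_nonneg (by norm_num)
    (Finset.sum_nonneg fun K _ => Finset.sum_nonneg fun K' _ => hnn K K'))]
  have h3 := h1.trans h2
  rw [extendPoly_of_mem v ⟨K, hK⟩, extendPoly_of_mem v ⟨K', hK'⟩]
  linarith

/-- On the comparable patch the mesh function, being a mean of two diameters, stays within the
factor `R` of `h_K`. The weight can therefore be replaced by its lower bound `m`. -/
theorem edgeBound_of_jumpNorm (hM : IsMesh Ω M) (ρ : ℝ → ℝ) (v : BrokenPoly M p) {K : Rect} {m : ℝ}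
    (hm : 0 < m) (hρ : ∀ t, K.h ≤ R * t → t ≤ R * K.h → m ≤ ρ t ^ 2) :
    EdgeBound (extendPoly M p v) (comparablePatch M R K)
      √(2 * jumpNorm ρ v (patch M R K) ^ 2 / m) := by
  intro K₁ h₁ K₂ h₂ i b hadj
  have hK₁ := (mem_patch.1 h₁.1).1
  have hK₂ := (mem_patch.1 h₂.1).1
  have hsub : K₁.interface K₂ ⊆ region (patch M R K) := fun x hx =>
    mem_region.2 ⟨K₁, h₁.1, hx.1.1⟩
  have h := setIntegral_interface_le_jumpNorm ρ v hK₁ hK₂ (hM.isInteriorSide_of_adj hK₁ hK₂ hadj) hsub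
  rw [hM.interface_eq_of_adj hK₁ hK₂ hadj] at h
  change ∫ x in coordSegment i (K₁.bd i b) (K₁.commonLo K₂ (oth i)) (K₁.commonHi K₂ (oth i)), _
    ∂(μH[1] : Measure Plane) ≤ _ at h
  rw [setIntegral_coordSegment _ _ hadj.commonLo_lt.le] at h
  simp only [mul_pow, ← polyEval_sub] at h
  rw [intervalIntegral.integral_const_mul] at h
  have h0 : 0 ≤ ∫ t in K₁.commonLo K₂ (oth i)..K₁.commonHi K₂ (oth i),
      polyEval (extendPoly M p v K₁ - extendPoly M p v K₂) (pt i (K₁.bd i b) t) ^ 2 :=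
    intervalIntegral.integral_nonneg hadj.commonLo_lt.le fun _ _ => sq_nonneg _
  have hρ' := hρ ((K₁.h + K₂.h) / 2) (by linarith [h₁.2.1, h₂.2.1]) (by linarith [h₁.2.2, h₂.2.2])
  rw [Real.sq_sqrt (by positivity), le_div_iff₀ hm, mul_comm]
  exact (mul_le_mul_of_nonneg_right hρ' h0).trans h

end Estimate

theorem l2Norm_neg (K : Rect) (q : MvPolynomial (Fin 2) ℝ) : l2Norm K (-q) = l2Norm K q := by
  simp only [l2Norm, polyEval_neg, neg_sq]

theorem gradL2Norm_neg (K : Rect) (q : MvPolynomial (Fin 2) ℝ) :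
    gradL2Norm K (-q) = gradL2Norm K q := by
  simp only [gradL2Norm, map_neg, polyEval_neg, neg_sq]

/-- The inverse inequality for the gradient on shape regular rectangles. -/
theorem Rect.gradL2Norm_sq_le (K : Rect) {p : ℕ} (hp : 1 ≤ p) {q : MvPolynomial (Fin 2) ℝ}
    (hq : q ∈ Qp p) {c : ℝ} (hc : ∀ i, K.h ≤ c * K.width i) :
    gradL2Norm K q ^ 2 ≤
      16896 * (p : ℝ) ^ 4 * c ^ 2 / K.h ^ 2 * ∫ x in K.carrier, polyEval q x ^ 2 := by
  have hh := K.h_pos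
  have hI : 0 ≤ ∫ x in K.carrier, polyEval q x ^ 2 := integral_nonneg fun _ => sq_nonneg _
  have hi : ∀ i, IntegrableOn (fun x => polyEval (MvPolynomial.pderiv i q) x ^ 2) K.carrier :=
    fun i => integrableOn_of_continuous ((continuous_polyEval _).pow 2) K
  rw [gradL2Norm, Real.sq_sqrt (integral_nonneg fun _ => Finset.sum_nonneg fun _ _ => sq_nonneg _),
    integral_finsetSum _ fun i _ => hi i]
  have key : ∀ i, ∫ x in K.carrier, polyEval (MvPolynomial.pderiv i q) x ^ 2 ≤
      8448 * (p : ℝ) ^ 4 * c ^ 2 / K.h ^ 2 * ∫ x in K.carrier, polyEval q x ^ 2 := by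
    intro i
    refine (K.integral_pderiv_sq_le hp hq i).trans (mul_le_mul_of_nonneg_right ?_ hI)
    have hw := K.width_pos i
    rw [div_le_div_iff₀ (by positivity) (by positivity)]
    have h1 : K.h ^ 2 ≤ (c * K.width i) ^ 2 := pow_le_pow_left₀ hh.le (hc i) 2
    calc 8448 * (p : ℝ) ^ 4 * K.h ^ 2 ≤ 8448 * (p : ℝ) ^ 4 * (c * K.width i) ^ 2 :=
          mul_le_mul_of_nonneg_left h1 (by positivity)
      _ = _ := by ring
  rw [Fin.sum_univ_two]
  refine (add_le_add (key 0) (key 1)).trans (le_of_eq ?_)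
  ring

theorem blendingConst_pos {R c : ℝ} (hR : 0 < R) (hc : 0 < c) : 0 < blendingConst R c := by
  rw [blendingConst]; positivity

theorem le_sqrt_mul_of_sq_le {x y a : ℝ} (hy : 0 ≤ y) (h : x ^ 2 ≤ a * y ^ 2) : x ≤ √a * y := by
  have := Real.abs_le_sqrt h
  rw [Real.sqrt_mul' _ (sq_nonneg y), Real.sqrt_sq hy] at this
  exact (le_abs_self x).trans this

end
-- The conforming projection and its two error bounds
theorem lemma3p2 (κ C₀ : ℝ) :
    ∃ C : ℝ, 0 < C ∧
      ∀ (Ω : Set Plane) (M : Finset Rect), IsBoundedLipschitz Ω → IsMesh Ω M →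
        IsShapeRegular κ M → IsKMesh C₀ Ω M →
        ∃ W : {K : Rect // K ∈ M} → Finset Rect,
          (∀ K, K.1 ∈ W K ∧ W K ⊆ M ∧ Metric.diam (region (W K)) ≤ C * K.1.h) ∧
          ∀ p : ℕ, 1 ≤ p →
            ∃ π : BrokenPoly M p →ₗ[ℝ] BrokenPoly M p,
              ∀ v : BrokenPoly M p,
                MemH1 Ω (π v).toFunction ∧
                (∀ K : {K : Rect // K ∈ M},
                  l2Norm K.1 ((v K : MvPolynomial (Fin 2) ℝ) - (π v K : MvPolynomial (Fin 2) ℝ))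
                      ≤ C * jumpNorm (fun h => (p : ℝ)⁻¹ * Real.sqrt h) v (W K) ∧
                  gradL2Norm K.1
                      ((v K : MvPolynomial (Fin 2) ℝ) - (π v K : MvPolynomial (Fin 2) ℝ))
                      ≤ C * jumpNorm (fun h => (p : ℝ) * (Real.sqrt h)⁻¹) v (W K)) ∧
                (v.VanishesOnBoundary Ω → MemH10 Ω (π v).toFunction) := by
  -- Absolute values keep `R` and `c` positive for arbitrary real constants, before any mesh is
  -- given.
  set R : ℝ := 1 + |C₀| + 2 * C₀ ^ 2 with hRdef
  set c : ℝ := 1 + |κ| with hcdef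
  have hR1 : 1 + C₀ + 2 * C₀ ^ 2 ≤ R := by linarith [le_abs_self C₀]
  have hR0 : 0 < R := by positivity
  have hc1 : 1 + κ ≤ c := by linarith [le_abs_self κ]
  have hc0 : 0 < c := by positivity
  -- The factor `2 * R` comes from removing the weight of the jump norm, and is the same in both
  -- estimates.
  set A := 2 * R * blendingConst R c with hA
  have hA0 : 0 < A := mul_pos (by positivity) (blendingConst_pos hR0 hc0)
  refine ⟨2 * R + √A + √(16896 * c ^ 2 * A), by positivity, ?_⟩
  intro Ω M hΩ hM hsr hKM
  refine ⟨fun K => patch M R K.1, fun K => ⟨?_, fun K' hK' => (mem_patch.1 hK').1, ?_⟩, ?_⟩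
  · exact (mem_comparablePatch_self hM hΩ hKM hR1 K.2).1
  · refine (diam_region_patch_le hR0.le K.1).trans
      (mul_le_mul_of_nonneg_right ?_ K.1.h_pos.le)
    linarith [Real.sqrt_nonneg A, Real.sqrt_nonneg (16896 * c ^ 2 * A)]
  intro p hp
  have hp0 : (0 : ℝ) < p := by exact_mod_cast hp
  obtain ⟨β, hβ1, hβ2, hβ3, hβ4, hβ5⟩ := UnitIntervalPoly.exists_cutoff hp
  have hβ : IsCutoff p β := ⟨hβ1, hβ2, hβ3, hβ4, hβ5⟩
  obtain ⟨K₀, hK₀, hK₀'⟩ := hM.exists_nodeElement hΩ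
  obtain ⟨N, hN⟩ := exists_nodalValues (p := p) hM hβ K₀
  refine ⟨blendingProjection hβ N, fun v => ?_⟩
  have hagree := agrees_add_blending hM hβ (hN v).1
  have hπ : ∀ K : {K // K ∈ M}, ((blendingProjection hβ N v K : Qp p) : MvPolynomial (Fin 2) ℝ) =
      extendPoly M p v K.1 + blending M β (extendPoly M p v) (N v) K.1 := fun K => rfl
  refine ⟨⟨_, isL2WeakGradient_toFunction hM hΩ.1 _ hπ hagree⟩, fun K => ?_, fun hv => ?_⟩
  · have hh := K.1.h_pos
    have hdiff : (v K : MvPolynomial (Fin 2) ℝ) - (blendingProjection hβ N v K : Qp p) =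
        -blending M β (extendPoly M p v) (N v) K.1 := by
      rw [hπ, extendPoly_of_mem]; ring
    have hest : ∀ (ρ : ℝ → ℝ) (m : ℝ), 0 < m →
        (∀ t, K.1.h ≤ R * t → t ≤ R * K.1.h → m ≤ ρ t ^ 2) →
        ∫ x in K.1.carrier, polyEval (blending M β (extendPoly M p v) (N v) K.1) x ^ 2 ≤
          blendingConst R c * (2 * jumpNorm ρ v (patch M R K.1) ^ 2 / m * K.1.h / (p : ℝ) ^ 2) := by
      intro ρ m hm hρ
      have h := blending_sq_le_of_edgeBound hM hΩ hsr hKM hβ hp (extendPoly_mem v) (hN v).1 hK₀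
        (hN v).2 hR1 hc1 hc0 K.2 (edgeBound_of_jumpNorm hM ρ v hm hρ)
      rwa [Real.sq_sqrt (by positivity)] at h
    rw [hdiff, l2Norm_neg, gradL2Norm_neg]
    constructor
    · set J := jumpNorm (fun h => (p : ℝ)⁻¹ * √h) v (patch M R K.1) with hJ
      have hJ0 : 0 ≤ J := Real.sqrt_nonneg _
      -- The squared weight is `t / p²`, smallest at the lower end `t = h_K / R` of the range.
      have h1 := hest (fun h => (p : ℝ)⁻¹ * √h) (K.1.h / (R * (p : ℝ) ^ 2)) (by positivity)
        fun t ht _ => by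
          have ht0 : 0 ≤ t := by
            by_contra hneg
            nlinarith
          rw [mul_pow, Real.sq_sqrt ht0, div_le_iff₀ (by positivity)]
          field_simp
          linarith
      rw [← hJ] at h1
      have h2 : l2Norm K.1 (blending M β (extendPoly M p v) (N v) K.1) ≤ √A * J := by
        refine le_sqrt_mul_of_sq_le hJ0 ?_
        rw [l2Norm, Real.sq_sqrt (integral_nonneg fun _ => sq_nonneg _)]
        refine h1.trans (le_of_eq ?_)
        rw [hA]
        field_simp
      refine h2.trans (mul_le_mul_of_nonneg_right ?_ hJ0)
      linarith [Real.sqrt_nonneg (16896 * c ^ 2 * A)]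
    · set J := jumpNorm (fun h => (p : ℝ) * (√h)⁻¹) v (patch M R K.1) with hJ
      have hJ0 : 0 ≤ J := Real.sqrt_nonneg _
      -- The squared weight is `p² / t`, smallest at the upper end `t = R h_K`.
      have h1 := hest (fun h => (p : ℝ) * (√h)⁻¹) ((p : ℝ) ^ 2 / (R * K.1.h)) (by positivity)
        fun t ht ht' => by
          have ht0 : 0 < t := by
            by_contra hneg
            nlinarith
          rw [mul_pow, inv_pow, Real.sq_sqrt ht0.le, ← div_eq_mul_inv]
          exact div_le_div_of_nonneg_left (by positivity) ht0 ht'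
      rw [← hJ] at h1
      have hw : ∀ i, K.1.h ≤ c * K.1.width i := fun i =>
        (hsr.h_le K.2 i).trans (mul_le_mul_of_nonneg_right hc1 (K.1.width_pos i).le)
      have h2 : gradL2Norm K.1 (blending M β (extendPoly M p v) (N v) K.1) ≤
          √(16896 * c ^ 2 * A) * J := by
        refine le_sqrt_mul_of_sq_le hJ0 ?_
        refine (K.1.gradL2Norm_sq_le hp (blending_mem hβ (extendPoly_mem v) K.1) hw).trans ?_
        refine (mul_le_mul_of_nonneg_left h1 (by positivity)).trans (le_of_eq ?_)
        rw [hA]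
        field_simp
      refine h2.trans (mul_le_mul_of_nonneg_right ?_ hJ0)
      linarith [Real.sqrt_nonneg A]
  · exact memH10_toFunction hM hΩ.1 hΩ.2.1 _ hπ hagree fun x hx =>
      glue_eq_zero_of_mem_frontier hM hΩ hKM hβ hv (hN v).1 (hN v).2
        (fun z hz => hK₀' z hz p v hv) hx
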